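/- Let $(M,g)$ be a smooth $n$-dimensional Riemannian manifold without boundary (Hausdorff, second countable), with Levi-Civita connection $\nabla^{LC}$ and volume measure $\operatorname{dvol}$. Let $E\to M$ be a finite rank smooth hermitian vector bundle with a metric preserving connection $\nabla$. Extend $\nabla$, using $\nabla^{LC}$, to the bundles $T^{*\otimes j}M\otimes E$, and put $\nabla^j=\nabla\circ\dots\circ\nabla$ ($j$ times). For hermitian bundles $V,W$ with connections, $\operatorname{Hom}(V,W)$ carries the induced hermitian metric and connection. * For a hermitian bundle $V$ with connection, $\mathcal C^\infty_b(M;V)$ is the space of smooth sections $s$ of $V$ such that $|\nabla^k s|$ is bounded on $M$ for all $k\ge 0$. * For a hermitian bundle $F$ with a metric preserving connection $\nabla^F$, $\operatorname{Diff}^\mu_{b,\nabla}(M;E,F)$ is the set of maps $P=\sum_{j=0}^\mu a^{[j]}\nabla^j$ on $\mathcal C^\infty_c(M;E)$ with $a^{[j]}\in\mathcal C_b^\infty(M;\operatorname{Hom}(T^{*\otimes j}M\otimes E,F))$, where boundedness refers to the connection induced by $\nabla^{LC}$, $\nabla$ and $\nabla^F$. * For $s\in\mathbb N$ and $p\in[1,\infty]$,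 $W^{s,p}_\nabla(M;E)$ is the space of $u$ whose distributional derivatives $\nabla^j u$ are in $L^p(M;T^{*\otimes j}M\otimes E)$ for $0\le j\le s$, and $\|u\|_{W^{s,p}_\nabla}$ is the $\ell^p$-norm of $(\|\nabla^ju\|_{L^p})_{0\le j\le s}$ (it is $+\infty$ if $u\notin W^{s,p}_\nabla$). The same notation is used for $T^*M\otimes\operatorname{End}(E)$. Let $A$ be a smooth section of $T^*M\otimes\operatorname{End}(E)$ with $A(X)^*=-A(X)$ for every tangent vector $X$, and let $\widetilde\nabla=\nabla+A$, which is again a metric preserving connection on $E$. Then the following holds. (i) Let $\mu\in\mathbb N$. Then $A\in\mathcal C_b^\infty(M;T^*M\otimes\operatorname{End}(E))$ (with respect to $\nabla$) if, and only if, $\operatorname{Diff}^\mu_{b,\nabla}(M;E,F)=\operatorname{Diff}^\mu_{b,\widetilde\nabla}(M;E,F)$ for all hermitian bundles $F$ with metric preserving connection $\nabla^F$ (only the connection of $E$ is changed, that of $F$ is kept). For the "if" part, the single bundle $F=T^{*\otimes\mu}M\otimes E$, with the connection induced by $\nabla^{LC}$ and $\nabla$, suffices. (ii) There is a function $C:\mathbb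 N\times[0,\infty)\to[1,\infty)$, independent of $M,g,E,\nabla,A,p$, such that the following holds for all $\ell\in\mathbb N$ and $p\in[1,\infty]$. If $\ell=0$, or if $\ell\ge1$ and $A\in W^{\ell-1,\infty}_\nabla(M;T^*M\otimes\operatorname{End}(E))$, then, with $C_\ell=C(\ell,\|A\|_{W^{\ell-1,\infty}_\nabla})$ (for $\ell=0$ the second argument is immaterial), every section $u$ of $E$ satisfies $$C_\ell^{-1}\|u\|_{W^{\ell,p}_\nabla(M;E)}\le\|u\|_{W^{\ell,p}_{\widetilde\nabla}(M;E)}\le C_\ell\|u\|_{W^{\ell,p}_\nabla(M;E)},$$ and $W^{\ell,p}_\nabla(M;E)=W^{\ell,p}_{\widetilde\nabla}(M;E)$. -/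

import Mathlib

open Bundle Manifold ContDiff MeasureTheory
open scoped ENNReal NNReal

namespace NablaSobolev

noncomputable section

/-! ### Vector fields, tensor fields, Levi-Civita connection -/

section Manifold

variable {n : ℕ} {M : Type*} [TopologicalSpace M] [ChartedSpace (EuclideanSpace ℝ (Fin n)) M]

/-- The tangent space of the `n`-dimensional manifold `M` at `x`. -/
abbrev Tan (n : ℕ) {M : Type*} [TopologicalSpace M] [ChartedSpace (EuclideanSpace ℝ (Fin n)) M]
    (x : M) : Type :=
  TangentSpace (𝓡 n) x

instance (x : M) : FiniteDimensional ℝ (Tan n x) :=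
  inferInstanceAs (FiniteDimensional ℝ (EuclideanSpace ℝ (Fin n)))

instance (x : M) : T2Space (Tan n x) :=
  inferInstanceAs (T2Space (EuclideanSpace ℝ (Fin n)))

/-- The fibre at `x` of `T*M ⊗ ⋯ ⊗ T*M ⊗ V` (with `k` factors `T*M`): the `k`-linear maps from
`T_x M` to `V x`. -/
abbrev Ten (n k : ℕ) {M : Type*} [TopologicalSpace M]
    [ChartedSpace (EuclideanSpace ℝ (Fin n)) M] (V : M → Type*) [∀ x, AddCommGroup (V x)]
    [∀ x, Module ℝ (V x)] (x : M) :=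
  MultilinearMap ℝ (fun _ : Fin k => Tan n x) (V x)

/-- An element of `V x` as an element of `Ten n 0 V x`. -/
abbrev ten0 (n : ℕ) {M : Type*} [TopologicalSpace M]
    [ChartedSpace (EuclideanSpace ℝ (Fin n)) M] {V : M → Type*} [∀ x, AddCommGroup (V x)]
    [∀ x, Module ℝ (V x)] {x : M} (e : V x) : Ten n 0 V x :=
  MultilinearMap.constOfIsEmpty ℝ _ e

/-- Globally defined smooth vector fields on `M`. -/
def SmoothField [IsManifold (𝓡 n) ∞ M] (X : Π x : M, Tan n x) : Prop :=
  ContMDiff (𝓡 n) ((𝓡 n).prod 𝓘(ℝ, EuclideanSpace ℝ (Fin n))) ∞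
    (fun x => TotalSpace.mk' (EuclideanSpace ℝ (Fin n)) (E := fun x : M => Tan n x) x (X x))

set_option synthInstance.maxHeartbeats 200000 in
/-- `D` is the Levi-Civita connection of the Riemannian manifold `M`: the (smooth) connection on
`TM` which is metric preserving and torsion-free. -/
structure IsLeviCivita [IsManifold (𝓡 n) ∞ M]
    [RiemannianBundle (fun x : M => TangentSpace (𝓡 n) x)]
    [IsContMDiffRiemannianBundle (𝓡 n) ∞ (EuclideanSpace ℝ (Fin n)) (fun x : M => TangentSpace (𝓡 n) x)]
    (D : CovariantDerivative (𝓡 n) (EuclideanSpace ℝ (Fin n)) (fun x : M => TangentSpace (𝓡 n) x)) : Prop where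
  smooth : CovariantDerivative.ContMDiffCovariantDerivative D ∞
  metric : D.IsMetricCompatible
  torsion_free : CovariantDerivative.torsion D = 0

/-- The divergence of the vector field `X`, i.e. the trace of `v ↦ ∇_v X`. -/
def divergence [IsManifold (𝓡 n) ∞ M]
    (D : CovariantDerivative (𝓡 n) (EuclideanSpace ℝ (Fin n)) (fun x : M => TangentSpace (𝓡 n) x))
    (X : Π x : M, Tan n x) (x : M) : ℝ :=
  LinearMap.trace ℝ (Tan n x) (D X x : Tan n x →ₗ[ℝ] Tan n x)

end Manifold

/-! ### Riemannian volume -/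

theorem exists_chart_cover (n : ℕ) (M : Type*) [TopologicalSpace M]
    [ChartedSpace (EuclideanSpace ℝ (Fin n)) M] [SecondCountableTopology M] [Nonempty M] :
    ∃ c : ℕ → M, ⋃ i, (chartAt (EuclideanSpace ℝ (Fin n)) (c i)).source = Set.univ := by
  obtain ⟨s, hs, hU⟩ := TopologicalSpace.countable_cover_nhds
    (fun x : M => chart_source_mem_nhds (EuclideanSpace ℝ (Fin n)) x)
  have hne : s.Nonempty := by
    by_contra h
    rw [Set.not_nonempty_iff_eq_empty] at h
    subst h
    exact Set.empty_ne_univ (by simpa using hU)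
  obtain ⟨c, rfl⟩ := hs.exists_eq_range hne
  exact ⟨c, by simpa using hU⟩

section Volume

variable {n : ℕ} {M : Type*} [TopologicalSpace M] [ChartedSpace (EuclideanSpace ℝ (Fin n)) M]
  [IsManifold (𝓡 n) ∞ M] [MeasurableSpace M] [BorelSpace M]

/-- The coordinate vector `∂ᵢ` at `x` in the chart centred at `c`. -/
def coordVector (c x : M) (i : Fin n) : Tan n x :=
  (trivializationAt (EuclideanSpace ℝ (Fin n)) (fun y : M => Tan n y) c).symm x
    (EuclideanSpace.basisFun (Fin n) ℝ i)

variable [RiemannianBundle (fun x : M => TangentSpace (𝓡 n) x)]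

/-- `√ det (g (∂ᵢ, ∂ⱼ))` in the chart centred at `c`. -/
def volumeDensity (c x : M) : ℝ :=
  √ (Matrix.of fun i j : Fin n => inner ℝ (coordVector c x i) (coordVector c x j)).det

/-- The measure `√ det (gᵢⱼ) dx¹ ⋯ dxⁿ` on the domain of the chart centred at `c`. -/
def chartVolume (c : M) : Measure M :=
  ((volume.restrict (chartAt (EuclideanSpace ℝ (Fin n)) c).target).map
    (chartAt (EuclideanSpace ℝ (Fin n)) c).symm).withDensity
    (fun x => ENNReal.ofReal (volumeDensity (n := n) c x))

open Classical in
/-- The Riemannian volume `dvol`: the measures `√ det (gᵢⱼ) dx¹ ⋯ dxⁿ`, which agree on overlaps of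
charts, glued along a countable covering by charts. -/
def riemannianVolume (n : ℕ) (M : Type*) [TopologicalSpace M]
    [ChartedSpace (EuclideanSpace ℝ (Fin n)) M] [IsManifold (𝓡 n) ∞ M] [MeasurableSpace M]
    [RiemannianBundle (fun x : M => TangentSpace (𝓡 n) x)] [SecondCountableTopology M] : Measure M :=
  if _h : Nonempty M then
    let c : ℕ → M := (exists_chart_cover n M).choose
    Measure.sum fun i : ℕ => (chartVolume (n := n) (c i)).restrict
      (disjointed (fun j => (chartAt (EuclideanSpace ℝ (Fin n)) (c j)).source) i)
  else 0

end Volume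

/-! ### Covariant derivatives of smooth sections of the bundles built from `TM`, `E`, `F`

For a family of fibres `V`, a relation `R` between `s : Π x, V x` and
`s' : Π x, Tan n x → V x` is used to say "`s` is a smooth section of `V` and `∇ s = s'`". -/

section Derivatives

variable {n : ℕ} {M : Type*} [TopologicalSpace M] [ChartedSpace (EuclideanSpace ℝ (Fin n)) M]
  [IsManifold (𝓡 n) ∞ M]

/-- Smooth sections of a vector bundle `E` with model fibre `FE`. -/
def SmoothSection (n : ℕ) {M : Type*} [TopologicalSpace M]
    [ChartedSpace (EuclideanSpace ℝ (Fin n)) M] (FE : Type*) [NormedAddCommGroup FE]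
    [NormedSpace ℝ FE] {E : M → Type*} [TopologicalSpace (TotalSpace FE E)]
    [∀ x, TopologicalSpace (E x)] [FiberBundle FE E] (s : Π x, E x) : Prop :=
  ContMDiff (𝓡 n) ((𝓡 n).prod 𝓘(ℝ, FE)) ∞ (fun x => TotalSpace.mk' FE x (s x))

/-- `s` is a smooth section of the vector bundle `E` and `s'` is its covariant derivative. -/
def bundleDeriv {FE : Type*} [NormedAddCommGroup FE] [NormedSpace ℂ FE] {E : M → Type*}
    [TopologicalSpace (TotalSpace FE E)] [∀ x, NormedAddCommGroup (E x)]
    [∀ x, InnerProductSpace ℂ (E x)] [FiberBundle FE E] (cov : CovariantDerivative (𝓡 n) FE E)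
    (s : Π x, E x) (s' : Π x : M, Tan n x → E x) : Prop :=
  SmoothSection n FE s ∧ ∀ x v, s' x v = cov s x v

/-- The connection induced on `T*M ⊗ ⋯ ⊗ T*M ⊗ V` by the connection `D` of `TM` and that of `V`:
`(∇_X T)(Y₁, …, Y_k) = ∇_X (T(Y₁, …, Y_k)) - ∑ᵢ T(Y₁, …, ∇_X Yᵢ, …, Y_k)`. -/
def tenDeriv (D : CovariantDerivative (𝓡 n) (EuclideanSpace ℝ (Fin n)) (fun x : M => TangentSpace (𝓡 n) x))
    {V : M → Type*} [∀ x, AddCommGroup (V x)] [∀ x, Module ℝ (V x)]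
    (R : (Π x, V x) → (Π x : M, Tan n x → V x) → Prop) (k : ℕ)
    (T : Π x, Ten n k V x) (T' : Π x : M, Tan n x → Ten n k V x) : Prop :=
  ∀ Y : Fin k → Π x : M, Tan n x, (∀ i, SmoothField (Y i)) →
    R (fun x => T x fun i => Y i x)
      (fun x v => T' x v (fun i => Y i x) +
        ∑ i, T x (Function.update (fun l => Y l x) i (D (Y i) x v)))

/-- The connection induced on `Hom(V, W)` by connections on `V` and `W`:
`(∇_X a) s = ∇_X (a s) - a (∇_X s)`. -/
def homDeriv {V W : M → Type*} [∀ x, AddCommGroup (V x)] [∀ x, Module ℂ (V x)]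
    [∀ x, AddCommGroup (W x)] [∀ x, Module ℂ (W x)]
    (RV : (Π x, V x) → (Π x : M, Tan n x → V x) → Prop)
    (RW : (Π x, W x) → (Π x : M, Tan n x → W x) → Prop)
    (a : Π x, V x →ₗ[ℂ] W x) (a' : Π x : M, Tan n x → (V x →ₗ[ℂ] W x)) : Prop :=
  ∀ s s', RV s s' → RW (fun x => a x (s x)) (fun x v => a' x v (s x) + a x (s' x v))

/-- `s` is a smooth section of `V` and `S k = ∇ᵏ s` for all `k`; here `∇ᵏ s` is a section of
`T*M ⊗ ⋯ ⊗ T*M ⊗ V` whose first argument is the direction of the last differentiation. -/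
def IteratedDeriv
    (D : CovariantDerivative (𝓡 n) (EuclideanSpace ℝ (Fin n)) (fun x : M => TangentSpace (𝓡 n) x))
    {V : M → Type*} [∀ x, AddCommGroup (V x)] [∀ x, Module ℝ (V x)]
    (R : (Π x, V x) → (Π x : M, Tan n x → V x) → Prop)
    (s : Π x, V x) (S : ∀ k, Π x, Ten n k V x) : Prop :=
  (∀ x, S 0 x = ten0 n (s x)) ∧
    ∀ k, tenDeriv D R k (S k) (fun x v => (S (k + 1) x).curryLeft v)

end Derivatives

/-! ### Hermitian norms and bounded sections -/

section Norms

variable {n : ℕ} {M : Type*} [TopologicalSpace M] [ChartedSpace (EuclideanSpace ℝ (Fin n)) M]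
  [RiemannianBundle (fun x : M => TangentSpace (𝓡 n) x)]

/-- An orthonormal basis of `T_x M`. -/
def tanBasis (n : ℕ) {M : Type*} [TopologicalSpace M]
    [ChartedSpace (EuclideanSpace ℝ (Fin n)) M] [RiemannianBundle (fun x : M => TangentSpace (𝓡 n) x)] (x : M) :
    OrthonormalBasis (Fin (Module.finrank ℝ (Tan n x))) ℝ (Tan n x) :=
  stdOrthonormalBasis ℝ (Tan n x)

/-- The norm on `T*M ⊗ ⋯ ⊗ T*M ⊗ V` induced by the metric of `M` and the norm `N` of `V`:
`|T|² = ∑ |T(e_{i₁}, …, e_{i_k})|²` for an orthonormal basis `e` of `T_x M`. -/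
def tenNorm {V : M → Type*} [∀ x, AddCommGroup (V x)] [∀ x, Module ℝ (V x)]
    (N : ∀ x, V x → ℝ) {k : ℕ} (x : M) (T : Ten n k V x) : ℝ :=
  √ (∑ I : Fin k → Fin (Module.finrank ℝ (Tan n x)), N x (T fun i => tanBasis n x (I i)) ^ 2)

/-- The Hilbert-Schmidt norm `|a|² = ∑ |a bᵢ|²` of a linear map, for an orthonormal basis `b` of
the source and the norm `N` of the target. -/
def homNorm {ι V W : Type*} [Fintype ι] (b : ι → V) (N : W → ℝ) (a : V → W) : ℝ :=
  √ (∑ i, N (a (b i)) ^ 2)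

variable {E : M → Type*} [∀ x, NormedAddCommGroup (E x)] [∀ x, InnerProductSpace ℂ (E x)]

/-- The norm of the hermitian bundle `E`. -/
def bundleNorm (x : M) (e : E x) : ℝ := ‖e‖

/-- The element `e_{I 1}^* ⊗ ⋯ ⊗ e_{I j}^* ⊗ f` of `T*M ⊗ ⋯ ⊗ T*M ⊗ E`. These, for `f` in an
orthonormal basis of `E x`, form an orthonormal basis. -/
def tenFrame {j : ℕ} (x : M) (I : Fin j → Fin (Module.finrank ℝ (Tan n x))) (f : E x) :
    Ten n j E x :=
  ((MultilinearMap.mkPiAlgebra ℝ (Fin j) ℝ).compLinearMap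
    (fun i => (innerSL ℝ (tanBasis n x (I i))).toLinearMap)).smulRight f

variable [∀ x, FiniteDimensional ℂ (E x)]

/-- The hermitian norm of `End(E)`. -/
def endNorm (x : M) (a : E x →ₗ[ℂ] E x) : ℝ :=
  homNorm (stdOrthonormalBasis ℂ (E x)) (bundleNorm x) a

/-- The hermitian norm of `Hom(T*M ⊗ ⋯ ⊗ T*M ⊗ E, W)`, where `N` is the norm of `W`. -/
def coeffNorm {j : ℕ} {W : M → Type*} [∀ x, AddCommGroup (W x)] [∀ x, Module ℂ (W x)]
    (N : ∀ x, W x → ℝ) (x : M) (a : Ten n j E x →ₗ[ℂ] W x) : ℝ :=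
  homNorm (ι := (Fin j → Fin (Module.finrank ℝ (Tan n x))) × Fin (Module.finrank ℂ (E x)))
    (fun q => tenFrame x q.1 (stdOrthonormalBasis ℂ (E x) q.2)) (N x) a

end Norms

section TotallyBounded

variable {n : ℕ} {M : Type*} [TopologicalSpace M] [ChartedSpace (EuclideanSpace ℝ (Fin n)) M]
  [IsManifold (𝓡 n) ∞ M] [RiemannianBundle (fun x : M => TangentSpace (𝓡 n) x)]

/-- `s ∈ C_b^∞(M; V)`: the section `s` is smooth and all its covariant derivatives (including
`s` itself) are bounded. -/
def IsTotallyBounded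
    (D : CovariantDerivative (𝓡 n) (EuclideanSpace ℝ (Fin n)) (fun x : M => TangentSpace (𝓡 n) x))
    {V : M → Type*} [∀ x, AddCommGroup (V x)] [∀ x, Module ℝ (V x)]
    (R : (Π x, V x) → (Π x : M, Tan n x → V x) → Prop) (N : ∀ x, V x → ℝ) (s : Π x, V x) : Prop :=
  ∃ S : ∀ k, Π x, Ten n k V x, IteratedDeriv D R s S ∧ ∀ k, ∃ C : ℝ, ∀ x, tenNorm N x (S k x) ≤ C

end TotallyBounded

/-! ### Connections on a hermitian bundle, `∇`-differential operators, Sobolev spaces -/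

section Bundle

variable {n : ℕ} {M : Type*} [TopologicalSpace M] [ChartedSpace (EuclideanSpace ℝ (Fin n)) M]
  [IsManifold (𝓡 n) ∞ M]
  {FE : Type*} [NormedAddCommGroup FE] [NormedSpace ℂ FE]
  {E : M → Type*} [TopologicalSpace (TotalSpace FE E)] [∀ x, NormedAddCommGroup (E x)]
  [∀ x, InnerProductSpace ℂ (E x)] [FiberBundle FE E]

/-- The inner product of the hermitian bundle `E` varies smoothly. -/
def SmoothMetric (n : ℕ) {M : Type*} [TopologicalSpace M]
    [ChartedSpace (EuclideanSpace ℝ (Fin n)) M] (FE : Type*) [NormedAddCommGroup FE]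
    [NormedSpace ℂ FE] (E : M → Type*) [TopologicalSpace (TotalSpace FE E)]
    [∀ x, NormedAddCommGroup (E x)] [∀ x, InnerProductSpace ℂ (E x)] [FiberBundle FE E] : Prop :=
  ∀ s t : Π x, E x, SmoothSection n FE s → SmoothSection n FE t →
    ContMDiff (𝓡 n) 𝓘(ℝ, ℂ) ∞ (fun x => (inner ℂ (s x) (t x) : ℂ))

/-- A (smooth, complex linear) metric preserving connection on the hermitian vector bundle `E`. -/
structure IsMetricConnection [VectorBundle ℝ FE E] (cov : CovariantDerivative (𝓡 n) FE E) :
    Prop where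
  smooth : CovariantDerivative.ContMDiffCovariantDerivative cov ∞
  complex_linear : ∀ (c : ℂ) (s : Π x, E x), SmoothSection n FE s → ∀ x v,
    cov (fun y => c • s y) x v = c • cov s x v
  metric : ∀ s t : Π x, E x, SmoothSection n FE s → SmoothSection n FE t → ∀ x (v : Tan n x),
    mfderiv (𝓡 n) 𝓘(ℝ, ℂ) (fun y => inner ℂ (s y) (t y)) x v =
      inner ℂ (cov s x v) (t x) + inner ℂ (s x) (cov t x v)

/-- Smoothness of a section `A` of `T*M ⊗ End(E)`. -/
def SmoothOneForm (FE : Type*) [NormedAddCommGroup FE] [NormedSpace ℂ FE]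
    {E : M → Type*} [TopologicalSpace (TotalSpace FE E)] [∀ x, NormedAddCommGroup (E x)]
    [∀ x, InnerProductSpace ℂ (E x)] [FiberBundle FE E]
    (A : Π x, Ten n 1 (fun x : M => E x →ₗ[ℂ] E x) x) : Prop :=
  ∀ (X : Π x : M, Tan n x) (s : Π x, E x), SmoothField X → SmoothSection n FE s →
    SmoothSection n FE (fun x => A x (fun _ => X x) (s x))

/-- `A* = -A`: for every tangent vector `v`, the endomorphism `A(v)` is skew-adjoint. -/
def SkewAdjoint (A : Π x, Ten n 1 (fun x : M => E x →ₗ[ℂ] E x) x) : Prop :=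
  ∀ (x : M) (v : Tan n x) (e f : E x),
    inner ℂ (A x (fun _ => v) e) f = - inner ℂ e (A x (fun _ => v) f)

/-- The connection `∇ + A`, `(∇ + A)_v s = ∇_v s + A(v) s`. -/
def addForm (cov : CovariantDerivative (𝓡 n) FE E)
    (A : Π x, Ten n 1 (fun x : M => E x →ₗ[ℂ] E x) x) : CovariantDerivative (𝓡 n) FE E where
  toFun s x := cov s x + LinearMap.toContinuousLinearMap
    ((LinearMap.applyₗ' (R := ℂ) ℝ (s x)).comp
      ((MultilinearMap.ofSubsingleton ℝ (Tan n x) (E x →ₗ[ℂ] E x) (0 : Fin 1)).symm (A x)))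
  isCovariantDerivativeOnUniv :=
    { add := by
        intro s t x hs ht hx
        ext v
        simp [cov.isCovariantDerivativeOnUniv.add hs ht hx]
        abel
      leibniz := by
        intro s g x hs hg hx
        ext v
        simp [cov.isCovariantDerivativeOnUniv.leibniz hs hg hx]
        abel }

/-- Smooth sections of `E` with compact support, `C_c^∞(M; E)`. -/
def TestSection (n : ℕ) {M : Type*} [TopologicalSpace M]
    [ChartedSpace (EuclideanSpace ℝ (Fin n)) M] (FE : Type*) [NormedAddCommGroup FE]
    [NormedSpace ℂ FE] (E : M → Type*) [TopologicalSpace (TotalSpace FE E)]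
    [∀ x, NormedAddCommGroup (E x)] [∀ x, InnerProductSpace ℂ (E x)] [FiberBundle FE E] :=
  {u : Π x, E x // SmoothSection n FE u ∧ IsCompact (closure {x | u x ≠ 0})}

variable [RiemannianBundle (fun x : M => TangentSpace (𝓡 n) x)]
  (D : CovariantDerivative (𝓡 n) (EuclideanSpace ℝ (Fin n)) (fun x : M => TangentSpace (𝓡 n) x))

/-- `A ∈ C_b^∞(M; T*M ⊗ End(E))`, where `End(E)` carries the connection induced by `cov`. -/
def TotallyBoundedForm [∀ x, FiniteDimensional ℂ (E x)] (cov : CovariantDerivative (𝓡 n) FE E)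
    (A : Π x, Ten n 1 (fun x : M => E x →ₗ[ℂ] E x) x) : Prop :=
  IsTotallyBounded D (tenDeriv D (homDeriv (bundleDeriv cov) (bundleDeriv cov)) 1)
    (tenNorm endNorm) A

section Diff

variable [∀ x, FiniteDimensional ℂ (E x)]
  {FF : Type*} [NormedAddCommGroup FF] [NormedSpace ℂ FF]
  {F : M → Type*} [TopologicalSpace (TotalSpace FF F)] [∀ x, NormedAddCommGroup (F x)]
  [∀ x, InnerProductSpace ℂ (F x)] [FiberBundle FF F]

/-- `Diff_{b,∇}^μ(M; E, W)`, where `W = T*M ⊗ ⋯ ⊗ T*M ⊗ F` with `m ≥ 0` factors `T*M`: the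
operators `P = ∑_{j ≤ μ} a_j ∇ʲ : C_c^∞(M; E) → C_c^∞(M; W)` with coefficients
`a_j ∈ C_b^∞(M; Hom(T*M ⊗ ⋯ ⊗ T*M ⊗ E, W))`. The bundle `E` carries the connection `covE` and `F`
the connection `covF`. -/
def DiffB (covE : CovariantDerivative (𝓡 n) FE E) (covF : CovariantDerivative (𝓡 n) FF F)
    (μ m : ℕ) : Set (TestSection n FE E → Π x, Ten n m F x) :=
  {P | ∃ a : ∀ j, Π x, Ten n j E x →ₗ[ℂ] Ten n m F x,
    (∀ j ≤ μ, IsTotallyBounded D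
      (homDeriv (tenDeriv D (bundleDeriv covE) j) (tenDeriv D (bundleDeriv covF) m))
      (coeffNorm (tenNorm bundleNorm)) (a j)) ∧
    ∀ u : TestSection n FE E, ∃ U : ∀ k, Π x, Ten n k E x,
      IteratedDeriv D (bundleDeriv covE) u.1 U ∧
      ∀ x, P u x = ∑ j ∈ Finset.range (μ + 1), a j x (U j x)}

end Diff

section Sobolev

/-- The `ℓᵖ`-norm of the family `N 0, …, N s`. -/
def ellNorm (p : ℝ≥0∞) (s : ℕ) (N : ℕ → ℝ≥0∞) : ℝ≥0∞ :=
  if p = ⊤ then ⨆ j ∈ Finset.range (s + 1), N j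
  else (∑ j ∈ Finset.range (s + 1), N j ^ p.toReal) ^ (1 / p.toReal)

variable [SecondCountableTopology M] [MeasurableSpace M]

/-- The `W^{s,p}_∇`-norm of a smooth section `w` of `V`, where `R` is the connection of `V` and `N`
its norm: the `ℓᵖ`-norm of `‖∇ʲ w‖_{Lᵖ}`, `0 ≤ j ≤ s`. (The infimum is over the single family of
the iterated covariant derivatives of `w`.) -/
def smoothSobolevNorm {V : M → Type*} [∀ x, AddCommGroup (V x)] [∀ x, Module ℝ (V x)]
    (R : (Π x, V x) → (Π x : M, Tan n x → V x) → Prop) (N : ∀ x, V x → ℝ)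
    (s : ℕ) (p : ℝ≥0∞) (w : Π x, V x) : ℝ≥0∞ :=
  ⨅ (S : ∀ k, Π x, Ten n k V x) (_ : IteratedDeriv D R w S),
    ellNorm p s fun j => eLpNorm (fun x => tenNorm N x (S j x)) p (riemannianVolume n M)

/-- The `W^{s,p}_∇`-norm of the smooth section `A` of `T*M ⊗ End(E)`. -/
def formSobolevNorm [∀ x, FiniteDimensional ℂ (E x)] (cov : CovariantDerivative (𝓡 n) FE E)
    (s : ℕ) (p : ℝ≥0∞) (A : Π x, Ten n 1 (fun x : M => E x →ₗ[ℂ] E x) x) : ℝ≥0∞ :=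
  smoothSobolevNorm D (tenDeriv D (homDeriv (bundleDeriv cov) (bundleDeriv cov)) 1)
    (tenNorm endNorm) s p A

/-- `T` is a (measurable and) locally integrable section of `T*M ⊗ ⋯ ⊗ T*M ⊗ E`: its pairings with
smooth vector fields and smooth compactly supported sections of `E` are integrable. -/
def LocIntegrable (FE : Type*) [NormedAddCommGroup FE] [NormedSpace ℂ FE]
    {E : M → Type*} [TopologicalSpace (TotalSpace FE E)] [∀ x, NormedAddCommGroup (E x)]
    [∀ x, InnerProductSpace ℂ (E x)] [FiberBundle FE E] {k : ℕ} (T : Π x, Ten n k E x) : Prop :=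
  ∀ (Y : Fin k → Π x : M, Tan n x) (φ : TestSection n FE E), (∀ i, SmoothField (Y i)) →
    Integrable (fun x => inner ℂ (φ.1 x) (T x fun i => Y i x)) (riemannianVolume n M)

/-- `T' = ∇T` in the sense of distributions, for locally integrable sections `T` of
`T*M ⊗ ⋯ ⊗ T*M ⊗ E` and `T'` of `T*M ⊗ T*M ⊗ ⋯ ⊗ T*M ⊗ E`. The definition uses that the formal
adjoint of `∇_X` on sections of `E` is `φ ↦ - ∇_X φ - div(X) φ`. -/
def WeakDeriv (cov : CovariantDerivative (𝓡 n) FE E) {k : ℕ} (T : Π x, Ten n k E x)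
    (T' : Π x, Ten n (k + 1) E x) : Prop :=
  LocIntegrable FE T ∧ LocIntegrable FE T' ∧
  ∀ (X : Π x : M, Tan n x) (Y : Fin k → Π x : M, Tan n x) (φ : TestSection n FE E),
    SmoothField X → (∀ i, SmoothField (Y i)) →
    ∫ x, inner ℂ (φ.1 x) (T' x (Fin.cons (X x) fun i => Y i x) +
        ∑ i, T x (Function.update (fun l => Y l x) i (D (Y i) x (X x)))) ∂(riemannianVolume n M) =
      - ∫ x, inner ℂ (cov φ.1 x (X x) + divergence D X x • φ.1 x) (T x fun i => Y i x)
        ∂(riemannianVolume n M)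

/-- `U j = ∇ʲ u` in the sense of distributions for `0 ≤ j ≤ s`, all of them being locally
integrable. -/
def WeakIteratedDeriv (cov : CovariantDerivative (𝓡 n) FE E) (s : ℕ) (u : Π x, E x)
    (U : ∀ k, Π x, Ten n k E x) : Prop :=
  (∀ x, U 0 x = ten0 n (u x)) ∧ LocIntegrable FE (U 0) ∧
    ∀ k < s, WeakDeriv D cov (U k) (U (k + 1))

/-- The norm of `W^{s,p}_∇(M; E)`, the `ℓᵖ`-norm of `‖∇ʲ u‖_{Lᵖ}`, `0 ≤ j ≤ s`; it is `∞` if `u`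
or one of these weak derivatives fails to exist as a locally integrable section. (Weak derivatives
are unique up to null sets, so that the infimum is over a single value.) -/
def sobolevNorm (cov : CovariantDerivative (𝓡 n) FE E) (s : ℕ) (p : ℝ≥0∞) (u : Π x, E x) : ℝ≥0∞ :=
  ⨅ (U : ∀ k, Π x, Ten n k E x) (_ : WeakIteratedDeriv D cov s u U),
    ellNorm p s fun j => eLpNorm (fun x => tenNorm bundleNorm x (U j x)) p (riemannianVolume n M)

/-- The Sobolev space `W^{s,p}_∇(M; E)`. -/
def sobolevSpace (cov : CovariantDerivative (𝓡 n) FE E) (s : ℕ) (p : ℝ≥0∞) : Set (Π x, E x) :=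
  {u | sobolevNorm D cov s p u < ⊤}

end Sobolev

end Bundle

end

end NablaSobolev

open NablaSobolev

universe u v w

/-!
Write `∇̃ = ∇ + A`. All comparisons go through the identity of `E`, regarded as a section of
`Hom(E₂, E₁)`, where `E₁` and `E₂` are `E` with the two connections, in either order. Its derivative
is `± A`; hence its iterated derivatives `C 0 = id, C 1, C 2, …` satisfy the recursion
`C (m + 1) = ∑ ± (∇ʲ A) · C (m - j)` given by the Leibniz rule for the product of `A` and the
identity (`exists_transition`). The sum over subsets in the Leibniz rule is `leib`, and its norm is
estimated in `tenSq_leib_le` with a constant which does not depend on the dimensions. So `C 0, …,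
C l` are bounded in terms of `A, …, ∇^{l-1} A` (`sum_tenSq_le_transBound`,
`exists_transition_bound`). Conversely, the term of the recursion with the highest derivative of `A`
is `± ∇ᵐ A`, so bounds for `C` give bounds for the derivatives of `A` (`tenSq_le_of_split_eq_leib`).

*Sobolev spaces.* Apply the Leibniz rule to `u = id* u` for weakly differentiable `u`: the weak
derivatives `∇̃ᵏ u` exist and are sums of products of adjoints of the `C i` with the `∇ʲ u`
(`WeakIteratedDeriv.leib`). In the weak formulation, the adjoint is moved to the test section, so
that only the smooth Leibniz rule and the weak derivative of `u` are needed (`weakRel_adjoint`). The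
pointwise bound then gives the bound of the norms, `sobolevNorm_le`. Minkowski's inequality needs
that `|∇ʲ u|` is measurable, which is seen in local frames
(`LocIntegrable.aemeasurable_tenNorm`).

*Differential operators, bounded `A`.* By the same rule, `∇ʲ u = ∑ C_{ij} ∇̃ⁱ u` with coefficients
`C_{ij}` (`transMap`) which are assembled from the `C k`. They and their derivatives are bounded,
and products of totally bounded coefficients are totally bounded, so one inclusion holds for each
order of the two connections (`diffB_subset`, `diffB_eq`).

*Differential operators, the converse.* The operator `∇^μ` has bounded coefficients with respect to
`∇`, so by hypothesis `∇^μ = ∑ ãⱼ ∇̃ʲ` with totally bounded `ãⱼ`. A product `u` of `μ` functions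
which vanish at `x` and a section has vanishing derivatives of order less than `μ` at `x`, and its
`μ`-th derivative is a symmetrized pure tensor for every connection (`exists_testSection_jet`).
Therefore `ã_μ` is the identity on symmetric tensors (`exists_coeff_symR`). Symmetrization being
parallel, the iterated derivatives of `ã_μ ∘ sym` are, on the one hand, those of `ã_μ` composed
with `sym`, and, on the other hand, the `C k` acting on the `E`-factor of symmetrized tensors.
Evaluation at `ξ ⊗ ⋯ ⊗ ξ ⊗ e` shows that the `C k` are bounded (`hsSq_le_of_compSym_eq`), and the
recursion, solved for the derivatives of `A`, that `A` is totally bounded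
(`totallyBoundedForm_of_diffB_subset`).

Covariant derivatives of sections of the tensor bundles are given by relations "`s` is smooth and
`∇ s = s'`". The rules of a connection are collected in `IsConnRel`, and `IsFrameRel` expresses that
there are enough smooth sections for `C^∞`-linear operations to be given by fibrewise linear maps
(`exists_linDeriv`).
-/

set_option linter.unusedSectionVars false

namespace NablaSobolev

noncomputable section

/-! ### The Leibniz rule for iterated derivatives: pointwise algebra -/

section Algebra

variable {T H V W : Type*} [AddCommGroup T] [Module ℝ T] [AddCommGroup H] [Module ℝ H]
  [AddCommGroup V] [Module ℝ V] [AddCommGroup W] [Module ℝ W]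

@[simp] theorem curryLeft_zero' {k : ℕ} (v : T) :
    (0 : MultilinearMap ℝ (fun _ : Fin (k + 1) => T) V).curryLeft v = 0 := rfl

theorem curryLeft_add' {k : ℕ} (S S' : MultilinearMap ℝ (fun _ : Fin (k + 1) => T) V) (v : T) :
    (S + S').curryLeft v = S.curryLeft v + S'.curryLeft v := rfl

theorem curryLeft_smul' {k : ℕ} (c : ℝ) (S : MultilinearMap ℝ (fun _ : Fin (k + 1) => T) V)
    (v : T) : (c • S).curryLeft v = c • S.curryLeft v := rfl

/-- Sequences of tensors, with one `k`-linear map for each `k`: the values at a point of the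
iterated derivatives of a section. -/
abbrev Fam (T V : Type*) [AddCommGroup T] [Module ℝ T] [AddCommGroup V] [Module ℝ V] :=
  ∀ k : ℕ, MultilinearMap ℝ (fun _ : Fin k => T) V

/-- Insert the vector `v` into the first slot of every tensor of the sequence. -/
def shift (v : T) : Fam T V →ₗ[ℝ] Fam T V where
  toFun B k := (B (k + 1)).curryLeft v
  map_add' _ _ := rfl
  map_smul' _ _ := rfl

@[simp] theorem shift_apply (v : T) (B : Fam T V) (k : ℕ) :
    shift v B k = (B (k + 1)).curryLeft v := rfl

theorem shift_add (v w : T) (B : Fam T V) : shift (v + w) B = shift v B + shift w B := by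
  funext k; simp

theorem shift_smul (c : ℝ) (v : T) (B : Fam T V) : shift (c • v) B = c • shift v B := by
  funext k; simp

/-- The `k`-th term of the Leibniz formula for the iterated derivatives of `β b u`: if `B` and `U`
are the iterated derivatives of `b` and `u`, then `leib β k B U` maps `v` to
`∑ β (B (v restricted to Jᶜ)) (U (v restricted to J))`, the sum being over the subsets `J` of
`Fin k`. The recursion splits the sum according to whether `0 ∈ J`. -/
def leib (β : H →ₗ[ℝ] V →ₗ[ℝ] W) : (k : ℕ) →
    Fam T H →ₗ[ℝ] Fam T V →ₗ[ℝ] MultilinearMap ℝ (fun _ : Fin k => T) W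
  | 0 => LinearMap.mk₂ ℝ
      (fun B U => MultilinearMap.constOfIsEmpty ℝ _ (β (B 0 0) (U 0 0)))
      (by intros; ext; simp) (by intros; ext; simp) (by intros; ext; simp) (by intros; ext; simp)
  | k + 1 => LinearMap.mk₂ ℝ
      (fun B U => LinearMap.uncurryLeft
        { toFun := fun v => leib β k (shift v B) U + leib β k B (shift v U)
          map_add' := fun v w => by simp only [shift_add, map_add, LinearMap.add_apply]; abel
          map_smul' := fun c v => by
            simp only [shift_smul, map_smul, LinearMap.smul_apply, RingHom.id_apply, smul_add] })
      (by intros; ext; simp; abel) (by intros; ext; simp)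
      (by intros; ext; simp; abel) (by intros; ext; simp)

variable (β : H →ₗ[ℝ] V →ₗ[ℝ] W)

theorem leib_zero (B : Fam T H) (U : Fam T V) (v : Fin 0 → T) :
    leib β 0 B U v = β (B 0 0) (U 0 0) := rfl

theorem leib_succ_apply (k : ℕ) (B : Fam T H) (U : Fam T V) (v : Fin (k + 1) → T) :
    leib β (k + 1) B U v =
      leib β k (shift (v 0) B) U (Fin.tail v) + leib β k B (shift (v 0) U) (Fin.tail v) := rfl

theorem leib_succ_curryLeft (k : ℕ) (B : Fam T H) (U : Fam T V) (v : T) :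
    (leib β (k + 1) B U).curryLeft v = leib β k (shift v B) U + leib β k B (shift v U) := by
  ext w
  rw [MultilinearMap.curryLeft_apply, leib_succ_apply]
  simp

theorem leib_congr (k : ℕ) : ∀ {B B' : Fam T H} {U U' : Fam T V}, (∀ j ≤ k, B j = B' j) →
    (∀ j ≤ k, U j = U' j) → leib β k B U = leib β k B' U' := by
  induction k with
  | zero =>
    intro B B' U U' hB hU
    ext v
    rw [leib_zero, leib_zero, hB 0 le_rfl, hU 0 le_rfl]
  | succ k ih =>
    intro B B' U U' hB hU
    ext v
    rw [leib_succ_apply, leib_succ_apply]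
    rw [ih (B := shift (v 0) B) (B' := shift (v 0) B') (U := U) (U' := U')
        (fun j hj => by simp [hB (j + 1) (by omega)]) (fun j hj => hU j (by omega)),
      ih (B := B) (B' := B') (U := shift (v 0) U) (U' := shift (v 0) U')
        (fun j hj => hB j (by omega)) (fun j hj => by simp [hU (j + 1) (by omega)])]

theorem leib_eq_zero_left (k : ℕ) {B : Fam T H} (U : Fam T V) (hB : ∀ j ≤ k, B j = 0) :
    leib β k B U = 0 := by
  rw [leib_congr β k (B' := 0) (U' := U) hB (fun _ _ => rfl)]
  simp

/-- Only the subset `J = ∅` contributes if `B` is concentrated in degree `k`. -/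
theorem leib_single_left (k : ℕ) : ∀ (b : MultilinearMap ℝ (fun _ : Fin k => T) H) (U : Fam T V),
    leib β k (Pi.single k b) U = (β.flip (U 0 0)).compMultilinearMap b := by
  induction k with
  | zero =>
    intro b U
    ext v
    rw [leib_zero, Subsingleton.elim v 0]
    simp
  | succ k ih =>
    intro b U
    ext v
    have h : shift (v 0) (Pi.single (k + 1) b : Fam T H) = Pi.single k (b.curryLeft (v 0)) := by
      funext j
      rcases eq_or_ne j k with rfl | hj
      · simp
      · simp [hj]
    rw [leib_succ_apply, h, ih, leib_eq_zero_left]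
    · simp
    · intro j hj
      rw [Pi.single_eq_of_ne (by omega)]

/-- Splitting off the subset `J = ∅` from the Leibniz formula. -/
theorem leib_eq_top_add (k : ℕ) (B : Fam T H) (U : Fam T V) :
    leib β k B U = (β.flip (U 0 0)).compMultilinearMap (B k) +
      leib β k (Function.update B k 0) U := by
  have h : B = Pi.single k (B k) + Function.update B k 0 := by
    funext j
    rcases eq_or_ne j k with rfl | hj
    · simp
    · simp [hj]
  conv_lhs => rw [h]
  rw [map_add, LinearMap.add_apply, leib_single_left]

theorem leib_eq_zero_right_of_lt (k : ℕ) : ∀ {r : ℕ} (B : Fam T H) {U : Fam T V}, k < r →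
    (∀ j < r, U j = 0) → leib β k B U = 0 := by
  intro r B U hk hU
  rw [leib_congr β k (B' := B) (U' := 0) (fun _ _ => rfl) (fun j hj => hU j (by omega))]
  simp

/-- If `U` vanishes below degree `r`, only the subset `J = Fin r` contributes in degree `r`. -/
theorem leib_eq_bot (r : ℕ) : ∀ (B : Fam T H) {U : Fam T V}, (∀ j < r, U j = 0) →
    leib β r B U = (β (B 0 0)).compMultilinearMap (U r) := by
  induction r with
  | zero =>
    intro B U _
    ext v
    rw [leib_zero, Subsingleton.elim v 0]
    simp
  | succ r ih =>
    intro B U hU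
    ext v
    rw [leib_succ_apply, leib_eq_zero_right_of_lt β r _ (Nat.lt_succ_self r) hU,
      ih B (fun j hj => by simp [hU (j + 1) (by omega)])]
    simp

/-- If `U` vanishes below degree `r` and `B 0 = 0`, only the subsets `J` of cardinality `r`
contribute in degree `r + 1`. -/
theorem leib_succ_of_vanish (r : ℕ) : ∀ {B : Fam T H} {U : Fam T V}, B 0 = 0 →
    (∀ j < r, U j = 0) → ∀ v : Fin (r + 1) → T,
    leib β (r + 1) B U v = ∑ i, β (B 1 fun _ => v i) (U r fun l => v (i.succAbove l)) := by
  induction r with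
  | zero =>
    intro B U hB _ v
    rw [leib_succ_apply, leib_zero, leib_zero, hB]
    simp
    congr 2
    · congr 1
      funext i
      rw [Subsingleton.elim i 0]; rfl
    · exact Subsingleton.elim _ _
  | succ r ih =>
    intro B U hB hU v
    rw [leib_succ_apply, leib_eq_bot β (r + 1) _ hU,
      ih hB (fun j hj => by simp [hU (j + 1) (by omega)])]
    refine Eq.trans ?_ (Fin.sum_univ_succ _).symm
    congr 1
    · simp only [LinearMap.compMultilinearMap_apply, shift_apply, MultilinearMap.curryLeft_apply]
      congr 2
      refine congrArg (B 1) (funext fun i : Fin 1 => ?_)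
      rw [Subsingleton.elim i 0]; rfl
    · refine Finset.sum_congr rfl fun i _ => ?_
      simp only [shift_apply, MultilinearMap.curryLeft_apply]
      congr 2
      funext l
      refine Fin.cases ?_ (fun l => ?_) l
      · simp
      · simp [Fin.tail]

/-- The Leibniz formula is natural in the bilinear map. -/
theorem leib_map {V' W' : Type*} [AddCommGroup V'] [Module ℝ V'] [AddCommGroup W'] [Module ℝ W']
    (β' : H →ₗ[ℝ] V' →ₗ[ℝ] W') (f : V →ₗ[ℝ] V') (g : W →ₗ[ℝ] W')
    (h : ∀ b u, β' b (f u) = g (β b u)) (k : ℕ) : ∀ (B : Fam T H) (U : Fam T V),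
    leib β' k B (fun j => f.compMultilinearMap (U j)) = g.compMultilinearMap (leib β k B U) := by
  induction k with
  | zero =>
    intro B U
    ext v
    simp only [leib_zero, LinearMap.compMultilinearMap_apply, h]
  | succ k ih =>
    intro B U
    ext v
    have hs : shift (v 0) (fun j => f.compMultilinearMap (U j)) =
        fun j => f.compMultilinearMap (shift (v 0) U j) := rfl
    rw [LinearMap.compMultilinearMap_apply, leib_succ_apply, leib_succ_apply, hs, ih, ih, map_add,
      LinearMap.compMultilinearMap_apply, LinearMap.compMultilinearMap_apply]

/-- Insert `r` vectors, one after the other, into the first slot of every tensor of a sequence. -/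
def shiftN : (r : ℕ) → Fam T V →ₗ[ℝ] MultilinearMap ℝ (fun _ : Fin r => T) (Fam T V)
  | 0 =>
    { toFun := fun B => MultilinearMap.constOfIsEmpty ℝ _ B
      map_add' := by intros; ext; simp
      map_smul' := by intros; ext; simp }
  | r + 1 =>
    { toFun := fun B => LinearMap.uncurryLeft
        { toFun := fun v => shiftN r (shift v B)
          map_add' := fun v w => by simp only [shift_add, map_add]
          map_smul' := fun c v => by simp only [shift_smul, map_smul, RingHom.id_apply] }
      map_add' := by intros; ext; simp
      map_smul' := by intros; ext; simp }

theorem shiftN_succ_curryLeft (r : ℕ) (B : Fam T V) (v : T) :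
    (shiftN (r + 1) B).curryLeft v = shiftN r (shift v B) := by
  ext w : 1
  simp [shiftN]

/-- Symmetrization: the sum, over all permutations of the slots, of the permuted tensors. The
recursion splits the sum according to the vector which is put into the first slot. -/
def symR : (k : ℕ) → MultilinearMap ℝ (fun _ : Fin k => T) V →ₗ[ℝ]
    MultilinearMap ℝ (fun _ : Fin k => T) V
  | 0 => LinearMap.id
  | k + 1 =>
    { toFun := fun S =>
        { toFun := fun v => ∑ i, symR k (S.curryLeft (v i)) (fun l => v (i.succAbove l))
          map_update_add' := by
            intro inst v m x y
            cases Subsingleton.elim inst (instDecidableEqFin (k + 1))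
            rw [← Finset.sum_add_distrib]
            refine Finset.sum_congr rfl fun i _ => ?_
            rcases eq_or_ne i m with rfl | hi
            · simp [Fin.succAbove_ne]
            · obtain ⟨l, rfl⟩ := Fin.exists_succAbove_eq hi.symm
              have h : ∀ z : T, (fun l' => Function.update v (i.succAbove l) z (i.succAbove l')) =
                  Function.update (fun l' => v (i.succAbove l')) l z := fun z =>
                Function.update_comp_eq_of_injective v Fin.succAbove_right_injective l z
              simp [h]
          map_update_smul' := by
            intro inst v m c x
            cases Subsingleton.elim inst (instDecidableEqFin (k + 1))
            rw [Finset.smul_sum]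
            refine Finset.sum_congr rfl fun i _ => ?_
            rcases eq_or_ne i m with rfl | hi
            · simp [Fin.succAbove_ne]
            · obtain ⟨l, rfl⟩ := Fin.exists_succAbove_eq hi.symm
              have h : ∀ z : T, (fun l' => Function.update v (i.succAbove l) z (i.succAbove l')) =
                  Function.update (fun l' => v (i.succAbove l')) l z := fun z =>
                Function.update_comp_eq_of_injective v Fin.succAbove_right_injective l z
              simp [h] }
      map_add' := by
        intro S S'
        ext v
        simp [curryLeft_add', Finset.sum_add_distrib]
      map_smul' := by
        intro c S
        ext v
        simp [curryLeft_smul', Finset.smul_sum] }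

theorem symR_succ_apply (k : ℕ) (S : MultilinearMap ℝ (fun _ : Fin (k + 1) => T) V)
    (v : Fin (k + 1) → T) :
    symR (k + 1) S v = ∑ i, symR k (S.curryLeft (v i)) (fun l => v (i.succAbove l)) := rfl

theorem symR_compMultilinearMap (f : V →ₗ[ℝ] W) (k : ℕ) :
    ∀ S : MultilinearMap ℝ (fun _ : Fin k => T) V,
    symR k (f.compMultilinearMap S) = f.compMultilinearMap (symR k S) := by
  induction k with
  | zero => intro S; rfl
  | succ k ih =>
    intro S
    ext v
    have hs : ∀ i, (f.compMultilinearMap S).curryLeft (v i) =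
        f.compMultilinearMap (S.curryLeft (v i)) := fun _ => rfl
    simp only [symR_succ_apply, hs, ih, LinearMap.compMultilinearMap_apply, map_sum]

/-- `∏ᵢ ξᵢ ⊗ e` as a multilinear map. -/
def pureTen {k : ℕ} (ξ : Fin k → T →ₗ[ℝ] ℝ) (e : V) : MultilinearMap ℝ (fun _ : Fin k => T) V :=
  ((MultilinearMap.mkPiAlgebra ℝ (Fin k) ℝ).compLinearMap ξ).smulRight e

@[simp] theorem pureTen_apply {k : ℕ} (ξ : Fin k → T →ₗ[ℝ] ℝ) (e : V) (v : Fin k → T) :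
    pureTen ξ e v = (∏ i, ξ i (v i)) • e := by
  simp [pureTen]

theorem pureTen_succ_curryLeft {k : ℕ} (ξ : Fin (k + 1) → T →ₗ[ℝ] ℝ) (e : V) (v : T) :
    (pureTen ξ e).curryLeft v = ξ 0 v • pureTen (fun i => ξ i.succ) e := by
  ext w
  simp [Fin.prod_univ_succ, mul_smul]

/-- The `k!` permutations of a symmetric tensor agree. -/
theorem symR_pureTen_const (ξ : T →ₗ[ℝ] ℝ) (e : V) (k : ℕ) :
    symR k (pureTen (fun _ => ξ) e) = (k.factorial : ℝ) • pureTen (fun _ : Fin k => ξ) e := by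
  induction k with
  | zero => simp [symR]
  | succ k ih =>
    ext v
    rw [symR_succ_apply]
    have : ∀ i, symR k ((pureTen (fun _ => ξ) e).curryLeft (v i))
        (fun l => v (i.succAbove l)) = (k.factorial : ℝ) • (∏ j, ξ (v j)) • e := by
      intro i
      rw [pureTen_succ_curryLeft, map_smul, ih, Fin.prod_univ_succAbove _ i]
      simp only [smul_apply, pureTen_apply, smul_smul]
      congr 1
      ring
    simp only [this, Finset.sum_const, Finset.card_univ, Fintype.card_fin, Nat.factorial_succ,
      smul_apply, pureTen_apply]
    push_cast
    rw [← Nat.cast_smul_eq_nsmul ℝ, smul_smul]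
    push_cast
    rfl

/-- A tensor with `k + m` slots as a tensor with `k` slots whose values are tensors with `m`
slots. -/
def split (k m : ℕ) : MultilinearMap ℝ (fun _ : Fin (k + m) => T) V →ₗ[ℝ]
    MultilinearMap ℝ (fun _ : Fin k => T) (MultilinearMap ℝ (fun _ : Fin m => T) V) where
  toFun S := MultilinearMap.currySum (S.domDomCongr finSumFinEquiv.symm)
  map_add' _ _ := by ext; simp
  map_smul' _ _ := by ext; simp

theorem split_apply (k m : ℕ) (S : MultilinearMap ℝ (fun _ : Fin (k + m) => T) V)
    (v : Fin k → T) (w : Fin m → T) : split k m S v w = S (Fin.append v w) := by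
  simp only [split, LinearMap.coe_mk, AddHom.coe_mk, MultilinearMap.currySum_apply,
    MultilinearMap.domDomCongr_apply]
  congr 1
  funext i
  refine Fin.addCases (fun i => ?_) (fun i => ?_) i <;> simp

end Algebra

/-! ### Sums of squares of the components of a tensor -/

section TensorSquare

variable {T H V W ι : Type*} [AddCommGroup T] [Module ℝ T] [AddCommGroup H] [Module ℝ H]
  [AddCommGroup V] [Module ℝ V] [AddCommGroup W] [Module ℝ W] [Fintype ι]

/-- The sum of `q (S (e_{i₁}, …, e_{i_k}))` over all multi-indices, where `q` is thought of as the
square of a norm. -/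
def tenSq (e : ι → T) (q : V → ℝ) {k : ℕ} (S : MultilinearMap ℝ (fun _ : Fin k => T) V) : ℝ :=
  ∑ I : Fin k → ι, q (S fun i => e (I i))

variable (e : ι → T) (q : V → ℝ)

theorem tenSq_zero (S : MultilinearMap ℝ (fun _ : Fin 0 => T) V) :
    tenSq e q S = q (S 0) := by
  rw [tenSq, Fintype.sum_unique]
  congr 2
  exact Subsingleton.elim _ _

theorem tenSq_succ {k : ℕ} (S : MultilinearMap ℝ (fun _ : Fin (k + 1) => T) V) :
    tenSq e q S = ∑ i, tenSq e q (S.curryLeft (e i)) := by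
  rw [tenSq, ← (Fin.consEquiv fun _ : Fin (k + 1) => ι).sum_comp, Fintype.sum_prod_type]
  refine Finset.sum_congr rfl fun i _ => Finset.sum_congr rfl fun I _ => ?_
  rw [MultilinearMap.curryLeft_apply]
  congr 2
  funext j
  refine Fin.cases ?_ (fun j => ?_) j <;> simp [Fin.consEquiv]

variable {q}

theorem tenSq_nonneg (hq : ∀ v, 0 ≤ q v) {k : ℕ} (S : MultilinearMap ℝ (fun _ : Fin k => T) V) :
    0 ≤ tenSq e q S :=
  Finset.sum_nonneg fun _ _ => hq _

theorem tenSq_mono {q' : V → ℝ} {c : ℝ} (hq : ∀ v, q v ≤ c * q' v) {k : ℕ}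
    (S : MultilinearMap ℝ (fun _ : Fin k => T) V) : tenSq e q S ≤ c * tenSq e q' S := by
  rw [tenSq, tenSq, Finset.mul_sum]
  exact Finset.sum_le_sum fun _ _ => hq _

theorem tenSq_add_le (h : ∀ v w, q (v + w) ≤ 2 * (q v + q w)) {k : ℕ}
    (S S' : MultilinearMap ℝ (fun _ : Fin k => T) V) :
    tenSq e q (S + S') ≤ 2 * (tenSq e q S + tenSq e q S') := by
  rw [tenSq, tenSq, tenSq, ← Finset.sum_add_distrib, Finset.mul_sum]
  exact Finset.sum_le_sum fun _ _ => h _ _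

theorem tenSq_split (k m : ℕ) (S : MultilinearMap ℝ (fun _ : Fin (k + m) => T) V) :
    tenSq e (fun S' : MultilinearMap ℝ (fun _ : Fin m => T) V => tenSq e q S') (split k m S) =
      tenSq e q S := by
  simp only [tenSq, split_apply]
  rw [← Fintype.sum_prod_type', ← (Fin.appendEquiv k m).sum_comp]
  refine Finset.sum_congr rfl fun I _ => ?_
  congr 2
  funext i
  refine Fin.addCases (fun i => ?_) (fun i => ?_) i <;> simp [Fin.appendEquiv]

theorem sum_tenSq_nonneg (hq : ∀ v, 0 ≤ q v) (C : Fam T V) (m : ℕ) :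
    0 ≤ ∑ j ∈ Finset.range m, tenSq e q (C j) :=
  Finset.sum_nonneg fun _ _ => tenSq_nonneg e hq _

theorem sum_tenSq_range_mono (hq : ∀ v, 0 ≤ q v) {k m : ℕ} (h : k ≤ m) (C : Fam T V) :
    ∑ j ∈ Finset.range k, tenSq e q (C j) ≤ ∑ j ∈ Finset.range m, tenSq e q (C j) :=
  Finset.sum_le_sum_of_subset_of_nonneg (Finset.range_mono h) fun _ _ _ => tenSq_nonneg e hq _

theorem sum_tenSq_shift_le (hq : ∀ v, 0 ≤ q v) (k : ℕ) (C : Fam T V) :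
    ∑ i, ∑ j ∈ Finset.range k, tenSq e q (shift (e i) C j) ≤
      ∑ j ∈ Finset.range (k + 1), tenSq e q (C j) := by
  rw [Finset.sum_comm, Finset.sum_range_succ' _ k]
  simp only [shift_apply, ← tenSq_succ]
  exact le_add_of_nonneg_right (tenSq_nonneg e hq (C 0))

/-- The estimate for the Leibniz formula; the constant depends neither on the number of frame
vectors nor on the dimensions. -/
theorem tenSq_leib_le {β : H →ₗ[ℝ] V →ₗ[ℝ] W} {qH : H → ℝ} {qV : V → ℝ} {qW : W → ℝ}
    (hH : ∀ b, 0 ≤ qH b) (hV : ∀ u, 0 ≤ qV u)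
    (hW : ∀ v w, qW (v + w) ≤ 2 * (qW v + qW w)) (hβ : ∀ b u, qW (β b u) ≤ qH b * qV u) (k : ℕ) :
    ∀ (B : Fam T H) (U : Fam T V), tenSq e qW (leib β k B U) ≤
      4 ^ k * (∑ j ∈ Finset.range (k + 1), tenSq e qH (B j)) *
        ∑ j ∈ Finset.range (k + 1), tenSq e qV (U j) := by
  induction k with
  | zero =>
    intro B U
    simp only [tenSq_zero, leib_zero, pow_zero, one_mul, zero_add, Finset.sum_range_one]
    exact hβ _ _
  | succ k ih =>
    intro B U
    set b := ∑ j ∈ Finset.range (k + 2), tenSq e qH (B j) with hb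
    set u := ∑ j ∈ Finset.range (k + 2), tenSq e qV (U j) with hu
    have hb0 : 0 ≤ b := sum_tenSq_nonneg e hH B _
    have hu0 : 0 ≤ u := sum_tenSq_nonneg e hV U _
    rw [tenSq_succ]
    calc ∑ i, tenSq e qW ((leib β (k + 1) B U).curryLeft (e i))
        ≤ ∑ i, 2 * (4 ^ k * (∑ j ∈ Finset.range (k + 1), tenSq e qH (shift (e i) B j)) * u +
            4 ^ k * b * ∑ j ∈ Finset.range (k + 1), tenSq e qV (shift (e i) U j)) := by
          refine Finset.sum_le_sum fun i _ => ?_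
          rw [leib_succ_curryLeft]
          refine (tenSq_add_le e hW _ _).trans ?_
          refine mul_le_mul_of_nonneg_left (add_le_add ?_ ?_) two_pos.le
          · refine (ih _ _).trans (mul_le_mul_of_nonneg_left
              (sum_tenSq_range_mono e hV (Nat.le_succ (k + 1)) U) ?_)
            exact mul_nonneg (by positivity) (sum_tenSq_nonneg e hH _ _)
          · refine (ih _ _).trans (mul_le_mul_of_nonneg_right ?_ (sum_tenSq_nonneg e hV _ _))
            exact mul_le_mul_of_nonneg_left
              (sum_tenSq_range_mono e hH (Nat.le_succ (k + 1)) B) (by positivity)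
      _ = 2 * (4 ^ k * (∑ i, ∑ j ∈ Finset.range (k + 1), tenSq e qH (shift (e i) B j)) * u +
            4 ^ k * b * ∑ i, ∑ j ∈ Finset.range (k + 1), tenSq e qV (shift (e i) U j)) := by
          rw [← Finset.mul_sum, Finset.sum_add_distrib, ← Finset.mul_sum, ← Finset.sum_mul,
            ← Finset.mul_sum]
      _ ≤ 2 * (4 ^ k * b * u + 4 ^ k * b * u) := by
          refine mul_le_mul_of_nonneg_left (add_le_add ?_ ?_) two_pos.le
          · exact mul_le_mul_of_nonneg_right
              (mul_le_mul_of_nonneg_left (sum_tenSq_shift_le e hH _ B) (by positivity)) hu0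
          · exact mul_le_mul_of_nonneg_left (sum_tenSq_shift_le e hV _ U) (by positivity)
      _ = 4 ^ (k + 1) * b * u := by ring

theorem tenSq_shiftN (j r : ℕ) : ∀ B : Fam T V,
    tenSq e (fun C : Fam T V => tenSq e q (C j)) (shiftN r B) = tenSq e q (B (j + r)) := by
  induction r with
  | zero => intro B; rw [tenSq_zero]; rfl
  | succ r ih =>
    intro B
    rw [tenSq_succ, ← add_assoc, tenSq_succ]
    refine Finset.sum_congr rfl fun i _ => ?_
    rw [shiftN_succ_curryLeft, ih, shift_apply]

theorem tenSq_finset_sum {α : Type*} (s : Finset α) {Q : α → V → ℝ} {k : ℕ}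
    (S : MultilinearMap ℝ (fun _ : Fin k => T) V) :
    tenSq e (fun v => ∑ a ∈ s, Q a v) S = ∑ a ∈ s, tenSq e (Q a) S := by
  simp only [tenSq]
  rw [Finset.sum_comm]

end TensorSquare

/-! ### Smooth local frames -/

section Frames

variable {n : ℕ} {M : Type*} [TopologicalSpace M] [ChartedSpace (EuclideanSpace ℝ (Fin n)) M]
  [IsManifold (𝓡 n) ∞ M]

/-- Smooth real functions on `M`. -/
abbrev SmoothFun (n : ℕ) {M : Type*} [TopologicalSpace M]
    [ChartedSpace (EuclideanSpace ℝ (Fin n)) M] (f : M → ℝ) : Prop :=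
  ContMDiff (𝓡 n) 𝓘(ℝ, ℝ) ∞ f

/-- Smooth sections of a real vector bundle. -/
abbrev SmoothSec (n : ℕ) {M : Type*} [TopologicalSpace M]
    [ChartedSpace (EuclideanSpace ℝ (Fin n)) M] (F : Type*) [NormedAddCommGroup F]
    [NormedSpace ℝ F] {V : M → Type*} [TopologicalSpace (TotalSpace F V)]
    [∀ x, TopologicalSpace (V x)] [FiberBundle F V] (s : Π x, V x) : Prop :=
  ContMDiff (𝓡 n) ((𝓡 n).prod 𝓘(ℝ, F)) ∞ (fun x => TotalSpace.mk' F x (s x))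

theorem exists_cutoff [T2Space M] (x₀ : M) {U : Set M} (hU : U ∈ nhds x₀) :
    ∃ χ : M → ℝ, SmoothFun n χ ∧ HasCompactSupport χ ∧ tsupport χ ⊆ U ∧
      ∀ᶠ x in nhds x₀, χ x = 1 := by
  obtain ⟨χ, -, hχ⟩ := (SmoothBumpFunction.nhds_basis_tsupport (I := 𝓡 n) x₀).mem_iff.1 hU
  exact ⟨χ, χ.contMDiff, χ.hasCompactSupport, hχ, χ.eventuallyEq_one⟩

theorem smoothFun_mul_of_tsupport {χ f : M → ℝ} (hχ : SmoothFun n χ)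
    (hf : ∀ x ∈ tsupport χ, ContMDiffAt (𝓡 n) 𝓘(ℝ, ℝ) ∞ f x) :
    SmoothFun n (fun x => χ x * f x) := by
  refine contMDiff_of_tsupport fun x hx => ?_
  exact (hχ x).mul (hf x (tsupport_mul_subset_left hx))

theorem smoothFun_det {ι : Type*} [Fintype ι] [DecidableEq ι] {G : M → Matrix ι ι ℝ}
    (hG : ∀ a b, SmoothFun n (fun x => G x a b)) : SmoothFun n (fun x => (G x).det) := by
  simp only [Matrix.det_apply]
  refine contMDiff_finsetSum fun σ _ => ?_
  have h : SmoothFun n (fun x => ∏ i, G x (σ i) i) := contMDiff_finsetProd fun i _ => hG _ _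
  simp only [Units.smul_def, zsmul_eq_mul]
  exact contMDiff_const.mul h

theorem smoothFun_adjugate {ι : Type*} [Fintype ι] [DecidableEq ι] {G : M → Matrix ι ι ℝ}
    (hG : ∀ a b, SmoothFun n (fun x => G x a b)) (a b : ι) :
    SmoothFun n (fun x => (G x).adjugate a b) := by
  simp only [Matrix.adjugate_apply]
  refine smoothFun_det fun c d => ?_
  simp only [Matrix.updateRow_apply]
  split_ifs
  · exact contMDiff_const
  · exact hG _ _

variable {F : Type*} [NormedAddCommGroup F] [NormedSpace ℝ F] {V : M → Type*}
  [TopologicalSpace (TotalSpace F V)] [∀ x, AddCommGroup (V x)] [∀ x, Module ℝ (V x)]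
  [∀ x, TopologicalSpace (V x)] [FiberBundle F V]

/-- `Z` is a family of compactly supported smooth sections which is a frame on the open set `U`;
`θ` is a family of smooth covector fields which is the dual frame on `U`. -/
structure IsCutFrame (n : ℕ) {M : Type*} [TopologicalSpace M]
    [ChartedSpace (EuclideanSpace ℝ (Fin n)) M] (F : Type*) [NormedAddCommGroup F]
    [NormedSpace ℝ F] {V : M → Type*} [TopologicalSpace (TotalSpace F V)]
    [∀ x, AddCommGroup (V x)] [∀ x, Module ℝ (V x)] [∀ x, TopologicalSpace (V x)]
    [FiberBundle F V] {ι : Type*} [Fintype ι] [DecidableEq ι] (U : Set M)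
    (Z : ι → Π x, V x) (θ : ι → Π x, V x →ₗ[ℝ] ℝ) : Prop where
  isOpen : IsOpen U
  smooth : ∀ a, SmoothSec n F (Z a)
  compact : ∀ a, IsCompact (closure {x | Z a x ≠ 0})
  smooth_coeff : ∀ a (s : Π x, V x), SmoothSec n F s → SmoothFun n (fun x => θ a x (s x))
  expand : ∀ x ∈ U, ∀ v : V x, v = ∑ a, θ a x v • Z a x
  dual : ∀ x ∈ U, ∀ a b, θ a x (Z b x) = if a = b then 1 else 0

theorem isCompact_closure_support_smul {χ : M → ℝ} (hχ : HasCompactSupport χ) (s : Π x, V x) :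
    IsCompact (closure {x | χ x • s x ≠ 0}) := by
  refine hχ.of_isClosed_subset isClosed_closure (closure_mono fun x hx => ?_)
  rw [Function.mem_support]
  rintro h
  exact hx (by rw [h, zero_smul])

variable [VectorBundle ℝ F V] [ContMDiffVectorBundle ∞ F V (𝓡 n)] [FiniteDimensional ℝ F]

/-- The local frame of a trivialization, cut off so that the sections are globally smooth. -/
theorem exists_cutFrame [T2Space M] (x₀ : M) :
    ∃ (U : Set M) (Z : Fin (Module.finrank ℝ F) → Π x, V x)
      (θ : Fin (Module.finrank ℝ F) → Π x, V x →ₗ[ℝ] ℝ),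
      x₀ ∈ U ∧ IsCutFrame n F U Z θ := by
  have : ContMDiffVectorBundle 1 F V (𝓡 n) := ContMDiffVectorBundle.of_le (n := ∞) (by simp)
  let e := trivializationAt F V x₀
  have hx₀ : x₀ ∈ e.baseSet := FiberBundle.mem_baseSet_trivializationAt F V x₀
  let b := Module.finBasis ℝ F
  obtain ⟨χ, hχ, hχc, hχU, hχ1⟩ := exists_cutoff (n := n) x₀ (e.open_baseSet.mem_nhds hx₀)
  obtain ⟨U, hU, hUo, hxU⟩ := eventually_nhds_iff.1 hχ1
  have hUe : U ⊆ e.baseSet := fun x hx => hχU (subset_tsupport _ (by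
    rw [Function.mem_support, hU x hx]; exact one_ne_zero))
  refine ⟨U, fun a x => χ x • e.localFrame b a x, fun a x => χ x • e.localFrameCoeff (𝓡 n) b a x,
    hxU, hUo, fun a => ?_, fun a => isCompact_closure_support_smul hχc _, fun a s hs => ?_,
    fun x hx v => ?_, fun x hx a c => ?_⟩
  · exact contMDiffOn_univ.1 (ContMDiffOn.smul_section_of_tsupport
      hχ.contMDiffOn e.open_baseSet hχU (e.contMDiffOn_localFrame_baseSet ∞ b a)).contMDiffOn
  · refine smoothFun_mul_of_tsupport hχ fun x hx => ?_
    exact contMDiffAt_localFrameCoeff b (hχU hx) (hs x) a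
  · classical
    have := e.eq_sum_localFrameCoeff_smul (I := 𝓡 n) (b := b) (s := Function.update 0 x v) (hUe hx)
    simp only [hU x hx, one_smul]
    simpa using this
  · simp only [hU x hx, one_smul]
    have := e.localFrameCoeff_apply_of_mem_baseSet (I := 𝓡 n) b (hUe hx) (e.localFrame b c) a
    rw [this, e.localFrame_apply_of_mem_baseSet b (hUe hx), Module.Basis.repr_self,
      Finsupp.single_apply]
    simp only [eq_comm]

/-- Near every point, a frame together with its dual frame for a smooth metric `g`. -/
theorem exists_metricFrame [T2Space M] (g : Π x, V x →ₗ[ℝ] V x →ₗ[ℝ] ℝ)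
    (hpos : ∀ x v, g x v v = 0 → v = 0)
    (hg : ∀ s t : Π x, V x, SmoothSec n F s → SmoothSec n F t →
      SmoothFun n (fun x => g x (s x) (t x))) (x₀ : M) :
    ∃ (U : Set M) (Z W : Fin (Module.finrank ℝ F) → Π x, V x),
      x₀ ∈ U ∧ IsOpen U ∧ (∀ a, SmoothSec n F (Z a)) ∧ (∀ a, SmoothSec n F (W a)) ∧
      (∀ a, IsCompact (closure {x | Z a x ≠ 0})) ∧ (∀ a, IsCompact (closure {x | W a x ≠ 0})) ∧
      ∀ x ∈ U, ∀ v, v = ∑ a, g x (W a x) v • Z a x := by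
  obtain ⟨U, Z, θ, hxU, hZ⟩ := exists_cutFrame (n := n) (F := F) (V := V) x₀
  obtain ⟨χ, hχ, hχc, hχU, hχ1⟩ := exists_cutoff (n := n) x₀ (hZ.isOpen.mem_nhds hxU)
  obtain ⟨U', hU', hUo', hxU'⟩ := eventually_nhds_iff.1 hχ1
  have hUU : U' ⊆ U := fun x hx => hχU (subset_tsupport _ (by
    rw [Function.mem_support, hU' x hx]; exact one_ne_zero))
  let G : M → Matrix (Fin (Module.finrank ℝ F)) (Fin (Module.finrank ℝ F)) ℝ :=
    fun x => Matrix.of fun a b => g x (Z a x) (Z b x)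
  have hG : ∀ a b, SmoothFun n (fun x => G x a b) := fun a b => hg _ _ (hZ.smooth a) (hZ.smooth b)
  have hdet : ∀ x ∈ U, (G x).det ≠ 0 := by
    intro x hx h0
    obtain ⟨c, hc, hGc⟩ := Matrix.exists_mulVec_eq_zero_iff.2 h0
    have hv : ∑ b, c b • Z b x = 0 := by
      refine hpos x _ ?_
      have : ∀ a, g x (Z a x) (∑ b, c b • Z b x) = 0 := by
        intro a
        have := congrFun hGc a
        simp only [Matrix.mulVec, dotProduct, G, Matrix.of_apply, Pi.zero_apply] at this
        rw [map_sum, ← this]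
        refine Finset.sum_congr rfl fun b _ => ?_
        rw [map_smul, smul_eq_mul, mul_comm]
      have h : ∀ w, w = ∑ b, c b • Z b x → g x (∑ b, c b • Z b x) w = 0 := by
        intro w hw
        simp only [map_sum, LinearMap.sum_apply, map_smul, LinearMap.smul_apply]
        refine Finset.sum_eq_zero fun a _ => ?_
        rw [hw, this, smul_zero]
      exact h _ rfl
    refine hc (funext fun a => ?_)
    have := congrArg (θ a x) hv
    simpa [hZ.dual x hx] using this
  refine ⟨U', Z, fun a x => ∑ b, (χ x * ((G x).det⁻¹ * (G x).adjugate a b)) • Z b x, hxU', hUo',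
    hZ.smooth, fun a => ?_, hZ.compact, fun a => ?_, fun x hx v => ?_⟩
  · refine ContMDiff.sum_section fun b _ => ContMDiff.smul_section ?_ (hZ.smooth b)
    refine smoothFun_mul_of_tsupport hχ fun x hx => ?_
    have h1 : ContMDiffAt (𝓡 n) 𝓘(ℝ, ℝ) ∞ (fun x => (G x).det) x := smoothFun_det hG x
    exact (h1.inv₀ (hdet x (hχU hx))).mul (smoothFun_adjugate hG a b x)
  · simp only [mul_smul, ← Finset.smul_sum]
    exact isCompact_closure_support_smul hχc _
  · have hx' := hUU hx
    conv_lhs => rw [hZ.expand x hx' v]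
    refine Finset.sum_congr rfl fun a _ => ?_
    congr 1
    have hinv : ∀ c, ∑ b, (χ x * ((G x).det⁻¹ * (G x).adjugate a b)) * G x b c =
        if a = c then 1 else 0 := by
      intro c
      have h := congrFun (congrFun (Matrix.adjugate_mul (G x)) a) c
      rw [Matrix.mul_apply, Matrix.smul_apply, Matrix.one_apply, smul_eq_mul] at h
      simp only [hU' x hx, one_mul, mul_assoc, ← Finset.mul_sum]
      rw [h, inv_mul_cancel_left₀ (hdet x hx')]
    have hc : ∀ c, g x (∑ b, (χ x * ((G x).det⁻¹ * (G x).adjugate a b)) • Z b x) (Z c x) =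
        if a = c then 1 else 0 := by
      intro c
      rw [← hinv c]
      simp [G]
    change _ = g x (∑ b, (χ x * ((G x).det⁻¹ * (G x).adjugate a b)) • Z b x) v
    generalize (∑ b, (χ x * ((G x).det⁻¹ * (G x).adjugate a b)) • Z b x) = w at hc ⊢
    conv_rhs => rw [hZ.expand x hx' v]
    simp [hc]

theorem trace_eq_sum_of_expand {V : Type*} [AddCommGroup V] [Module ℝ V] [FiniteDimensional ℝ V]
    {ι : Type*} [Fintype ι] {Z : ι → V} {θ : ι → V →ₗ[ℝ] ℝ} (h : ∀ v, v = ∑ a, θ a v • Z a)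
    (f : V →ₗ[ℝ] V) : LinearMap.trace ℝ V f = ∑ a, θ a (f (Z a)) := by
  have : f = ∑ a, (θ a).smulRight (f (Z a)) := by
    ext v
    conv_lhs => rw [h v]
    rw [map_sum, LinearMap.sum_apply]
    exact Finset.sum_congr rfl fun a _ => by rw [map_smul, LinearMap.smulRight_apply]
  conv_lhs => rw [this]
  simp

/-- A smooth section which vanishes at `x` is a combination of smooth sections with smooth
coefficients which vanish at `x`. -/
theorem exists_eq_sum_of_vanish [T2Space M] {s : Π x, V x} (hs : SmoothSec n F s) {x : M}
    (hx : s x = 0) : ∃ (f : Option (Fin (Module.finrank ℝ F)) → M → ℝ)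
      (t : Option (Fin (Module.finrank ℝ F)) → Π x, V x),
      (∀ a, SmoothFun n (f a)) ∧ (∀ a, f a x = 0) ∧ (∀ a, SmoothSec n F (t a)) ∧
      s = fun y => ∑ a, f a y • t a y := by
  obtain ⟨U, Z, θ, hxU, hZ⟩ := exists_cutFrame (n := n) (F := F) (V := V) x
  obtain ⟨χ, hχ, hχc, hχU, hχ1⟩ := exists_cutoff (n := n) x (hZ.isOpen.mem_nhds hxU)
  refine ⟨fun a y => a.elim (1 - χ y) (fun a => χ y * θ a y (s y)), fun a => a.elim s Z,
    ?_, ?_, ?_, ?_⟩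
  · rintro (_ | a)
    · exact contMDiff_const.sub hχ
    · exact hχ.mul (hZ.smooth_coeff a s hs)
  · rintro (_ | a)
    · simp [hχ1.self_of_nhds]
    · simp [hx]
  · rintro (_ | a)
    · exact hs
    · exact hZ.smooth a
  · funext y
    rw [Fintype.sum_option]
    simp only [Option.elim, mul_smul, ← Finset.smul_sum]
    by_cases hy : y ∈ U
    · rw [← hZ.expand y hy (s y)]
      module
    · have : χ y = 0 := by
        by_contra h
        exact hy (hχU (subset_tsupport _ h))
      simp [this]

/-- A linear extension of the vectors at `x` to compactly supported smooth sections. -/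
theorem exists_linear_extension [T2Space M] (x : M) :
    ∃ ext : V x →ₗ[ℝ] Π y, V y, (∀ v, SmoothSec n F (ext v)) ∧ (∀ v, ext v x = v) ∧
      ∀ v, IsCompact (closure {y | ext v y ≠ 0}) := by
  obtain ⟨U, Z, θ, hxU, hZ⟩ := exists_cutFrame (n := n) (F := F) (V := V) x
  obtain ⟨χ, hχ, hχc, hχU, hχ1⟩ := exists_cutoff (n := n) x (hZ.isOpen.mem_nhds hxU)
  refine ⟨∑ a, (θ a x).smulRight (χ • Z a), fun v => ?_, fun v => ?_, fun v => ?_⟩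
  · have : (∑ a, (θ a x).smulRight (χ • Z a)) v =
        fun y => ∑ a, (θ a x v * χ y) • Z a y := by
      funext y
      simp [mul_smul]
    rw [this]
    exact ContMDiff.sum_section fun a _ =>
      ContMDiff.smul_section (contMDiff_const.mul hχ) (hZ.smooth a)
  · refine Eq.trans ?_ (hZ.expand x hxU v).symm
    rw [LinearMap.sum_apply, Finset.sum_apply]
    exact Finset.sum_congr rfl fun a _ => by simp [hχ1.self_of_nhds]
  · have : (∑ a, (θ a x).smulRight (χ • Z a)) v =
        fun y => χ y • ∑ a, θ a x v • Z a y := by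
      funext y
      rw [LinearMap.sum_apply, Finset.sum_apply, Finset.smul_sum]
      exact Finset.sum_congr rfl fun a _ => smul_comm _ _ _
    rw [this]
    exact isCompact_closure_support_smul hχc _

/-- Every covector at `x` is the differential of a smooth function which vanishes at `x`. -/
theorem exists_smoothFun_mvfderiv [T2Space M] (x : M) (ξ : Tan n x →ₗ[ℝ] ℝ) :
    ∃ f : M → ℝ, SmoothFun n f ∧ f x = 0 ∧ ∀ v : Tan n x, mvfderiv (𝓡 n) f x v = ξ v := by
  obtain ⟨χ, hχ, hχc, hχU, hχ1⟩ := exists_cutoff (n := n) x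
    (chart_source_mem_nhds (EuclideanSpace ℝ (Fin n)) x)
  let l : EuclideanSpace ℝ (Fin n) →L[ℝ] ℝ := LinearMap.toContinuousLinearMap ξ
  let h : M → ℝ := fun y => l (extChartAt (𝓡 n) x y) - l (extChartAt (𝓡 n) x x)
  refine ⟨fun y => χ y * h y, ?_, ?_, ?_⟩
  · refine smoothFun_mul_of_tsupport hχ fun y hy => ?_
    exact (l.contDiff.contMDiff.contMDiffAt.comp y (contMDiffAt_extChartAt' (hχU hy))).sub
      contMDiffAt_const
  · simp [h]
  · intro v
    have he : (fun y => χ y * h y) =ᶠ[nhds x] h := by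
      filter_upwards [hχ1] with y hy
      rw [hy, one_mul]
    have h1 : HasMFDerivAt (𝓡 n) 𝓘(ℝ, ℝ) h x (l.comp (tangentCoordChange (𝓡 n) x x x)) := by
      have := hasMFDerivAt_extChartAt (I := 𝓡 n) (mem_chart_source (EuclideanSpace ℝ (Fin n)) x)
      rw [mfderiv_chartAt_eq_tangentCoordChange (mem_chart_source _ x)] at this
      have h2 := l.hasMFDerivAt (x := extChartAt (𝓡 n) x x)
      have h3 := (h2.comp x this).sub (hasMFDerivAt_const (l (extChartAt (𝓡 n) x x)) x)
      exact h3.congr_mfderiv (sub_zero _)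
    rw [mvfderiv, (h1.congr_of_eventuallyEq he).mfderiv]
    have := tangentCoordChange_self (I := 𝓡 n) (x := x) (z := x) (v := v) (mem_extChartAt_source x)
    exact congrArg ξ this

end Frames

/-! ### Relational connections -/

section ConnRel

variable {n : ℕ} {M : Type*} [TopologicalSpace M] [ChartedSpace (EuclideanSpace ℝ (Fin n)) M]
  [IsManifold (𝓡 n) ∞ M]

section Defs

variable {V : M → Type*} [∀ x, AddCommGroup (V x)] [∀ x, Module ℝ (V x)]

/-- The relation `R s s'`, read "`s` is smooth and `∇ s = s'`", satisfies the rules of a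
connection. -/
structure IsConnRel (R : (Π x, V x) → (Π x : M, Tan n x → V x) → Prop) : Prop where
  zero : R (fun _ => 0) (fun _ _ => 0)
  add : ∀ {s s' t t'}, R s s' → R t t' →
    R (fun x => s x + t x) (fun x v => s' x v + t' x v)
  smul : ∀ {f : M → ℝ} {s s'}, SmoothFun n f → R s s' →
    R (fun x => f x • s x) (fun x v => mvfderiv (𝓡 n) f x v • s x + f x • s' x v)
  unique : ∀ {s s' s''}, R s s' → R s s'' → s' = s''
  linear : ∀ {s s'}, R s s' → ∀ x, IsLinearMap ℝ (s' x)
  smooth : ∀ {s s'} {X : Π x : M, Tan n x}, R s s' → SmoothField X →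
    ∃ t', R (fun x => s' x (X x)) t'

/-- A relational connection on a family of fibres which has enough smooth sections, so that
`C^∞`-linear operations on sections are given by fibrewise linear maps. -/
structure IsFrameRel (R : (Π x, V x) → (Π x : M, Tan n x → V x) → Prop) : Prop
    extends IsConnRel R where
  exists_ext : ∀ x, ∃ ext : V x →ₗ[ℝ] Π y, V y, (∀ v, ∃ s', R (ext v) s') ∧ ∀ v, ext v x = v
  exists_sum : ∀ {s s'} {x}, R s s' → s x = 0 →
    ∃ (ι : Type) (_ : Fintype ι) (f : ι → M → ℝ) (t : ι → Π x, V x) (t' : ι → Π x, Tan n x → V x),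
      (∀ a, SmoothFun n (f a)) ∧ (∀ a, f a x = 0) ∧ (∀ a, R (t a) (t' a)) ∧
      s = fun y => ∑ a, f a y • t a y

/-- The connection induced on the bundle of real linear maps from `V` to `W`. -/
def linDeriv {W : M → Type*} [∀ x, AddCommGroup (W x)] [∀ x, Module ℝ (W x)]
    (RV : (Π x, V x) → (Π x : M, Tan n x → V x) → Prop)
    (RW : (Π x, W x) → (Π x : M, Tan n x → W x) → Prop)
    (a : Π x, V x →ₗ[ℝ] W x) (a' : Π x : M, Tan n x → (V x →ₗ[ℝ] W x)) : Prop :=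
  ∀ s s', RV s s' → RW (fun x => a x (s x)) (fun x v => a' x v (s x) + a x (s' x v))

end Defs

theorem rel_congr {α β : Type*} {R : α → β → Prop} {a b : α} {a' b' : β} (h : R a a')
    (h₁ : b = a) (h₂ : b' = a') : R b b' := by
  rw [h₁, h₂]; exact h

namespace IsConnRel

variable {V : M → Type*} [∀ x, AddCommGroup (V x)] [∀ x, Module ℝ (V x)]
  {R : (Π x, V x) → (Π x : M, Tan n x → V x) → Prop}

theorem const_smul (hR : IsConnRel R) (c : ℝ) {s s'} (h : R s s') :
    R (fun x => c • s x) (fun x v => c • s' x v) := by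
  have := hR.smul (f := fun _ => c) contMDiff_const h
  simpa [mvfderiv_const] using this

theorem neg (hR : IsConnRel R) {s s'} (h : R s s') :
    R (fun x => -s x) (fun x v => -s' x v) := by
  simpa using hR.const_smul (-1) h

theorem sub (hR : IsConnRel R) {s s' t t'} (h : R s s') (h' : R t t') :
    R (fun x => s x - t x) (fun x v => s' x v - t' x v) := by
  simpa [sub_eq_add_neg] using hR.add h (hR.neg h')

theorem sum (hR : IsConnRel R) {ι : Type*} (u : Finset ι) {s : ι → Π x, V x}
    {s' : ι → Π x, Tan n x → V x} (h : ∀ a ∈ u, R (s a) (s' a)) :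
    R (fun x => ∑ a ∈ u, s a x) (fun x v => ∑ a ∈ u, s' a x v) := by
  classical
  induction u using Finset.induction_on with
  | empty => simpa using hR.zero
  | insert a u ha ih =>
    simp only [Finset.sum_insert ha]
    exact hR.add (h a (Finset.mem_insert_self a u))
      (ih fun b hb => h b (Finset.mem_insert_of_mem hb))

end IsConnRel

section Lin

variable {V W : M → Type*} [∀ x, AddCommGroup (V x)] [∀ x, Module ℝ (V x)]
  [∀ x, AddCommGroup (W x)] [∀ x, Module ℝ (W x)]
  {RV : (Π x, V x) → (Π x : M, Tan n x → V x) → Prop}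
  {RW : (Π x, W x) → (Π x : M, Tan n x → W x) → Prop}

/-- A fibrewise linear map which maps smooth sections to smooth sections is differentiable: the
operation `s ↦ ∇ (a s) - a (∇ s)` is `C^∞`-linear. -/
theorem exists_linDeriv (hV : IsFrameRel RV) (hW : IsConnRel RW) (a : Π x, V x →ₗ[ℝ] W x)
    (ha : ∀ s s', RV s s' → ∃ t', RW (fun x => a x (s x)) t') :
    ∃ a', linDeriv RV RW a a' := by
  -- `P s s' t'` is the operation, for the derivatives `s'` of `s` and `t'` of `a s`
  let P : (Π x : M, Tan n x → V x) → (Π x : M, Tan n x → W x) → Π x : M, Tan n x → W x :=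
    fun s' t' x v => t' x v - a x (s' x v)
  have key : ∀ {s s' t'}, RV s s' → RW (fun x => a x (s x)) t' → ∀ x, s x = 0 →
      ∀ v, P s' t' x v = 0 := by
    intro s s' t' hs ht x hx v
    obtain ⟨ι, _, f, r, r', hf, hfx, hr, rfl⟩ := hV.exists_sum hs hx
    choose q hq using fun i => ha _ _ (hr i)
    have h1 := hV.toIsConnRel.sum Finset.univ fun i _ => hV.smul (hf i) (hr i)
    have h2 := hW.sum Finset.univ fun i _ => hW.smul (hf i) (hq i)
    have h3 : (fun x => a x (∑ i, f i x • r i x)) = fun x => ∑ i, f i x • a x (r i x) := by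
      funext y
      simp
    rw [h3] at ht
    rw [hV.unique hs h1, hW.unique ht h2]
    simp [P, hfx]
  choose ext hext hextx using hV.exists_ext
  choose e' he' using hext
  choose t' ht' using fun x v => ha _ _ (he' x v)
  have hadd : ∀ x v w, e' x (v + w) = fun y z => e' x v y z + e' x w y z := fun x v w =>
    hV.unique (he' x (v + w)) (by
      have := hV.add (he' x v) (he' x w)
      exact rel_congr this (map_add _ _ _) rfl)
  have hadd' : ∀ x v w, t' x (v + w) = fun y z => t' x v y z + t' x w y z := fun x v w =>
    hW.unique (ht' x (v + w)) (by
      have := hW.add (ht' x v) (ht' x w)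
      simpa using this)
  have hsmul : ∀ x (c : ℝ) v, e' x (c • v) = fun y z => c • e' x v y z := fun x c v =>
    hV.unique (he' x (c • v)) (by
      have := hV.toIsConnRel.const_smul c (he' x v)
      exact rel_congr this (map_smul _ _ _) rfl)
  have hsmul' : ∀ x (c : ℝ) v, t' x (c • v) = fun y z => c • t' x v y z := fun x c v =>
    hW.unique (ht' x (c • v)) (by
      have := hW.const_smul c (ht' x v)
      simpa using this)
  refine ⟨fun x z =>
    { toFun := fun v => P (e' x v) (t' x v) x z
      map_add' := fun v w => by simp only [P, hadd, hadd', map_add]; abel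
      map_smul' := fun c v => by
        simp only [P, hsmul, hsmul', map_smul, RingHom.id_apply, smul_sub] }, ?_⟩
  intro s s' hs
  obtain ⟨r, hr⟩ := ha s s' hs
  convert hr using 1
  funext x z
  have h1 := hV.toIsConnRel.sub hs (he' x (s x))
  have h2 := hW.sub hr (ht' x (s x))
  have h3 := key (t' := fun y z => r y z - t' x (s x) y z) h1 (by
    convert h2 using 2 with y
    exact map_sub _ _ _) x (by rw [hextx, sub_self]) z
  simp only [P, map_sub] at h3
  simp only [P, LinearMap.coe_mk, AddHom.coe_mk]
  rw [← sub_eq_zero, ← neg_eq_zero, ← h3]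
  abel

/-- Differentiable sections attain all values at a point, so they detect the derivative of `a`. -/
theorem linDeriv_unique (hV : IsFrameRel RV) (hW : IsConnRel RW) {a : Π x, V x →ₗ[ℝ] W x}
    {a' a''} (h : linDeriv RV RW a a') (h' : linDeriv RV RW a a'') : a' = a'' := by
  funext x v
  ext e
  obtain ⟨ext, hext, hx⟩ := hV.exists_ext x
  obtain ⟨s', hs'⟩ := hext e
  have := congrFun (congrFun (hW.unique (h _ _ hs') (h' _ _ hs')) x) v
  simpa [hx] using this

theorem isConnRel_linDeriv (hV : IsFrameRel RV) (hW : IsConnRel RW) :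
    IsConnRel (linDeriv RV RW) where
  zero := fun s s' _ => by simpa using hW.zero
  add := fun h h' s s' hs => by
    refine rel_congr (hW.add (h s s' hs) (h' s s' hs)) rfl ?_
    funext x v
    simp only [LinearMap.add_apply]
    abel
  smul := fun {f a a'} hf h s s' hs => by
    refine rel_congr (hW.smul hf (h s s' hs)) rfl ?_
    funext x v
    simp only [LinearMap.add_apply, LinearMap.smul_apply, smul_add]
    abel
  unique := fun h h' => linDeriv_unique hV hW h h'
  linear := fun {a a'} h x => by
    constructor
    · intro v w
      ext e
      obtain ⟨ext, hext, hx⟩ := hV.exists_ext x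
      obtain ⟨s', hs'⟩ := hext e
      have h1 := (hW.linear (h _ _ hs') x).map_add v w
      have h2 := (hV.linear hs' x).map_add v w
      simp only [h2, map_add, hx] at h1
      rw [LinearMap.add_apply]
      have h3 : a' x (v + w) e + (a x (s' x v) + a x (s' x w)) =
        (a' x v e + a' x w e) + (a x (s' x v) + a x (s' x w)) := by rw [h1]; abel
      exact add_right_cancel h3
    · intro c v
      ext e
      obtain ⟨ext, hext, hx⟩ := hV.exists_ext x
      obtain ⟨s', hs'⟩ := hext e
      have h1 := (hW.linear (h _ _ hs') x).map_smul c v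
      have h2 := (hV.linear hs' x).map_smul c v
      simp only [h2, map_smul, hx, smul_add] at h1
      exact add_right_cancel h1
  smooth := fun {a a' X} h hX => by
    refine exists_linDeriv hV hW _ fun s s' hs => ?_
    obtain ⟨t', ht'⟩ := hW.smooth (h s s' hs) hX
    obtain ⟨r', hr'⟩ := hV.smooth hs hX
    refine ⟨_, rel_congr (hW.sub ht' (h _ _ hr')) ?_ rfl⟩
    funext x
    exact (add_sub_cancel_right _ _).symm

end Lin

end ConnRel

/-! ### Covariant derivatives of tensor fields -/

section TenDeriv

variable {n : ℕ} {M : Type*} [TopologicalSpace M] [ChartedSpace (EuclideanSpace ℝ (Fin n)) M]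
  [IsManifold (𝓡 n) ∞ M]

section Sec

variable {F : Type*} [NormedAddCommGroup F] [NormedSpace ℝ F] {V : M → Type*}
  [TopologicalSpace (TotalSpace F V)] [∀ x, AddCommGroup (V x)] [∀ x, Module ℝ (V x)]
  [∀ x, TopologicalSpace (V x)] [∀ x, IsTopologicalAddGroup (V x)]
  [∀ x, ContinuousSMul ℝ (V x)] [FiberBundle F V]

/-- `s` is a smooth section of a real vector bundle and `s'` is its covariant derivative. -/
def secRel (cov : CovariantDerivative (𝓡 n) F V) (s : Π x, V x) (s' : Π x : M, Tan n x → V x) :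
    Prop :=
  SmoothSec n F s ∧ ∀ x v, s' x v = cov s x v

variable [VectorBundle ℝ F V] [ContMDiffVectorBundle ∞ F V (𝓡 n)] [FiniteDimensional ℝ F]

theorem isFrameRel_secRel [T2Space M] {cov : CovariantDerivative (𝓡 n) F V}
    (hcov : ∀ (s : Π x, V x) (X : Π x : M, Tan n x), SmoothSec n F s → SmoothField X →
      SmoothSec n F (fun x => cov s x (X x))) : IsFrameRel (secRel cov) where
  zero := by
    refine ⟨contMDiff_zeroSection ℝ V, fun x v => ?_⟩
    have : cov (fun _ => 0) = 0 := cov.zero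
    rw [this]; rfl
  add := fun {s s' t t'} h h' => by
    refine ⟨h.1.add_section h'.1, fun x v => ?_⟩
    have := cov.isCovariantDerivativeOnUniv.add (x := x) (h.1.mdifferentiable (by simp) x)
      (h'.1.mdifferentiable (by simp) x)
    simp only [h.2, h'.2]
    exact (DFunLike.congr_fun this v).symm
  smul := fun {f s s'} hf h => by
    refine ⟨hf.smul_section h.1, fun x v => ?_⟩
    have := cov.isCovariantDerivativeOnUniv.leibniz (x := x) (h.1.mdifferentiable (by simp) x)
      (hf.mdifferentiable (by simp) x)
    simp only [h.2]
    rw [add_comm]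
    exact (DFunLike.congr_fun this v).symm
  unique := fun h h' => by
    funext x v
    rw [h.2, h'.2]
  linear := fun {s s'} h x => ⟨fun v w => by simp [h.2], fun c v => by simp [h.2]⟩
  smooth := fun {s s' X} h hX => by
    refine ⟨_, ?_, fun _ _ => rfl⟩
    simp only [h.2]
    exact hcov s X h.1 hX
  exists_ext := fun x => by
    obtain ⟨ext, h1, h2, -⟩ := exists_linear_extension (n := n) (F := F) (V := V) x
    exact ⟨ext, fun v => ⟨_, h1 v, fun _ _ => rfl⟩, h2⟩
  exists_sum := fun {s s' x} h hx => by
    obtain ⟨f, t, h1, h2, h3, h4⟩ := exists_eq_sum_of_vanish h.1 hx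
    exact ⟨_, inferInstance, f, t, _, h1, h2, fun a => ⟨h3 a, fun _ _ => rfl⟩, h4⟩

theorem smoothSec_covariantDerivative {cov : CovariantDerivative (𝓡 n) F V}
    (h : CovariantDerivative.ContMDiffCovariantDerivative cov ∞) {s : Π x, V x}
    {X : Π x : M, Tan n x} (hs : SmoothSec n F s) (hX : SmoothField X) :
    SmoothSec n F (fun x => cov s x (X x)) := by
  have h1 := contMDiffOn_univ.1 (h.contMDiff.contMDiff (σ := s) hs.contMDiffOn)
  exact ContMDiff.clm_bundle_apply h1 hX

end Sec

variable {D : CovariantDerivative (𝓡 n) (EuclideanSpace ℝ (Fin n))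
  (fun x : M => TangentSpace (𝓡 n) x)}

/-- `D_X Y` is smooth for smooth vector fields `X` and `Y`. -/
def IsSmoothConn (D : CovariantDerivative (𝓡 n) (EuclideanSpace ℝ (Fin n))
    (fun x : M => TangentSpace (𝓡 n) x)) : Prop :=
  ∀ X Y : Π x : M, Tan n x, SmoothField X → SmoothField Y → SmoothField (fun x => D Y x (X x))

theorem isFrameRel_tangent [T2Space M] (hD : IsSmoothConn D) : IsFrameRel (secRel D) :=
  isFrameRel_secRel fun s X hs hX => hD X s hX hs

variable {V W H : M → Type*} [∀ x, AddCommGroup (V x)] [∀ x, Module ℝ (V x)]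
  [∀ x, AddCommGroup (W x)] [∀ x, Module ℝ (W x)]
  [∀ x, AddCommGroup (H x)] [∀ x, Module ℝ (H x)]
  {R : (Π x, V x) → (Π x : M, Tan n x → V x) → Prop}
  {RV : (Π x, V x) → (Π x : M, Tan n x → V x) → Prop}
  {RW : (Π x, W x) → (Π x : M, Tan n x → W x) → Prop}
  {RH : (Π x, H x) → (Π x : M, Tan n x → H x) → Prop}

theorem tenDeriv_zero_iff {T : Π x, Ten n 0 V x} {T' : Π x : M, Tan n x → Ten n 0 V x} :
    tenDeriv D R 0 T T' ↔ R (fun x => T x 0) (fun x v => T' x v 0) := by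
  constructor
  · intro h
    refine rel_congr (h (fun i => i.elim0) fun i => i.elim0) ?_ ?_
    · funext x; congr 1; exact Subsingleton.elim _ _
    · funext x v
      rw [Finset.univ_eq_empty, Finset.sum_empty, add_zero]
      congr 1; exact Subsingleton.elim _ _
  · intro h Y _
    refine rel_congr h ?_ ?_
    · funext x; congr 1; exact Subsingleton.elim _ _
    · funext x v
      rw [Finset.univ_eq_empty, Finset.sum_empty, add_zero]
      congr 1; exact Subsingleton.elim _ _

theorem tenDeriv_succ_iff {k : ℕ} {T : Π x, Ten n (k + 1) V x}
    {T' : Π x : M, Tan n x → Ten n (k + 1) V x} :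
    tenDeriv D R (k + 1) T T' ↔ ∀ Y : Π x : M, Tan n x, SmoothField Y →
      tenDeriv D R k (fun x => (T x).curryLeft (Y x))
        (fun x v => (T' x v).curryLeft (Y x) + (T x).curryLeft (D Y x v)) := by
  have key : ∀ Y : Fin (k + 1) → Π x : M, Tan n x,
      (R (fun x => T x fun i => Y i x) (fun x v => T' x v (fun i => Y i x) +
        ∑ i, T x (Function.update (fun l => Y l x) i (D (Y i) x v))) ↔
      R (fun x => (T x).curryLeft (Y 0 x) fun i => Y i.succ x)
        (fun x v => ((T' x v).curryLeft (Y 0 x) + (T x).curryLeft (D (Y 0) x v))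
            (fun i => Y i.succ x) +
          ∑ i, (T x).curryLeft (Y 0 x)
            (Function.update (fun l => Y l.succ x) i (D (Y i.succ) x v)))) := by
    intro Y
    have h0 : ∀ x, (fun i => Y i x) = Fin.cons (Y 0 x) (fun i => Y i.succ x) := fun x =>
      (Fin.cons_self_tail fun i => Y i x).symm
    have h1 : (fun x => T x fun i => Y i x) =
        fun x => (T x).curryLeft (Y 0 x) fun i => Y i.succ x := by
      funext x
      rw [h0, MultilinearMap.curryLeft_apply]
    have h2 : (fun (x : M) (v : Tan n x) => T' x v (fun i => Y i x) +
        ∑ i, T x (Function.update (fun l => Y l x) i (D (Y i) x v))) =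
        (fun x v => ((T' x v).curryLeft (Y 0 x) + (T x).curryLeft (D (Y 0) x v))
            (fun i => Y i.succ x) +
          ∑ i, (T x).curryLeft (Y 0 x)
            (Function.update (fun l => Y l.succ x) i (D (Y i.succ) x v))) := by
      funext x v
      rw [Fin.sum_univ_succ, h0, Fin.update_cons_zero, add_apply,
        MultilinearMap.curryLeft_apply, MultilinearMap.curryLeft_apply, add_assoc]
      congr 2
      refine Finset.sum_congr rfl fun i _ => ?_
      rw [← Fin.cons_update, MultilinearMap.curryLeft_apply]
    rw [h1, h2]
  constructor
  · intro h Y hY Z hZ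
    have := (key (Fin.cons Y Z)).1 (h (Fin.cons Y Z) (Fin.cases hY hZ))
    simpa using this
  · intro h Y hY
    exact (key Y).2 (h (Y 0) (hY 0) (fun i => Y i.succ) fun i => hY i.succ)

/-- A tensor with one more slot, as a linear map. -/
theorem tenDeriv_succ_iff_linDeriv {k : ℕ} {T : Π x, Ten n (k + 1) V x}
    {T' : Π x : M, Tan n x → Ten n (k + 1) V x} :
    tenDeriv D R (k + 1) T T' ↔ linDeriv (secRel D) (tenDeriv D R k)
      (fun x => (T x).curryLeft) (fun x v => (T' x v).curryLeft) := by
  rw [tenDeriv_succ_iff]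
  constructor
  · intro h Y Y' hY
    have := h Y hY.1
    simp only [hY.2]
    exact this
  · intro h Y hY
    exact h Y _ ⟨hY, fun _ _ => rfl⟩

theorem isConnRel_tenDeriv [T2Space M] (hD : IsSmoothConn D) (hR : IsConnRel R) (k : ℕ) :
    IsConnRel (tenDeriv D R k) := by
  induction k with
  | zero =>
    constructor
    · exact tenDeriv_zero_iff.2 hR.zero
    · intro s s' t t' h h'
      exact tenDeriv_zero_iff.2 (hR.add (tenDeriv_zero_iff.1 h) (tenDeriv_zero_iff.1 h'))
    · intro f s s' hf h
      exact tenDeriv_zero_iff.2 (hR.smul hf (tenDeriv_zero_iff.1 h))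
    · intro s s' s'' h h'
      have := hR.unique (tenDeriv_zero_iff.1 h) (tenDeriv_zero_iff.1 h')
      funext x v
      ext w
      rw [Subsingleton.elim w 0]
      exact congrFun (congrFun this x) v
    · intro s s' h x
      have := hR.linear (tenDeriv_zero_iff.1 h) x
      constructor
      · intro v w
        ext u
        rw [Subsingleton.elim u 0]
        exact this.map_add v w
      · intro c v
        ext u
        rw [Subsingleton.elim u 0]
        exact this.map_smul c v
    · intro s s' X h hX
      obtain ⟨t', ht'⟩ := hR.smooth (tenDeriv_zero_iff.1 h) hX
      exact ⟨fun x v => ten0 n (t' x v), tenDeriv_zero_iff.2 ht'⟩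
  | succ k ih =>
    have hl := isConnRel_linDeriv (isFrameRel_tangent hD) ih
    constructor
    · exact tenDeriv_succ_iff_linDeriv.2 hl.zero
    · intro s s' t t' h h'
      exact tenDeriv_succ_iff_linDeriv.2
        (hl.add (tenDeriv_succ_iff_linDeriv.1 h) (tenDeriv_succ_iff_linDeriv.1 h'))
    · intro f s s' hf h
      exact tenDeriv_succ_iff_linDeriv.2 (hl.smul hf (tenDeriv_succ_iff_linDeriv.1 h))
    · intro s s' s'' h h'
      have := hl.unique (tenDeriv_succ_iff_linDeriv.1 h) (tenDeriv_succ_iff_linDeriv.1 h')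
      funext x v
      exact (multilinearCurryLeftEquiv ℝ _ _).injective (congrFun (congrFun this x) v)
    · intro s s' h x
      have := hl.linear (tenDeriv_succ_iff_linDeriv.1 h) x
      constructor
      · intro v w
        exact (multilinearCurryLeftEquiv ℝ _ _).injective (this.map_add v w)
      · intro c v
        exact (multilinearCurryLeftEquiv ℝ _ _).injective (this.map_smul c v)
    · intro s s' X h hX
      obtain ⟨t', ht'⟩ := hl.smooth (tenDeriv_succ_iff_linDeriv.1 h) hX
      refine ⟨fun x v => (t' x v).uncurryLeft, tenDeriv_succ_iff_linDeriv.2 ?_⟩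
      exact rel_congr ht' rfl (funext fun x => funext fun v => LinearMap.curry_uncurryLeft _)

/-- A tensor field with smooth values on smooth vector fields is differentiable. -/
theorem exists_tenDeriv [T2Space M] (hD : IsSmoothConn D) (hR : IsConnRel R) (k : ℕ) :
    ∀ T : Π x, Ten n k V x, (∀ Y : Fin k → Π x : M, Tan n x, (∀ i, SmoothField (Y i)) →
      ∃ s', R (fun x => T x fun i => Y i x) s') → ∃ T', tenDeriv D R k T T' := by
  induction k with
  | zero =>
    intro T hT
    obtain ⟨s', hs'⟩ := hT (fun i => i.elim0) fun i => i.elim0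
    refine ⟨fun x v => ten0 n (s' x v), tenDeriv_zero_iff.2 (rel_congr hs' ?_ rfl)⟩
    funext x; congr 1; exact Subsingleton.elim _ _
  | succ k ih =>
    intro T hT
    obtain ⟨a', ha'⟩ := exists_linDeriv (isFrameRel_tangent hD) (isConnRel_tenDeriv hD hR k)
      (fun x => (T x).curryLeft) fun Y Y' hY => ih _ fun Z hZ => by
        obtain ⟨s', hs'⟩ := hT (Fin.cons Y Z) (Fin.cases hY.1 hZ)
        refine ⟨s', rel_congr hs' ?_ rfl⟩
        funext x
        rw [MultilinearMap.curryLeft_apply]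
        congr 1
        funext i
        refine Fin.cases ?_ (fun i => ?_) i <;> simp
    refine ⟨fun x v => (a' x v).uncurryLeft, tenDeriv_succ_iff_linDeriv.2 ?_⟩
    exact rel_congr ha' rfl (funext fun x => funext fun v => LinearMap.curry_uncurryLeft _)

/-- The covariant derivative of a tensor field is differentiable in turn, which allows iteration. -/
theorem tenDeriv_apply_smooth [T2Space M] (hD : IsSmoothConn D) (hR : IsConnRel R) {k : ℕ}
    {T : Π x, Ten n k V x} {T'} (h : tenDeriv D R k T T') {X : Π x : M, Tan n x}
    (hX : SmoothField X) {Y : Fin k → Π x : M, Tan n x} (hY : ∀ i, SmoothField (Y i)) :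
    ∃ s', R (fun x => T' x (X x) fun i => Y i x) s' := by
  obtain ⟨t', ht'⟩ := (isConnRel_tenDeriv hD hR k).smooth h hX
  exact ⟨_, ht' Y hY⟩

theorem exists_iteratedDeriv [T2Space M] (hD : IsSmoothConn D) (hR : IsConnRel R) {s : Π x, V x}
    {s'} (hs : R s s') : ∃ S, IteratedDeriv D R s S := by
  have hk := fun k => isConnRel_tenDeriv hD hR k
  have step : ∀ k (T : {T : Π x, Ten n k V x // ∃ T', tenDeriv D R k T T'}),
      ∃ T₁ : {T : Π x, Ten n (k + 1) V x // ∃ T', tenDeriv D R (k + 1) T T'},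
        tenDeriv D R k T.1 (fun x v => (T₁.1 x).curryLeft v) := by
    rintro k ⟨T, T', hT⟩
    let L : Π x, Tan n x →ₗ[ℝ] Ten n k V x := fun x => ((hk k).linear hT x).mk' _
    refine ⟨⟨fun x => (L x).uncurryLeft, exists_tenDeriv hD hR (k + 1) _ fun Y hY => ?_⟩, hT⟩
    exact tenDeriv_apply_smooth hD hR hT (hY 0) (Y := fun i => Y i.succ) fun i => hY i.succ
  choose next hnext using step
  let S : ∀ k, {T : Π x, Ten n k V x // ∃ T', tenDeriv D R k T T'} := fun k =>
    Nat.rec ⟨fun x => ten0 n (s x), fun x v => ten0 n (s' x v), tenDeriv_zero_iff.2 hs⟩ next k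
  exact ⟨fun k => (S k).1, fun x => rfl, fun k => hnext k (S k)⟩

theorem IteratedDeriv.unique [T2Space M] (hD : IsSmoothConn D)
    (hR : ∀ {s s' s''}, R s s' → R s s'' → s' = s'') {s : Π x, V x} {S S'}
    (h : IteratedDeriv D R s S) (h' : IteratedDeriv D R s S') : S = S' := by
  funext k
  induction k with
  | zero => funext x; rw [h.1, h'.1]
  | succ k ih =>
    funext x
    ext w
    -- extend the vectors to smooth fields and evaluate on them
    obtain ⟨ext, hext, hx⟩ := (isFrameRel_tangent hD).exists_ext x
    choose e' he' using hext
    let Y : Fin k → Π x : M, Tan n x := fun i => ext (w i.succ)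
    have hY : ∀ i, SmoothField (Y i) := fun i => (he' (w i.succ)).1
    have h1 := h.2 k Y hY
    have h2 := h'.2 k Y hY
    rw [ih] at h1
    have := congrFun (congrFun (hR h1 h2) x) (w 0)
    have h3 := add_right_cancel this
    simp only [Y, hx, MultilinearMap.curryLeft_apply] at h3
    rwa [show (Fin.cons (w 0) fun i => w i.succ : Fin (k + 1) → Tan n x) = w from
      Fin.cons_self_tail w] at h3

/-- The first iterated derivative is the covariant derivative. -/
theorem IteratedDeriv.one_apply (hR : ∀ {s s' s''}, R s s' → R s s'' → s' = s'') {s : Π x, V x}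
    {s' S} (hS : IteratedDeriv D R s S) (hs : R s s') (x : M) (v : Tan n x) :
    S 1 x (fun _ => v) = s' x v := by
  have h1 := tenDeriv_zero_iff.1 (hS.2 0)
  have h2 := hR (rel_congr h1 (funext fun x => by rw [hS.1]; rfl) rfl) hs
  refine Eq.trans ?_ (congrFun (congrFun h2 x) v)
  rw [MultilinearMap.curryLeft_apply]
  congr 1
  funext i
  rw [Subsingleton.elim (α := Fin 1) i 0]
  rfl

/-- Parallel bundle maps commute with covariant derivatives of tensor fields. -/
theorem tenDeriv_map (Φ : Π x, V x →ₗ[ℝ] W x)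
    (h : ∀ s s', RV s s' → RW (fun x => Φ x (s x)) (fun x v => Φ x (s' x v))) {k : ℕ}
    {T : Π x, Ten n k V x} {T'} (hT : tenDeriv D RV k T T') :
    tenDeriv D RW k (fun x => (Φ x).compMultilinearMap (T x))
      (fun x v => (Φ x).compMultilinearMap (T' x v)) := by
  intro Y hY
  refine rel_congr (h _ _ (hT Y hY)) rfl ?_
  funext x v
  simp

theorem IteratedDeriv.map (Φ : Π x, V x →ₗ[ℝ] W x)
    (h : ∀ s s', RV s s' → RW (fun x => Φ x (s x)) (fun x v => Φ x (s' x v))) {s : Π x, V x} {S}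
    (hS : IteratedDeriv D RV s S) : IteratedDeriv D RW (fun x => Φ x (s x))
      (fun k x => (Φ x).compMultilinearMap (S k x)) := by
  refine ⟨fun x => ?_, fun k => tenDeriv_map Φ h (hS.2 k)⟩
  simp only [hS.1]
  rfl

/-- The Leibniz rule. -/
theorem tenDeriv_leib {β : Π x, H x →ₗ[ℝ] V x →ₗ[ℝ] W x}
    (hadd : ∀ {s s' t t'}, RW s s' → RW t t' →
      RW (fun x => s x + t x) (fun x v => s' x v + t' x v))
    (hβ : ∀ {b b' u u'}, RH b b' → RV u u' → RW (fun x => β x (b x) (u x))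
      (fun x v => β x (b' x v) (u x) + β x (b x) (u' x v))) (k : ℕ) :
    ∀ {B : ∀ j, Π x, Ten n j H x} {B' : ∀ j, Π x : M, Tan n x → Ten n j H x}
      {U : ∀ j, Π x, Ten n j V x} {U' : ∀ j, Π x : M, Tan n x → Ten n j V x},
      (∀ j ≤ k, tenDeriv D RH j (B j) (B' j)) → (∀ j ≤ k, tenDeriv D RV j (U j) (U' j)) →
      tenDeriv D RW k (fun x => leib (β x) k (fun j => B j x) (fun j => U j x))
        (fun x v => leib (β x) k (fun j => B' j x v) (fun j => U j x) +
          leib (β x) k (fun j => B j x) (fun j => U' j x v)) := by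
  induction k with
  | zero =>
    intro B B' U U' hB hU
    exact tenDeriv_zero_iff.2
      (hβ (tenDeriv_zero_iff.1 (hB 0 le_rfl)) (tenDeriv_zero_iff.1 (hU 0 le_rfl)))
  | succ k ih =>
    intro B B' U U' hB hU
    rw [tenDeriv_succ_iff]
    intro Y hY
    have h1 := ih (fun j hj => tenDeriv_succ_iff.1 (hB (j + 1) (by omega)) Y hY)
      (fun j hj => hU j (by omega))
    have h2 := ih (fun j hj => hB j (by omega))
      (fun j hj => tenDeriv_succ_iff.1 (hU (j + 1) (by omega)) Y hY)
    intro Z hZ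
    refine rel_congr (hadd (h1 Z hZ) (h2 Z hZ)) ?_ ?_
    · funext x
      simp only [leib_succ_curryLeft]
      rfl
    · funext x v
      have e1 : ∀ (w : Tan n x), (fun j => (B' (j + 1) x v).curryLeft w +
          (B (j + 1) x).curryLeft (D Y x v)) =
          shift w (fun j => B' j x v) + shift (D Y x v) (fun j => B j x) := fun w => rfl
      have e2 : ∀ (w : Tan n x), (fun j => (U' (j + 1) x v).curryLeft w +
          (U (j + 1) x).curryLeft (D Y x v)) =
          shift w (fun j => U' j x v) + shift (D Y x v) (fun j => U j x) := fun w => rfl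
      have e3 : ∀ w : Tan n x, (fun j => (B (j + 1) x).curryLeft w) = shift w (fun j => B j x) :=
        fun w => rfl
      have e4 : ∀ w : Tan n x, (fun j => (U (j + 1) x).curryLeft w) = shift w (fun j => U j x) :=
        fun w => rfl
      simp only [e1, e2, e3, e4, curryLeft_add', leib_succ_curryLeft, map_add,
        LinearMap.add_apply, add_apply, Finset.sum_add_distrib]
      abel

theorem IteratedDeriv.leib {β : Π x, H x →ₗ[ℝ] V x →ₗ[ℝ] W x}
    (hadd : ∀ {s s' t t'}, RW s s' → RW t t' →
      RW (fun x => s x + t x) (fun x v => s' x v + t' x v))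
    (hβ : ∀ {b b' u u'}, RH b b' → RV u u' → RW (fun x => β x (b x) (u x))
      (fun x v => β x (b' x v) (u x) + β x (b x) (u' x v))) {b : Π x, H x} {B} {u : Π x, V x} {U}
    (hB : IteratedDeriv D RH b B) (hU : IteratedDeriv D RV u U) :
    IteratedDeriv D RW (fun x => β x (b x) (u x))
      (fun k x => NablaSobolev.leib (β x) k (fun j => B j x) (fun j => U j x)) := by
  refine ⟨fun x => ?_, fun k => ?_⟩
  · ext v
    rw [leib_zero, hB.1, hU.1]
    rfl
  · refine rel_congr (tenDeriv_leib hadd hβ k (fun j _ => hB.2 j) (fun j _ => hU.2 j)) rfl ?_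
    funext x v
    exact leib_succ_curryLeft _ _ _ _ _

/-- Symmetrization is parallel. -/
theorem tenDeriv_symR (hadd : ∀ {s s' t t'}, RV s s' → RV t t' →
      RV (fun x => s x + t x) (fun x v => s' x v + t' x v)) (hzero : RV (fun _ => 0) fun _ _ => 0)
    (k : ℕ) : ∀ {T : Π x, Ten n k V x} {T'}, tenDeriv D RV k T T' →
      tenDeriv D RV k (fun x => symR k (T x)) (fun x v => symR k (T' x v)) := by
  induction k with
  | zero => exact fun h => h
  | succ k ih =>
    intro T T' hT Y hY
    have hsum : ∀ (u : Finset (Fin (k + 1))) {s : Fin (k + 1) → Π x, V x}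
        {s' : Fin (k + 1) → Π x : M, Tan n x → V x}, (∀ a ∈ u, RV (s a) (s' a)) →
        RV (fun x => ∑ a ∈ u, s a x) (fun x v => ∑ a ∈ u, s' a x v) := by
      intro u s s' h
      induction u using Finset.induction_on with
      | empty => simpa using hzero
      | insert a u ha ih =>
        simp only [Finset.sum_insert ha]
        exact hadd (h a (Finset.mem_insert_self a u))
          (ih fun b hb => h b (Finset.mem_insert_of_mem hb))
    refine rel_congr (hsum Finset.univ fun i _ =>
      ih (tenDeriv_succ_iff.1 hT (Y i) (hY i)) (fun l => Y (i.succAbove l))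
        fun l => hY (i.succAbove l)) ?_ ?_
    · funext x
      rw [symR_succ_apply]
    · funext x v
      simp only [symR_succ_apply, map_add, add_apply, Finset.sum_add_distrib,
        add_assoc]
      congr 1
      rw [Finset.sum_comm, ← Finset.sum_add_distrib]
      refine Finset.sum_congr rfl fun i _ => ?_
      rw [Fin.sum_univ_succAbove _ i]
      congr 1
      · simp [Fin.succAbove_ne]
      · refine Finset.sum_congr rfl fun l _ => ?_
        rw [Function.update_of_ne (Fin.succAbove_ne i l).symm]
        congr 1
        exact (Function.update_comp_eq_of_injective _ Fin.succAbove_right_injective _ _)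

/-- The connection of `T*M ⊗ ⋯ ⊗ T*M ⊗ V` does not depend on how the factors are grouped. -/
theorem tenDeriv_split (k m : ℕ) {T : Π x, Ten n (k + m) V x} {T'}
    (hT : tenDeriv D RV (k + m) T T') :
    tenDeriv D (tenDeriv D RV m) k (fun x => split k m (T x)) (fun x v => split k m (T' x v)) := by
  intro Y hY Z hZ
  have h0 : ∀ x, (fun i => (Fin.append Y Z : Fin (k + m) → Π x : M, Tan n x) i x) =
      Fin.append (fun i => Y i x) (fun i => Z i x) := by
    intro x
    funext i
    refine Fin.addCases (fun i => ?_) (fun i => ?_) i <;> simp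
  have h1 : ∀ x i (w : Tan n x), Function.update (Fin.append (fun i => Y i x) (fun i => Z i x))
      (Fin.castAdd m i) w =
      Fin.append (Function.update (fun i => Y i x) i w) (fun i => Z i x) := by
    intro x i w
    funext j
    refine Fin.addCases (fun j => ?_) (fun j => ?_) j
    · rcases eq_or_ne j i with rfl | hj
      · simp
      · simp [hj]
    · rw [Function.update_of_ne (fun h => by
        have h' : (k + j : ℕ) = i := congrArg Fin.val h
        omega)]
      simp
  have h2 : ∀ x i (w : Tan n x), Function.update (Fin.append (fun i => Y i x) (fun i => Z i x))
      (Fin.natAdd k i) w =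
      Fin.append (fun i => Y i x) (Function.update (fun i => Z i x) i w) := by
    intro x i w
    funext j
    refine Fin.addCases (fun j => ?_) (fun j => ?_) j
    · rw [Function.update_of_ne (fun h => by
        have h' : (j : ℕ) = k + i := congrArg Fin.val h
        omega)]
      simp
    · rcases eq_or_ne j i with rfl | hj
      · simp
      · simp [hj]
  refine rel_congr (hT (Fin.append Y Z) fun i => Fin.addCases (by simpa using hY)
    (by simpa using hZ) i) ?_ ?_
  · funext x
    rw [split_apply, h0]
  · funext x v
    simp only [h0, Fin.sum_univ_add, h1, h2, Fin.append_left, Fin.append_right, add_apply,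
      split_apply, sum_apply, add_assoc]

/-- The sequence of all tensors `B j` is regarded as one section of the product of the bundles; the
partial evaluations of its members are then tensor fields with values in that product. -/
theorem tenDeriv_shiftN (r : ℕ) : ∀ {B : ∀ j, Π x, Ten n j H x}
    {B' : ∀ j, Π x : M, Tan n x → Ten n j H x}, (∀ j, tenDeriv D RH j (B j) (B' j)) →
    tenDeriv D (fun (C : Π x, Fam (Tan n x) (H x)) C' =>
        ∀ j, tenDeriv D RH j (fun x => C x j) (fun x v => C' x v j)) r
      (fun x => shiftN r (fun j => B j x)) (fun x v => shiftN r (fun j => B' j x v)) := by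
  induction r with
  | zero => exact fun hB => tenDeriv_zero_iff.2 hB
  | succ r ih =>
    intro B B' hB
    rw [tenDeriv_succ_iff]
    intro Y hY
    refine rel_congr (ih fun j => tenDeriv_succ_iff.1 (hB (j + 1)) Y hY) ?_ ?_
    · funext x
      rw [shiftN_succ_curryLeft]
      rfl
    · funext x v
      rw [shiftN_succ_curryLeft, shiftN_succ_curryLeft, ← map_add]
      rfl

end TenDeriv

/-! ### Connections on a hermitian bundle -/

section Hermitian

variable {n : ℕ} {M : Type*} [TopologicalSpace M] [ChartedSpace (EuclideanSpace ℝ (Fin n)) M]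
  [IsManifold (𝓡 n) ∞ M]
  {FE : Type*} [NormedAddCommGroup FE] [NormedSpace ℂ FE]
  {E : M → Type*} [TopologicalSpace (TotalSpace FE E)] [∀ x, NormedAddCommGroup (E x)]
  [∀ x, InnerProductSpace ℂ (E x)] [FiberBundle FE E] [VectorBundle ℂ FE E] [VectorBundle ℝ FE E]

/-- A smooth complex linear connection; it need not preserve a metric. -/
structure IsComplexConn (cov : CovariantDerivative (𝓡 n) FE E) : Prop where
  smooth : ∀ (s : Π x, E x) (X : Π x : M, Tan n x), SmoothSection n FE s → SmoothField X →
    SmoothSection n FE (fun x => cov s x (X x))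
  complex_linear : ∀ (c : ℂ) (s : Π x, E x), SmoothSection n FE s → ∀ x v,
    cov (fun y => c • s y) x v = c • cov s x v

variable [ContMDiffVectorBundle ∞ FE E (𝓡 n)]

theorem addForm_apply (cov : CovariantDerivative (𝓡 n) FE E)
    (A : Π x, Ten n 1 (fun x : M => E x →ₗ[ℂ] E x) x) (s : Π x, E x) (x : M) (v : Tan n x) :
    addForm cov A s x v = cov s x v + A x (fun _ => v) (s x) := rfl

/-- The trivializations are complex linear, although smoothness refers to the real structure. -/
theorem smoothSection_const_smul (c : ℂ) {s : Π x, E x} (hs : SmoothSection n FE s) :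
    SmoothSection n FE (fun x => c • s x) := by
  intro x₀
  have h := (Bundle.contMDiffAt_section (F := FE) (IB := 𝓡 n) (n := ∞) (s := s) x₀).1 (hs x₀)
  refine (Bundle.contMDiffAt_section (F := FE) (IB := 𝓡 n) (n := ∞)
    (s := fun x => c • s x) x₀).2 ?_
  have h2 : ContMDiffAt (𝓡 n) 𝓘(ℝ, FE) ∞
      (fun x => c • (trivializationAt FE E x₀ ⟨x, s x⟩).2) x₀ :=
    (c • ContinuousLinearMap.id ℝ FE).contMDiff.contMDiffAt.comp x₀ h
  refine h2.congr_of_eventuallyEq ?_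
  filter_upwards [(trivializationAt FE E x₀).open_baseSet.mem_nhds
    (FiberBundle.mem_baseSet_trivializationAt FE E x₀)] with x hx
  exact ((trivializationAt FE E x₀).linear ℂ hx).map_smul c (s x)

theorem IsComplexConn.addForm {cov : CovariantDerivative (𝓡 n) FE E} (h : IsComplexConn cov)
    {A : Π x, Ten n 1 (fun x : M => E x →ₗ[ℂ] E x) x} (hA : SmoothOneForm FE A) :
    IsComplexConn (addForm cov A) where
  smooth := fun s X hs hX => (h.smooth s X hs hX).add_section (hA X s hX hs)
  complex_linear := fun c s hs x v => by
    rw [addForm_apply, addForm_apply, h.complex_linear c s hs, map_smul, smul_add]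

theorem bundleDeriv_const_smul {cov : CovariantDerivative (𝓡 n) FE E} (h : IsComplexConn cov)
    (c : ℂ) {s : Π x, E x} {s'} (hs : bundleDeriv cov s s') :
    bundleDeriv cov (fun x => c • s x) (fun x v => c • s' x v) :=
  ⟨smoothSection_const_smul c hs.1, fun x v => by
    simp only [h.complex_linear c s hs.1, hs.2]⟩

variable [FiniteDimensional ℂ FE] [T2Space M]

theorem IsMetricConnection.isComplexConn {cov : CovariantDerivative (𝓡 n) FE E}
    (h : IsMetricConnection cov) : IsComplexConn cov where
  smooth := fun _ _ hs hX =>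
    haveI : FiniteDimensional ℝ FE := FiniteDimensional.complexToReal FE
    smoothSec_covariantDerivative h.smooth hs hX
  complex_linear := h.complex_linear

theorem isFrameRel_bundleDeriv {cov : CovariantDerivative (𝓡 n) FE E} (h : IsComplexConn cov) :
    IsFrameRel (bundleDeriv cov) :=
  haveI : FiniteDimensional ℝ FE := FiniteDimensional.complexToReal FE
  isFrameRel_secRel (F := FE) (V := E) h.smooth

variable {cov₁ cov₂ : CovariantDerivative (𝓡 n) FE E}

theorem homDeriv_unique (h₁ : IsComplexConn cov₁) (h₂ : IsComplexConn cov₂)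
    {a : Π x, E x →ₗ[ℂ] E x} {a' a''} (h : homDeriv (bundleDeriv cov₁) (bundleDeriv cov₂) a a')
    (h' : homDeriv (bundleDeriv cov₁) (bundleDeriv cov₂) a a'') : a' = a'' := by
  funext x v
  ext e
  obtain ⟨ext, hext, hx⟩ := (isFrameRel_bundleDeriv h₁).exists_ext x
  obtain ⟨s', hs'⟩ := hext e
  have := congrFun (congrFun ((isFrameRel_bundleDeriv h₂).unique (h _ _ hs') (h' _ _ hs')) x) v
  simpa [hx] using this

/-- A fibrewise complex linear map which maps smooth sections to smooth sections is
differentiable. -/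
theorem exists_homDeriv (h₁ : IsComplexConn cov₁) (h₂ : IsComplexConn cov₂)
    (a : Π x, E x →ₗ[ℂ] E x)
    (ha : ∀ s, SmoothSection n FE s → SmoothSection n FE (fun x => a x (s x))) :
    ∃ a', homDeriv (bundleDeriv cov₁) (bundleDeriv cov₂) a a' := by
  have hV := isFrameRel_bundleDeriv h₁
  have hW := isFrameRel_bundleDeriv h₂
  obtain ⟨b, hb⟩ := exists_linDeriv hV hW.toIsConnRel (fun x => (a x).restrictScalars ℝ)
    fun s s' hs => ⟨_, ha s hs.1, fun _ _ => rfl⟩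
  refine ⟨fun x v =>
    { toFun := b x v
      map_add' := (b x v).map_add
      map_smul' := fun c e => ?_ }, fun s s' hs => hb s s' hs⟩
  obtain ⟨ext, hext, hx⟩ := hV.exists_ext x
  obtain ⟨s', hs'⟩ := hext e
  have h3 := hb _ _ (bundleDeriv_const_smul h₁ c hs')
  have h4 := bundleDeriv_const_smul h₂ c (hb _ _ hs')
  have h5 := congrFun (congrFun (hW.unique h3 (rel_congr h4 (by
    funext y; exact map_smul (a y) c _) rfl)) x) v
  simp only [hx, LinearMap.restrictScalars_apply, map_smul, smul_add] at h5
  exact add_right_cancel h5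

theorem isConnRel_homDeriv (h₁ : IsComplexConn cov₁) (h₂ : IsComplexConn cov₂) :
    IsConnRel (homDeriv (bundleDeriv cov₁) (bundleDeriv cov₂)) := by
  have hV := isFrameRel_bundleDeriv h₁
  have hW := isFrameRel_bundleDeriv h₂
  have hl := isConnRel_linDeriv hV hW.toIsConnRel
  constructor
  · exact fun s s' hs => hl.zero s s' hs
  · exact fun h h' s s' hs => hl.add (s := fun x => LinearMap.restrictScalars ℝ _)
      (s' := fun x v => LinearMap.restrictScalars ℝ _)
      (t := fun x => LinearMap.restrictScalars ℝ _)
      (t' := fun x v => LinearMap.restrictScalars ℝ _) h h' s s' hs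
  · exact fun hf h s s' hs => hl.smul (s := fun x => LinearMap.restrictScalars ℝ _)
      (s' := fun x v => LinearMap.restrictScalars ℝ _) hf h s s' hs
  · exact fun h h' => homDeriv_unique h₁ h₂ h h'
  · intro a a' h x
    have := hl.linear (s := fun x => (a x).restrictScalars ℝ)
      (s' := fun x v => (a' x v).restrictScalars ℝ) h x
    constructor
    · intro v w
      ext e
      exact LinearMap.congr_fun (this.map_add v w) e
    · intro c v
      ext e
      exact LinearMap.congr_fun (this.map_smul c v) e
  · intro a a' X h hX
    refine exists_homDeriv h₁ h₂ _ fun s hs => ?_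
    have h3 := h _ _ ⟨hs, fun _ _ => rfl⟩
    obtain ⟨t', ht'⟩ := hW.smooth h3 hX
    have h4 := (h _ _ ⟨h₁.smooth s X hs hX, fun _ _ => rfl⟩).1
    have h5 := ContMDiff.sub_section ht'.1 h4
    simpa [SmoothSection] using h5

/-- The Leibniz rule for compositions. -/
theorem homDeriv_comp {V₁ V₂ V₃ : M → Type*} [∀ x, AddCommGroup (V₁ x)] [∀ x, Module ℂ (V₁ x)]
    [∀ x, AddCommGroup (V₂ x)] [∀ x, Module ℂ (V₂ x)] [∀ x, AddCommGroup (V₃ x)]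
    [∀ x, Module ℂ (V₃ x)]
    {R₁ : (Π x, V₁ x) → (Π x : M, Tan n x → V₁ x) → Prop}
    {R₂ : (Π x, V₂ x) → (Π x : M, Tan n x → V₂ x) → Prop}
    {R₃ : (Π x, V₃ x) → (Π x : M, Tan n x → V₃ x) → Prop}
    {a : Π x, V₂ x →ₗ[ℂ] V₃ x} {a'} {b : Π x, V₁ x →ₗ[ℂ] V₂ x} {b'}
    (ha : homDeriv R₂ R₃ a a') (hb : homDeriv R₁ R₂ b b') :
    homDeriv R₁ R₃ (fun x => (a x).comp (b x))
      (fun x v => (a' x v).comp (b x) + (a x).comp (b' x v)) := by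
  intro s s' hs
  refine rel_congr (ha _ _ (hb _ _ hs)) rfl ?_
  funext x v
  simp only [LinearMap.add_apply, LinearMap.comp_apply, map_add]
  abel

theorem IsLeviCivita.isSmoothConn [RiemannianBundle (fun x : M => TangentSpace (𝓡 n) x)]
    [IsContMDiffRiemannianBundle (𝓡 n) ∞ (EuclideanSpace ℝ (Fin n))
      (fun x : M => TangentSpace (𝓡 n) x)]
    {D : CovariantDerivative (𝓡 n) (EuclideanSpace ℝ (Fin n))
      (fun x : M => TangentSpace (𝓡 n) x)} (h : IsLeviCivita D) : IsSmoothConn D :=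
  fun _ _ hX hY => smoothSec_covariantDerivative h.smooth hY hX

end Hermitian

/-! ### The iterated derivatives of the identity between two connections -/

section PointwiseTransition

variable {T H V W : Type*} [AddCommGroup T] [Module ℝ T] [AddCommGroup H] [Module ℝ H]
  [AddCommGroup V] [Module ℝ V] [AddCommGroup W] [Module ℝ W]

/-- A bilinear map `β` extended to tensors with values in the first factor. -/
def leftMap (β : H →ₗ[ℝ] V →ₗ[ℝ] W) (k : ℕ) : MultilinearMap ℝ (fun _ : Fin k => T) H →ₗ[ℝ]
    V →ₗ[ℝ] MultilinearMap ℝ (fun _ : Fin k => T) W :=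
  LinearMap.mk₂ ℝ (fun S u => (β.flip u).compMultilinearMap S)
    (by intros; ext; simp) (by intros; ext; simp) (by intros; ext; simp) (by intros; ext; simp)

@[simp] theorem leftMap_apply (β : H →ₗ[ℝ] V →ₗ[ℝ] W) (k : ℕ)
    (S : MultilinearMap ℝ (fun _ : Fin k => T) H) (u : V) (v : Fin k → T) :
    leftMap β k S u v = β (S v) u := rfl

variable {ι : Type*} [Fintype ι] (e : ι → T)

theorem tenSq_leftMap_le {β : H →ₗ[ℝ] V →ₗ[ℝ] W} {qH : H → ℝ} {qV : V → ℝ} {qW : W → ℝ}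
    (hβ : ∀ b u, qW (β b u) ≤ qH b * qV u) (k : ℕ) (S : MultilinearMap ℝ (fun _ : Fin k => T) H)
    (u : V) : tenSq e qW (leftMap β k S u) ≤ tenSq e qH S * qV u := by
  rw [tenSq, tenSq, Finset.sum_mul]
  exact Finset.sum_le_sum fun I _ => hβ _ _

/-- The bound for `∑ |C j|²`, `j ≤ m`, which results from `C (j + 1) = leib j S C`, `|C 0|² ≤ c` and
`|S j|² ≤ K`. -/
def transBound (c K : ℝ) : ℕ → ℝ
  | 0 => c
  | m + 1 => transBound c K m * (1 + 4 ^ m * ((m + 1) * K))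

theorem transBound_nonneg {c K : ℝ} (hc : 0 ≤ c) (hK : 0 ≤ K) (m : ℕ) :
    0 ≤ transBound c K m := by
  induction m with
  | zero => exact hc
  | succ m ih => exact mul_nonneg ih (by positivity)

variable {β : H →ₗ[ℝ] V →ₗ[ℝ] V} {qH : H → ℝ} {q : V → ℝ}

/-- The recursion `C (m + 1) = leib m S C` bounds `C` in terms of `S`. -/
theorem sum_tenSq_le_transBound (hH : ∀ b, 0 ≤ qH b) (hq : ∀ u, 0 ≤ q u)
    (hadd : ∀ v w, q (v + w) ≤ 2 * (q v + q w)) (hβ : ∀ b u, q (β b u) ≤ qH b * q u)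
    {S : Fam T (MultilinearMap ℝ (fun _ : Fin 1 => T) H)} {C : Fam T V}
    (hC : ∀ m, split m 1 (C (m + 1)) = leib (leftMap β 1) m S C) {c K : ℝ} (hK : 0 ≤ K)
    (h0 : tenSq e q (C 0) ≤ c) (l : ℕ) (hS : ∀ j < l, tenSq e (tenSq e qH) (S j) ≤ K) :
    ∑ j ∈ Finset.range (l + 1), tenSq e q (C j) ≤ transBound c K l := by
  induction l with
  | zero => simpa [transBound] using h0
  | succ l ih =>
    have ih := ih fun j hj => hS j (by omega)
    have hc0 : 0 ≤ ∑ j ∈ Finset.range (l + 1), tenSq e q (C j) := sum_tenSq_nonneg e hq C _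
    rw [Finset.sum_range_succ, transBound]
    have h1 : tenSq e q (C (l + 1)) ≤ 4 ^ l *
        (∑ j ∈ Finset.range (l + 1), tenSq e (tenSq e qH) (S j)) *
        ∑ j ∈ Finset.range (l + 1), tenSq e q (C j) := by
      rw [← tenSq_split e l 1 (C (l + 1)), hC]
      exact tenSq_leib_le e (tenSq_nonneg e hH) hq (tenSq_add_le e hadd)
        (fun b u => tenSq_leftMap_le e hβ 1 b u) l S C
    have h2 : ∑ j ∈ Finset.range (l + 1), tenSq e (tenSq e qH) (S j) ≤ (l + 1) * K := by
      refine (Finset.sum_le_sum fun j hj => hS j (Finset.mem_range.1 hj)).trans ?_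
      simp
    calc _ ≤ (∑ j ∈ Finset.range (l + 1), tenSq e q (C j)) +
          4 ^ l * ((l + 1) * K) * ∑ j ∈ Finset.range (l + 1), tenSq e q (C j) := by
          gcongr
          exact h1.trans (by gcongr)
      _ = (∑ j ∈ Finset.range (l + 1), tenSq e q (C j)) * (1 + 4 ^ l * ((l + 1) * K)) := by ring
      _ ≤ _ := by gcongr

/-- Conversely, `S` is bounded in terms of `C`: `C (m + 1) = leib m S C`, in which the only term
with `S m` is `β (S m) (C 0)`. -/
theorem tenSq_le_of_split_eq_leib (hH : ∀ b, 0 ≤ qH b) (hq : ∀ u, 0 ≤ q u)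
    (hadd : ∀ v w, q (v + w) ≤ 2 * (q v + q w)) (hneg : ∀ v, q (-v) = q v) (hH0 : qH 0 = 0)
    (hβ : ∀ b u, q (β b u) ≤ qH b * q u)
    {S : Fam T (MultilinearMap ℝ (fun _ : Fin 1 => T) H)} {C : Fam T V}
    (hC : ∀ m, split m 1 (C (m + 1)) = leib (leftMap β 1) m S C)
    (h0 : ∀ b, q (β b (C 0 0)) = qH b) (m : ℕ) :
    tenSq e (tenSq e qH) (S m) ≤ 2 * (tenSq e q (C (m + 1)) + 4 ^ m *
      (∑ j ∈ Finset.range m, tenSq e (tenSq e qH) (S j)) *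
        ∑ j ∈ Finset.range (m + 1), tenSq e q (C j)) := by
  have h1 := hC m
  rw [leib_eq_top_add] at h1
  have h2 : tenSq e (tenSq e qH) (S m) = tenSq e (tenSq e q)
      (((leftMap β 1).flip (C 0 0)).compMultilinearMap (S m)) := by
    simp only [tenSq, LinearMap.compMultilinearMap_apply, LinearMap.flip_apply, leftMap_apply, h0]
  rw [h2, ← sub_eq_of_eq_add h1, sub_eq_add_neg]
  refine (tenSq_add_le e (tenSq_add_le e hadd) _ _).trans ?_
  rw [tenSq_split e m 1 (C (m + 1))]
  gcongr
  rw [show ∀ R : MultilinearMap ℝ (fun _ : Fin m => T) (MultilinearMap ℝ (fun _ : Fin 1 => T) V),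
    tenSq e (tenSq e q) (-R) = tenSq e (tenSq e q) R from fun R => by simp [tenSq, hneg]]
  refine (tenSq_leib_le e (tenSq_nonneg e hH) hq (tenSq_add_le e hadd)
        (fun b u => tenSq_leftMap_le e hβ 1 b u) m _ C).trans ?_
  have hc0 : 0 ≤ ∑ j ∈ Finset.range (m + 1), tenSq e q (C j) := sum_tenSq_nonneg e hq C _
  gcongr
  rw [Finset.sum_range_succ, Function.update_self, show tenSq e (tenSq e qH)
      (0 : MultilinearMap ℝ (fun _ : Fin m => T) (MultilinearMap ℝ (fun _ : Fin 1 => T) H)) = 0 by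
    simp [tenSq, hH0], add_zero]
  refine Finset.sum_le_sum fun j hj => ?_
  rw [Function.update_of_ne (Finset.mem_range.1 hj).ne]

end PointwiseTransition

section Transition

variable {n : ℕ} {M : Type*} [TopologicalSpace M] [ChartedSpace (EuclideanSpace ℝ (Fin n)) M]
  [IsManifold (𝓡 n) ∞ M] [T2Space M]
  {D : CovariantDerivative (𝓡 n) (EuclideanSpace ℝ (Fin n)) (fun x : M => TangentSpace (𝓡 n) x)}

section General

variable {H V W : M → Type*} [∀ x, AddCommGroup (H x)] [∀ x, Module ℝ (H x)]
  [∀ x, AddCommGroup (V x)] [∀ x, Module ℝ (V x)] [∀ x, AddCommGroup (W x)] [∀ x, Module ℝ (W x)]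
  {RH : (Π x, H x) → (Π x : M, Tan n x → H x) → Prop}
  {RV : (Π x, V x) → (Π x : M, Tan n x → V x) → Prop}
  {RW : (Π x, W x) → (Π x : M, Tan n x → W x) → Prop}

/-- The iterated derivatives of the covariant derivative of a section. -/
theorem IteratedDeriv.split_one {s : Π x, V x} {S} (h : IteratedDeriv D RV s S) :
    IteratedDeriv D (tenDeriv D RV 1) (S 1) (fun m x => split m 1 (S (m + 1) x)) := by
  refine ⟨fun x => ?_, fun m => ?_⟩
  · ext v w
    rw [split_apply]
    refine congrArg (S 1 x) (funext fun i => ?_)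
    obtain rfl : i = Fin.natAdd 0 (0 : Fin 1) := Fin.ext (by simp)
    rw [Fin.append_right]
    rfl
  · refine rel_congr (tenDeriv_split m 1 (h.2 (m + 1))) rfl ?_
    funext x v
    ext u w
    rw [split_apply, MultilinearMap.curryLeft_apply, MultilinearMap.curryLeft_apply, split_apply,
      Fin.append_cons]
    rfl

theorem tenDeriv_leftMap {β : Π x, H x →ₗ[ℝ] V x →ₗ[ℝ] W x}
    (hβ : ∀ {b b' u u'}, RH b b' → RV u u' → RW (fun x => β x (b x) (u x))
      (fun x v => β x (b' x v) (u x) + β x (b x) (u' x v))) {k : ℕ}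
    {B : Π x, Ten n k H x} {B'} {u : Π x, V x} {u'} (hB : tenDeriv D RH k B B') (hu : RV u u') :
    tenDeriv D RW k (fun x => leftMap (β x) k (B x) (u x))
      (fun x v => leftMap (β x) k (B' x v) (u x) + leftMap (β x) k (B x) (u' x v)) := by
  intro Y hY
  refine rel_congr (hβ (hB Y hY) hu) rfl ?_
  funext x v
  simp only [leftMap_apply, map_add, map_sum, LinearMap.add_apply, LinearMap.sum_apply, add_apply]
  abel

end General

variable {FE : Type*} [NormedAddCommGroup FE] [NormedSpace ℂ FE]
  {E : M → Type*} [TopologicalSpace (TotalSpace FE E)] [∀ x, NormedAddCommGroup (E x)]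
  [∀ x, InnerProductSpace ℂ (E x)] [FiberBundle FE E] [VectorBundle ℂ FE E] [VectorBundle ℝ FE E]
  [ContMDiffVectorBundle ∞ FE E (𝓡 n)] [FiniteDimensional ℂ FE]
  {cov cov₁ cov₂ : CovariantDerivative (𝓡 n) FE E}
  {A : Π x, Ten n 1 (fun x : M => E x →ₗ[ℂ] E x) x}

/-- Smooth forms have covariant derivatives of all orders. -/
theorem exists_iteratedDeriv_form (hD : IsSmoothConn D) (h : IsComplexConn cov)
    (hA : SmoothOneForm FE A) :
    ∃ S, IteratedDeriv D (tenDeriv D (homDeriv (bundleDeriv cov) (bundleDeriv cov)) 1) A S := by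
  have hR := isConnRel_homDeriv h h
  obtain ⟨A', hA'⟩ := exists_tenDeriv hD hR 1 A fun Y hY => exists_homDeriv h h _ fun s hs => by
    have := hA (Y 0) s (hY 0) hs
    have h2 : ∀ x, (fun i => Y i x) = fun _ => Y 0 x := fun x => funext fun i => by
      rw [Subsingleton.elim i 0]
    simpa only [h2] using this
  exact exists_iteratedDeriv hD (isConnRel_tenDeriv hD hR 1) hA'

/-- If the derivative of the identity, as a section of `Hom(E₂, E₁)`, is `β A id`, then its iterated
derivatives `C` satisfy a recursion whose coefficients are the iterated derivatives `S` of `A`.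
Here `β A b` is (up to a sign) the composition of `A` with `b`, in either order. -/
theorem exists_transition (hD : IsSmoothConn D) (h₁ : IsComplexConn cov₁)
    (h₂ : IsComplexConn cov₂)
    {β : Π x, (E x →ₗ[ℂ] E x) →ₗ[ℝ] (E x →ₗ[ℂ] E x) →ₗ[ℝ] (E x →ₗ[ℂ] E x)}
    (hβ : ∀ {a a' b b'}, homDeriv (bundleDeriv cov) (bundleDeriv cov) a a' →
      homDeriv (bundleDeriv cov₂) (bundleDeriv cov₁) b b' →
      homDeriv (bundleDeriv cov₂) (bundleDeriv cov₁) (fun x => β x (a x) (b x))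
        (fun x v => β x (a' x v) (b x) + β x (a x) (b' x v)))
    (hid : homDeriv (bundleDeriv cov₂) (bundleDeriv cov₁) (fun _ => LinearMap.id)
      (fun x v => β x (A x fun _ => v) LinearMap.id)) {S}
    (hS : IteratedDeriv D (tenDeriv D (homDeriv (bundleDeriv cov) (bundleDeriv cov)) 1) A S) :
    ∃ C, IteratedDeriv D (homDeriv (bundleDeriv cov₂) (bundleDeriv cov₁))
        (fun _ => LinearMap.id) C ∧
      ∀ x m, split m 1 (C (m + 1) x) =
        leib (leftMap (β x) 1) m (fun j => S j x) (fun j => C j x) := by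
  have hR := isConnRel_homDeriv h₂ h₁
  obtain ⟨C, hC⟩ := exists_iteratedDeriv hD hR hid
  refine ⟨C, hC, ?_⟩
  have h1 : C 1 = fun x => leftMap (β x) 1 (A x) LinearMap.id := by
    funext x
    ext v : 1
    have hv : (fun _ => v 0) = v := funext fun i => by rw [Subsingleton.elim (α := Fin 1) i 0]
    rw [← hv]
    exact hC.one_apply (R := homDeriv (bundleDeriv cov₂) (bundleDeriv cov₁)) hR.unique hid x (v 0)
  have h2 := hC.split_one
  rw [h1] at h2
  have h3 := IteratedDeriv.leib (isConnRel_tenDeriv hD hR 1).add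
    (tenDeriv_leftMap (D := D) (k := 1) hβ) hS hC
  have h4 := IteratedDeriv.unique
    (R := tenDeriv D (homDeriv (bundleDeriv cov₂) (bundleDeriv cov₁)) 1) hD
    (isConnRel_tenDeriv hD hR 1).unique h2 h3
  intro x m
  exact congrFun (congrFun h4 m) x

end Transition

/-! ### Norms of endomorphisms -/

section EndNorms

variable {V W : Type*} [NormedAddCommGroup V] [InnerProductSpace ℂ V] [FiniteDimensional ℂ V]
  [AddCommGroup W] [Module ℂ W]

/-- A linear map is bounded by its Hilbert-Schmidt norm, for a family `b` and a linear combination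
of it with coefficients `c`. -/
theorem sq_map_sum_le {ι V : Type*} [Fintype ι] [AddCommGroup V] [Module ℂ V] {N : W → ℝ}
    (hadd : ∀ v w, N (v + w) ≤ N v + N w) (hsmul : ∀ (c : ℂ) v, N (c • v) = ‖c‖ * N v)
    (hN : ∀ v, 0 ≤ N v) (a : V →ₗ[ℂ] W) (b : ι → V) (c : ι → ℂ) :
    N (a (∑ i, c i • b i)) ^ 2 ≤ (∑ i, N (a (b i)) ^ 2) * ∑ i, ‖c i‖ ^ 2 := by
  have h0 : N 0 = 0 := by simpa using hsmul 0 0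
  have h1 : N (a (∑ i, c i • b i)) ≤ ∑ i, N (a (b i)) * ‖c i‖ := by
    rw [map_sum]
    refine (Finset.le_sum_of_subadditive N h0.le hadd _ _).trans_eq ?_
    exact Finset.sum_congr rfl fun i _ => by rw [map_smul, hsmul, mul_comm]
  calc _ ≤ (∑ i, N (a (b i)) * ‖c i‖) ^ 2 := by
        have := hN (a (∑ i, c i • b i))
        gcongr
    _ ≤ _ := Finset.sum_mul_sq_le_sq_mul_sq _ _ _

/-- The square of the operator norm of an endomorphism. -/
def opSq (a : V →ₗ[ℂ] V) : ℝ := ‖LinearMap.toContinuousLinearMap a‖ ^ 2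

theorem opSq_nonneg (a : V →ₗ[ℂ] V) : 0 ≤ opSq a := sq_nonneg _

theorem norm_sq_apply_le_opSq (a : V →ₗ[ℂ] V) (v : V) : ‖a v‖ ^ 2 ≤ opSq a * ‖v‖ ^ 2 := by
  rw [opSq, ← mul_pow]
  exact pow_le_pow_left₀ (norm_nonneg _) ((LinearMap.toContinuousLinearMap a).le_opNorm v) 2

theorem opSq_le {a : V →ₗ[ℂ] V} {c : ℝ} (hc : 0 ≤ c) (h : ∀ v, ‖a v‖ ^ 2 ≤ c * ‖v‖ ^ 2) :
    opSq a ≤ c := by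
  have h1 : ‖LinearMap.toContinuousLinearMap a‖ ≤ √c := by
    refine ContinuousLinearMap.opNorm_le_bound _ (Real.sqrt_nonneg c) fun v => ?_
    rw [← Real.sqrt_sq (norm_nonneg v), ← Real.sqrt_mul hc]
    exact Real.le_sqrt_of_sq_le (h v)
  rw [opSq]
  exact (pow_le_pow_left₀ (norm_nonneg _) h1 2).trans_eq (Real.sq_sqrt hc)

theorem opSq_add_le (a b : V →ₗ[ℂ] V) : opSq (a + b) ≤ 2 * (opSq a + opSq b) := by
  rw [opSq, map_add]
  exact (pow_le_pow_left₀ (norm_nonneg _) (norm_add_le _ _) 2).trans (add_sq_le)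

theorem opSq_neg (a : V →ₗ[ℂ] V) : opSq (-a) = opSq a := by
  rw [opSq, map_neg, norm_neg, opSq]

theorem opSq_comp_le (a b : V →ₗ[ℂ] V) : opSq (a ∘ₗ b) ≤ opSq a * opSq b := by
  refine opSq_le (mul_nonneg (opSq_nonneg a) (opSq_nonneg b)) fun v => ?_
  refine (norm_sq_apply_le_opSq a (b v)).trans ?_
  rw [mul_assoc]
  exact mul_le_mul_of_nonneg_left (norm_sq_apply_le_opSq b v) (opSq_nonneg a)

theorem opSq_id_le : opSq (LinearMap.id : V →ₗ[ℂ] V) ≤ 1 :=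
  opSq_le zero_le_one fun v => by simp

/-- The adjoint has the same operator norm: `|w|² = ⟨a w, v⟩` for `w = a* v`. -/
theorem norm_sq_adjoint_apply_le (a : V →ₗ[ℂ] V) (v : V) :
    ‖LinearMap.adjoint a v‖ ^ 2 ≤ opSq a * ‖v‖ ^ 2 := by
  set w := LinearMap.adjoint a v with hw
  have h1 : ‖w‖ ^ 2 ≤ ‖a w‖ * ‖v‖ := by
    rw [← inner_self_eq_norm_sq (𝕜 := ℂ) w]
    conv_lhs => rw [hw, LinearMap.adjoint_inner_right, ← hw]
    exact (RCLike.re_le_norm _).trans (norm_inner_le_norm _ _)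
  have h2 := norm_sq_apply_le_opSq a w
  rcases (norm_nonneg w).eq_or_lt with h0 | h0
  · rw [← h0]
    have := mul_nonneg (opSq_nonneg a) (sq_nonneg ‖v‖)
    simpa using this
  · have h3 : ‖w‖ ^ 2 * ‖w‖ ^ 2 ≤ ‖w‖ ^ 2 * (opSq a * ‖v‖ ^ 2) := by
      calc ‖w‖ ^ 2 * ‖w‖ ^ 2 ≤ (‖a w‖ * ‖v‖) * (‖a w‖ * ‖v‖) := by gcongr
        _ = ‖a w‖ ^ 2 * ‖v‖ ^ 2 := by ring
        _ ≤ opSq a * ‖w‖ ^ 2 * ‖v‖ ^ 2 := by gcongr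
        _ = _ := by ring
    exact le_of_mul_le_mul_left h3 (by positivity)

/-- The square of the Hilbert-Schmidt norm of an endomorphism. -/
def hsSq (a : V →ₗ[ℂ] V) : ℝ := ∑ i, ‖a (stdOrthonormalBasis ℂ V i)‖ ^ 2

theorem hsSq_nonneg (a : V →ₗ[ℂ] V) : 0 ≤ hsSq a := Finset.sum_nonneg fun _ _ => sq_nonneg _

theorem norm_sq_apply_le_hsSq (a : V →ₗ[ℂ] V) (v : V) : ‖a v‖ ^ 2 ≤ hsSq a * ‖v‖ ^ 2 := by
  have h := sq_map_sum_le (N := fun w : V => ‖w‖) norm_add_le norm_smul norm_nonneg a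
    (stdOrthonormalBasis ℂ V) (fun i => inner ℂ (stdOrthonormalBasis ℂ V i) v)
  rw [(stdOrthonormalBasis ℂ V).sum_repr', (stdOrthonormalBasis ℂ V).sum_sq_norm_inner_right] at h
  exact h

theorem opSq_le_hsSq (a : V →ₗ[ℂ] V) : opSq a ≤ hsSq a :=
  opSq_le (hsSq_nonneg a) (norm_sq_apply_le_hsSq a)

theorem norm_add_sq_le {V : Type*} [SeminormedAddCommGroup V] (v w : V) :
    ‖v + w‖ ^ 2 ≤ 2 * (‖v‖ ^ 2 + ‖w‖ ^ 2) :=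
  (pow_le_pow_left₀ (norm_nonneg _) (norm_add_le v w) 2).trans add_sq_le

theorem hsSq_add_le (a b : V →ₗ[ℂ] V) : hsSq (a + b) ≤ 2 * (hsSq a + hsSq b) := by
  rw [hsSq, hsSq, hsSq, ← Finset.sum_add_distrib, Finset.mul_sum]
  exact Finset.sum_le_sum fun i _ => norm_add_sq_le _ _

theorem hsSq_neg (a : V →ₗ[ℂ] V) : hsSq (-a) = hsSq a := by simp [hsSq]

theorem hsSq_comp_le (a b : V →ₗ[ℂ] V) : hsSq (a ∘ₗ b) ≤ hsSq a * hsSq b := by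
  rw [hsSq, hsSq.eq_1 b, Finset.mul_sum]
  exact Finset.sum_le_sum fun i _ => norm_sq_apply_le_hsSq a _

/-- The pairing `(c, u) ↦ c* u`. -/
def adjPairing (V : Type*) [NormedAddCommGroup V] [InnerProductSpace ℂ V]
    [FiniteDimensional ℂ V] : (V →ₗ[ℂ] V) →ₗ[ℝ] V →ₗ[ℝ] V :=
  LinearMap.mk₂ ℝ (fun c u => LinearMap.adjoint c u)
    (by intros; simp) (by
      intro r c u
      have : (r • c) = (r : ℂ) • c := by ext; simp
      rw [this, map_smulₛₗ]
      simp) (by intros; simp) (by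
      intro r c u
      have h : ∀ w : V, r • w = (r : ℂ) • w := fun w => by simp
      rw [h, h, map_smul])

@[simp] theorem adjPairing_apply (c : V →ₗ[ℂ] V) (u : V) :
    adjPairing V c u = LinearMap.adjoint c u := rfl

/-- The product `(a, b) ↦ a b` of endomorphisms. -/
def endComp (V : Type*) [NormedAddCommGroup V] [InnerProductSpace ℂ V] :
    (V →ₗ[ℂ] V) →ₗ[ℝ] (V →ₗ[ℂ] V) →ₗ[ℝ] (V →ₗ[ℂ] V) :=
  LinearMap.mk₂ ℝ (fun a b => a ∘ₗ b)
    (by intros; ext; simp) (by intros; ext; simp) (by intros; ext; simp) (by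
      intro r a b
      ext v
      have h : ∀ w : V, r • w = (r : ℂ) • w := fun w => by simp
      simp only [LinearMap.comp_apply, LinearMap.smul_apply, h, map_smul])

@[simp] theorem endComp_apply {V : Type*} [NormedAddCommGroup V] [InnerProductSpace ℂ V]
    (a b : V →ₗ[ℂ] V) : endComp V a b = a ∘ₗ b := rfl

end EndNorms

section TenNorms

variable {n : ℕ} {M : Type*} [TopologicalSpace M] [ChartedSpace (EuclideanSpace ℝ (Fin n)) M]
  [RiemannianBundle (fun x : M => TangentSpace (𝓡 n) x)]
  {E : M → Type*} [∀ x, NormedAddCommGroup (E x)] [∀ x, InnerProductSpace ℂ (E x)]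
  [∀ x, FiniteDimensional ℂ (E x)]

theorem tenNorm_nonneg {V : M → Type*} [∀ x, AddCommGroup (V x)] [∀ x, Module ℝ (V x)]
    (N : ∀ x, V x → ℝ) {k : ℕ} (x : M) (T : Ten n k V x) : 0 ≤ tenNorm N x T := Real.sqrt_nonneg _

theorem tenNorm_sq {V : M → Type*} [∀ x, AddCommGroup (V x)] [∀ x, Module ℝ (V x)]
    (N : ∀ x, V x → ℝ) {k : ℕ} (x : M) (T : Ten n k V x) :
    tenNorm N x T ^ 2 = tenSq (tanBasis n x) (fun v => N x v ^ 2) T :=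
  Real.sq_sqrt (Finset.sum_nonneg fun _ _ => sq_nonneg _)

theorem endNorm_sq (x : M) (a : E x →ₗ[ℂ] E x) : endNorm x a ^ 2 = hsSq a :=
  Real.sq_sqrt (Finset.sum_nonneg fun _ _ => sq_nonneg _)

theorem tenNorm_tenNorm_endNorm_sq {k : ℕ} (x : M)
    (S : Ten n k (fun x => Ten n 1 (fun x : M => E x →ₗ[ℂ] E x) x) x) :
    tenNorm (tenNorm endNorm) x S ^ 2 =
      tenSq (tanBasis n x) (tenSq (tanBasis n x) hsSq) S := by
  rw [tenNorm_sq]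
  congr 1
  funext R
  rw [tenNorm_sq]
  congr 1
  funext a
  exact endNorm_sq x a

theorem tenNorm_bundleNorm_sq {k : ℕ} (x : M) (S : Ten n k E x) :
    tenNorm bundleNorm x S ^ 2 = tenSq (tanBasis n x) (fun v => ‖v‖ ^ 2) S := tenNorm_sq _ _ _

/-- The estimate for the covariant derivatives `∇̃ᵏ u = leib k C* U`. -/
theorem tenSq_leib_adjPairing_le {x : M} (k l : ℕ) (hk : k ≤ l)
    (C : Fam (Tan n x) (E x →ₗ[ℂ] E x)) (U : Fam (Tan n x) (E x)) {c : ℝ} (hc : 0 ≤ c)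
    (hC : ∑ j ∈ Finset.range (l + 1), tenSq (tanBasis n x) opSq (C j) ≤ c) :
    tenNorm bundleNorm x (leib (adjPairing (E x)) k C U : Ten n k E x) ^ 2 ≤
      4 ^ l * c * ∑ j ∈ Finset.range (l + 1), tenNorm bundleNorm x (U j : Ten n j E x) ^ 2 := by
  simp only [tenNorm_bundleNorm_sq]
  have hV : ∀ v : E x, (0 : ℝ) ≤ ‖v‖ ^ 2 := fun v => sq_nonneg _
  refine (tenSq_leib_le (tanBasis n x) opSq_nonneg hV norm_add_sq_le
    norm_sq_adjoint_apply_le k C U).trans ?_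
  have h1 := sum_tenSq_range_mono (tanBasis n x) opSq_nonneg (show k + 1 ≤ l + 1 by omega) C
  have h2 := sum_tenSq_range_mono (tanBasis n x) hV (show k + 1 ≤ l + 1 by omega) U
  have h3 := sum_tenSq_nonneg (tanBasis n x) hV U (k + 1)
  have h4 := sum_tenSq_nonneg (tanBasis n x) opSq_nonneg C (k + 1)
  have h5 : (4 : ℝ) ^ k ≤ 4 ^ l := pow_le_pow_right₀ (by norm_num) hk
  gcongr
  exact h1.trans hC

end TenNorms

section TransitionBound

variable {n : ℕ} {M : Type*} [TopologicalSpace M] [ChartedSpace (EuclideanSpace ℝ (Fin n)) M]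
  [IsManifold (𝓡 n) ∞ M] [T2Space M]
  {D : CovariantDerivative (𝓡 n) (EuclideanSpace ℝ (Fin n)) (fun x : M => TangentSpace (𝓡 n) x)}
  {FE : Type*} [NormedAddCommGroup FE] [NormedSpace ℂ FE]
  {E : M → Type*} [TopologicalSpace (TotalSpace FE E)] [∀ x, NormedAddCommGroup (E x)]
  [∀ x, InnerProductSpace ℂ (E x)] [FiberBundle FE E] [VectorBundle ℂ FE E] [VectorBundle ℝ FE E]
  [ContMDiffVectorBundle ∞ FE E (𝓡 n)] [FiniteDimensional ℂ FE]
  {cov : CovariantDerivative (𝓡 n) FE E}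
  {A : Π x, Ten n 1 (fun x : M => E x →ₗ[ℂ] E x) x} {S : ∀ k, Π x, Ten n k (fun x =>
    Ten n 1 (fun x : M => E x →ₗ[ℂ] E x) x) x}

/-- The transition from `∇ + A` to `∇`. -/
theorem exists_transition_left (hD : IsSmoothConn D) (h : IsComplexConn cov)
    (hA : SmoothOneForm FE A)
    (hS : IteratedDeriv D (tenDeriv D (homDeriv (bundleDeriv cov) (bundleDeriv cov)) 1) A S) :
    ∃ C, IteratedDeriv D (homDeriv (bundleDeriv (addForm cov A)) (bundleDeriv cov))
        (fun _ => LinearMap.id) C ∧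
      ∀ x m, split m 1 (C (m + 1) x) =
        leib (leftMap (-endComp (E x)) 1) m (fun j => S j x) (fun j => C j x) := by
  refine exists_transition hD h (h.addForm hA) (cov := cov) (β := fun x => -endComp (E x))
    (fun {a a' b b'} ha hb => ?_) ?_ hS
  · refine rel_congr ((isConnRel_homDeriv (h.addForm hA) h).neg (homDeriv_comp ha hb)) rfl ?_
    funext x v
    simp only [LinearMap.neg_apply, endComp_apply, neg_add]
  · intro s s' hs
    refine ⟨hs.1, fun x v => ?_⟩
    simp only [hs.2, addForm_apply, LinearMap.neg_apply, endComp_apply, LinearMap.comp_id,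
      LinearMap.id_apply]
    abel

/-- The transition from `∇` to `∇ + A`. -/
theorem exists_transition_right (hD : IsSmoothConn D) (h : IsComplexConn cov)
    (hA : SmoothOneForm FE A)
    (hS : IteratedDeriv D (tenDeriv D (homDeriv (bundleDeriv cov) (bundleDeriv cov)) 1) A S) :
    ∃ C, IteratedDeriv D (homDeriv (bundleDeriv cov) (bundleDeriv (addForm cov A)))
        (fun _ => LinearMap.id) C ∧
      ∀ x m, split m 1 (C (m + 1) x) =
        leib (leftMap (endComp (E x)).flip 1) m (fun j => S j x) (fun j => C j x) := by
  refine exists_transition hD (h.addForm hA) h (cov := cov) (β := fun x => (endComp (E x)).flip)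
    (fun {a a' b b'} ha hb => ?_) ?_ hS
  · refine rel_congr (homDeriv_comp hb ha) rfl ?_
    funext x v
    simp only [LinearMap.flip_apply, endComp_apply]
    abel
  · intro s s' hs
    refine ⟨hs.1, fun x v => ?_⟩
    simp only [hs.2, addForm_apply, LinearMap.flip_apply, endComp_apply, LinearMap.id_comp,
      LinearMap.id_apply]
    abel

variable [RiemannianBundle (fun x : M => TangentSpace (𝓡 n) x)] [∀ x, FiniteDimensional ℂ (E x)]

theorem sum_opSq_le_transBound {x : M}
    {β : (E x →ₗ[ℂ] E x) →ₗ[ℝ] (E x →ₗ[ℂ] E x) →ₗ[ℝ] (E x →ₗ[ℂ] E x)}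
    (hβ : ∀ a b, opSq (β a b) ≤ opSq a * opSq b) {C : Fam (Tan n x) (E x →ₗ[ℂ] E x)}
    (hC0 : C 0 0 = LinearMap.id)
    (hC : ∀ m, split m 1 (C (m + 1)) = leib (leftMap β 1) m (fun j => S j x) C) {K : ℝ} (l : ℕ)
    (hS : ∀ j < l, tenNorm (tenNorm endNorm) x (S j x) ≤ K) :
    ∑ j ∈ Finset.range (l + 1), tenSq (tanBasis n x) opSq (C j) ≤ transBound 1 (K ^ 2) l := by
  refine sum_tenSq_le_transBound (tanBasis n x) hsSq_nonneg opSq_nonneg opSq_add_le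
    (fun a b => (hβ a b).trans ?_) hC (sq_nonneg K) ?_ l fun j hj => ?_
  · exact mul_le_mul_of_nonneg_right (opSq_le_hsSq a) (opSq_nonneg b)
  · rw [tenSq_zero, hC0]
    exact opSq_id_le
  · rw [← tenNorm_tenNorm_endNorm_sq]
    exact pow_le_pow_left₀ (tenNorm_nonneg _ _ _) (hS j hj) 2

/-- The transitions between `∇` and `∇ + A`, in both directions, with their bounds. -/
theorem exists_transition_bound (hD : IsSmoothConn D) (h : IsComplexConn cov)
    (hA : SmoothOneForm FE A)
    (hS : IteratedDeriv D (tenDeriv D (homDeriv (bundleDeriv cov) (bundleDeriv cov)) 1) A S)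
    {cov₁ cov₂ : CovariantDerivative (𝓡 n) FE E}
    (hc : cov₁ = cov ∧ cov₂ = addForm cov A ∨ cov₁ = addForm cov A ∧ cov₂ = cov) :
    ∃ C, IteratedDeriv D (homDeriv (bundleDeriv cov₂) (bundleDeriv cov₁))
        (fun _ => LinearMap.id) C ∧
      ∀ x l K, (∀ j < l, tenNorm (tenNorm endNorm) x (S j x) ≤ K) →
        ∑ j ∈ Finset.range (l + 1), tenSq (tanBasis n x) opSq (C j x) ≤
          transBound 1 (K ^ 2) l := by
  rcases hc with ⟨rfl, rfl⟩ | ⟨rfl, rfl⟩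
  · obtain ⟨C, hC, hr⟩ := exists_transition_left hD h hA hS
    refine ⟨C, hC, fun x l K hK => sum_opSq_le_transBound (C := fun j => C j x)
      (fun a b => ?_) (by rw [hC.1 x]; rfl) (hr x) l hK⟩
    simp only [LinearMap.neg_apply, endComp_apply, opSq_neg]
    exact opSq_comp_le a b
  · obtain ⟨C, hC, hr⟩ := exists_transition_right hD h hA hS
    refine ⟨C, hC, fun x l K hK => sum_opSq_le_transBound (C := fun j => C j x)
      (fun a b => ?_) (by rw [hC.1 x]; rfl) (hr x) l hK⟩
    simp only [LinearMap.flip_apply, endComp_apply]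
    rw [mul_comm]
    exact opSq_comp_le b a

end TransitionBound

/-! ### Weak derivatives -/

section Weak

variable {n : ℕ} {M : Type*} [TopologicalSpace M] [ChartedSpace (EuclideanSpace ℝ (Fin n)) M]
  [IsManifold (𝓡 n) ∞ M] [T2Space M]
  {D : CovariantDerivative (𝓡 n) (EuclideanSpace ℝ (Fin n)) (fun x : M => TangentSpace (𝓡 n) x)}

/-- In a local frame, the divergence is the sum of the diagonal components of `∇X`. -/
theorem smoothFun_divergence (hD : IsSmoothConn D) {X : Π x : M, Tan n x} (hX : SmoothField X) :
    SmoothFun n (divergence D X) := by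
  intro x₀
  obtain ⟨U, Z, θ, hxU, hZ⟩ := exists_cutFrame (n := n) (F := EuclideanSpace ℝ (Fin n))
    (V := fun x : M => Tan n x) x₀
  have h1 : SmoothFun n (fun x => ∑ a, θ a x (D X x (Z a x))) :=
    contMDiff_finsetSum fun a _ => hZ.smooth_coeff a _ (hD _ _ (hZ.smooth a) hX)
  refine (h1 x₀).congr_of_eventuallyEq ?_
  filter_upwards [hZ.isOpen.mem_nhds hxU] with x hx
  exact trace_eq_sum_of_expand (hZ.expand x hx) _

variable {FE : Type*} [NormedAddCommGroup FE] [NormedSpace ℂ FE]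
  {E : M → Type*} [TopologicalSpace (TotalSpace FE E)] [∀ x, NormedAddCommGroup (E x)]
  [∀ x, InnerProductSpace ℂ (E x)] [FiberBundle FE E] [VectorBundle ℂ FE E] [VectorBundle ℝ FE E]
  [ContMDiffVectorBundle ∞ FE E (𝓡 n)] [FiniteDimensional ℂ FE]
  {cov cov₁ cov₂ : CovariantDerivative (𝓡 n) FE E}

theorem isCompact_closure_of_apply_eq_zero {V W : M → Type*} [∀ x, AddCommGroup (V x)]
    [∀ x, AddCommGroup (W x)] {s : Π x, V x} {t : Π x, W x}
    (hs : IsCompact (closure {x | s x ≠ 0})) (h : ∀ x, (∀ᶠ y in nhds x, s y = 0) → t x = 0) :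
    IsCompact (closure {x | t x ≠ 0}) := by
  refine hs.of_isClosed_subset isClosed_closure (closure_minimal (fun x hx => ?_) isClosed_closure)
  by_contra hx'
  refine hx (h x ?_)
  filter_upwards [isClosed_closure.isOpen_compl.mem_nhds hx'] with y hy
  by_contra hy'
  exact hy (subset_closure hy')

theorem covariantDerivative_eq_zero {φ : Π x, E x} (hφ : SmoothSection n FE φ) {x : M}
    (h : ∀ᶠ y in nhds x, φ y = 0) : cov φ x = 0 := by
  have h0 : SmoothSection n FE (fun x => (0 : E x)) := contMDiff_zeroSection ℝ E
  have h1 := cov.isCovariantDerivativeOnUniv.congr_of_eventuallyEq (x := x)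
    (hφ.mdifferentiable (by simp) x) (h0.mdifferentiable (by simp) x) Filter.univ_mem h
  rw [h1]
  have h2 : cov (fun _ => 0) = 0 := cov.zero
  rw [h2]
  rfl

/-- The formal adjoint of `∇_X`, up to the sign, on test sections. -/
theorem exists_testSection_adjoint (hD : IsSmoothConn D) (h : IsComplexConn cov)
    {X : Π x : M, Tan n x} (hX : SmoothField X) (φ : TestSection n FE E) :
    ∃ ψ : TestSection n FE E, ∀ x, ψ.1 x = cov φ.1 x (X x) + divergence D X x • φ.1 x := by
  refine ⟨⟨_, (h.smooth _ _ φ.2.1 hX).add_section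
    ((smoothFun_divergence hD hX).smul_section φ.2.1), ?_⟩, fun x => rfl⟩
  refine isCompact_closure_of_apply_eq_zero φ.2.2 fun x hx => ?_
  have h1 := covariantDerivative_eq_zero (cov := cov) φ.2.1 hx
  simp [h1, hx.self_of_nhds]

variable [RiemannianBundle (fun x : M => TangentSpace (𝓡 n) x)] [SecondCountableTopology M]
  [MeasurableSpace M]

/-- `s'` is the covariant derivative of `s` in the sense of distributions. -/
def weakRel (D : CovariantDerivative (𝓡 n) (EuclideanSpace ℝ (Fin n))
    (fun x : M => TangentSpace (𝓡 n) x)) (cov : CovariantDerivative (𝓡 n) FE E)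
    (s : Π x, E x) (s' : Π x : M, Tan n x → E x) : Prop :=
  (∀ φ : TestSection n FE E,
    Integrable (fun x => inner ℂ (φ.1 x) (s x)) (riemannianVolume n M)) ∧
  ∀ X : Π x : M, Tan n x, SmoothField X → ∀ φ : TestSection n FE E,
    Integrable (fun x => inner ℂ (φ.1 x) (s' x (X x))) (riemannianVolume n M) ∧
    ∫ x, inner ℂ (φ.1 x) (s' x (X x)) ∂(riemannianVolume n M) =
      - ∫ x, inner ℂ (cov φ.1 x (X x) + divergence D X x • φ.1 x) (s x) ∂(riemannianVolume n M)

theorem weakRel_add (hD : IsSmoothConn D) (h : IsComplexConn cov) {s t : Π x, E x} {s' t'}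
    (hs : weakRel D cov s s') (ht : weakRel D cov t t') :
    weakRel D cov (fun x => s x + t x) (fun x v => s' x v + t' x v) := by
  refine ⟨fun φ => ?_, fun X hX φ => ⟨?_, ?_⟩⟩
  · simp only [inner_add_right]
    exact (hs.1 φ).add (ht.1 φ)
  · simp only [inner_add_right]
    exact (hs.2 X hX φ).1.add (ht.2 X hX φ).1
  · obtain ⟨ψ, hψ⟩ := exists_testSection_adjoint hD h hX φ
    have h1 := (hs.2 X hX φ).2
    have h2 := (ht.2 X hX φ).2
    simp only [← hψ] at h1 h2 ⊢
    simp only [inner_add_right]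
    rw [integral_add (hs.2 X hX φ).1 (ht.2 X hX φ).1, integral_add (hs.1 ψ) (ht.1 ψ), h1, h2,
      neg_add]

/-- Weak derivatives of tensors are the derivatives which are induced, in the formal way, by weak
derivatives of sections. -/
theorem weakDeriv_iff (hD : IsSmoothConn D) {k : ℕ} {T : Π x, Ten n k E x}
    {T' : Π x, Ten n (k + 1) E x} : WeakDeriv D cov T T' ↔
      tenDeriv D (weakRel D cov) k T (fun x v => (T' x).curryLeft v) := by
  have hsum : ∀ (_ : LocIntegrable FE T) (Y : Fin k → Π x : M, Tan n x) (X : Π x : M, Tan n x)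
      (φ : TestSection n FE E), SmoothField X → (∀ i, SmoothField (Y i)) →
      Integrable (fun x => inner ℂ (φ.1 x) (∑ i, T x (Function.update (fun l => Y l x) i
        (D (Y i) x (X x))))) (riemannianVolume n M) := by
    intro h Y X φ hX hY
    simp only [inner_sum]
    refine integrable_finsetSum _ fun i _ => ?_
    have h1 := h (Function.update Y i fun x => D (Y i) x (X x)) φ fun j => by
      rcases eq_or_ne j i with rfl | hj
      · rw [Function.update_self]; exact hD _ _ hX (hY j)
      · rw [Function.update_of_ne hj]; exact hY j
    refine h1.congr (Filter.Eventually.of_forall fun x => ?_)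
    refine congrArg (fun w => inner ℂ (φ.1 x) (T x w)) (funext fun j => ?_)
    rcases eq_or_ne j i with rfl | hj
    · simp
    · simp [hj]
  constructor
  · rintro ⟨h1, h2, h3⟩ Y hY
    refine ⟨fun φ => h1 Y φ hY, fun X hX φ => ⟨?_, ?_⟩⟩
    · simp only [inner_add_right]
      refine Integrable.add ?_ (hsum h1 Y X φ hX hY)
      refine (h2 (Fin.cons X Y) φ (Fin.cases hX hY)).congr (Filter.Eventually.of_forall fun x => ?_)
      simp only [MultilinearMap.curryLeft_apply]
      congr 2
      funext i
      refine Fin.cases ?_ (fun i => ?_) i <;> simp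
    · exact h3 X Y φ hX hY
  · intro h
    have h1 : LocIntegrable FE T := fun Y φ hY => (h Y hY).1 φ
    refine ⟨h1, fun Y φ hY => ?_, fun X Y φ hX hY => ((h Y hY).2 X hX φ).2⟩
    have h2 := ((h (fun i => Y i.succ) fun i => hY i.succ).2 (Y 0) (hY 0) φ).1.sub
      (hsum h1 (fun i => Y i.succ) (Y 0) φ (hY 0) fun i => hY i.succ)
    refine h2.congr (Filter.Eventually.of_forall fun x => ?_)
    simp only [Pi.sub_apply, inner_add_right, add_sub_cancel_right, MultilinearMap.curryLeft_apply]
    congr 2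
    exact Fin.cons_self_tail fun i => Y i x

variable [∀ x, FiniteDimensional ℂ (E x)]

/-- The adjoints of smooth homomorphisms act on weakly differentiable sections, and the Leibniz rule
holds. -/
theorem weakRel_adjoint (hD : IsSmoothConn D) (h₁ : IsComplexConn cov₁) (h₂ : IsComplexConn cov₂)
    {c : Π x, E x →ₗ[ℂ] E x} {c'} {s : Π x, E x} {s'}
    (hc : homDeriv (bundleDeriv cov₂) (bundleDeriv cov₁) c c') (hs : weakRel D cov₁ s s') :
    weakRel D cov₂ (fun x => adjPairing (E x) (c x) (s x))
      (fun x v => adjPairing (E x) (c' x v) (s x) + adjPairing (E x) (c x) (s' x v)) := by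
  -- the images of a test section under `c` and under the derivative of `c`
  have hc1 : ∀ φ : TestSection n FE E, ∃ ψ : TestSection n FE E, ∀ x, ψ.1 x = c x (φ.1 x) := by
    intro φ
    refine ⟨⟨_, (hc φ.1 _ ⟨φ.2.1, fun _ _ => rfl⟩).1, ?_⟩, fun x => rfl⟩
    exact isCompact_closure_of_apply_eq_zero φ.2.2 fun x hx => by simp [hx.self_of_nhds]
  have hc2 : ∀ X : Π x : M, Tan n x, SmoothField X → ∀ φ : TestSection n FE E,
      ∃ ψ : TestSection n FE E, ∀ x, ψ.1 x = c' x (X x) (φ.1 x) := by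
    intro X hX φ
    obtain ⟨a', ha'⟩ := (isConnRel_homDeriv h₂ h₁).smooth hc hX
    refine ⟨⟨_, (ha' φ.1 _ ⟨φ.2.1, fun _ _ => rfl⟩).1, ?_⟩, fun x => rfl⟩
    exact isCompact_closure_of_apply_eq_zero φ.2.2 fun x hx => by simp [hx.self_of_nhds]
  have hint : ∀ (φ : TestSection n FE E), Integrable
      (fun x => inner ℂ (c x (φ.1 x)) (s x)) (riemannianVolume n M) := by
    intro φ
    obtain ⟨ψ, hψ⟩ := hc1 φ
    simpa only [← hψ] using hs.1 ψ
  simp only [weakRel, adjPairing_apply, inner_add_right, LinearMap.adjoint_inner_right]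
  refine ⟨hint, fun X hX φ => ?_⟩
  obtain ⟨ψ, hψ⟩ := hc1 φ
  obtain ⟨χ, hχ⟩ := hc2 X hX φ
  obtain ⟨τ, hτ⟩ := exists_testSection_adjoint hD h₂ hX φ
  obtain ⟨η, hη⟩ := hc1 τ
  have h3 := hs.2 X hX ψ
  have h4 : ∀ x, cov₁ ψ.1 x (X x) + divergence D X x • ψ.1 x = χ.1 x + η.1 x := by
    intro x
    have h5 := (hc φ.1 _ ⟨φ.2.1, fun _ _ => rfl⟩).2 x (X x)
    have h6 : ψ.1 = fun x => c x (φ.1 x) := funext hψ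
    have h7 : c x (divergence D X x • φ.1 x) = divergence D X x • c x (φ.1 x) :=
      ((c x).restrictScalars ℝ).map_smul _ _
    rw [hχ, hη, hτ, hψ, h6, ← h5, map_add, h7]
    exact add_assoc _ _ _
  simp only [h4, inner_add_left] at h3
  rw [integral_add (hs.1 χ) (hs.1 η)] at h3
  simp only [← hψ, ← hχ, ← hτ, ← hη]
  refine ⟨(hs.1 χ).add h3.1, ?_⟩
  rw [integral_add (hs.1 χ) h3.1, h3.2]
  abel

/-- The weak derivatives for `∇₂` of a section are obtained from those for `∇₁` by the Leibniz rule,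
applied to `u = id* u`. The adjoint appears since the rule is tested against smooth sections. -/
theorem WeakIteratedDeriv.leib (hD : IsSmoothConn D) (h₁ : IsComplexConn cov₁)
    (h₂ : IsComplexConn cov₂) {C}
    (hC : IteratedDeriv D (homDeriv (bundleDeriv cov₂) (bundleDeriv cov₁))
      (fun _ => LinearMap.id) C) {l : ℕ} {u : Π x, E x} {U}
    (hU : WeakIteratedDeriv D cov₁ l u U) : WeakIteratedDeriv D cov₂ l u
      (fun k x => NablaSobolev.leib (adjPairing (E x)) k (fun j => C j x) (fun j => U j x)) := by
  have h0 : ∀ x, NablaSobolev.leib (adjPairing (E x)) 0 (fun j => C j x) (fun j => U j x) =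
      U 0 x := by
    intro x
    ext v
    rw [leib_zero, hC.1, hU.1]
    simp
  refine ⟨fun x => (h0 x).trans (hU.1 x), ?_, fun k hk => ?_⟩
  · simp only [h0]
    exact hU.2.1
  · refine (weakDeriv_iff hD).2 (rel_congr (tenDeriv_leib (weakRel_add hD h₂)
      (weakRel_adjoint hD h₁ h₂) k (fun j _ => hC.2 j)
      fun j hj => (weakDeriv_iff hD).1 (hU.2.2 j (by omega))) rfl ?_)
    funext x v
    exact leib_succ_curryLeft _ _ _ _ _

end Weak

/-! ### Measurability of tensor norms -/

section FrameSums

variable {T V : Type*} [AddCommGroup V] [Module ℝ V]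

/-- The sum of the pairings of the components of two tensors in two families of vectors. -/
def pairSum [AddCommGroup T] [Module ℝ T] (b : V →ₗ[ℝ] V →ₗ[ℝ] ℝ) {ι : Type*} [Fintype ι]
    (e f : ι → T) {k : ℕ} (S S' : MultilinearMap ℝ (fun _ : Fin k => T) V) : ℝ :=
  ∑ I : Fin k → ι, b (S fun i => e (I i)) (S' fun i => f (I i))

theorem pairSum_succ [AddCommGroup T] [Module ℝ T] (b : V →ₗ[ℝ] V →ₗ[ℝ] ℝ) {ι : Type*} [Fintype ι]
    (e f : ι → T) {k : ℕ} (S S' : MultilinearMap ℝ (fun _ : Fin (k + 1) => T) V) :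
    pairSum b e f S S' = ∑ i, pairSum b e f (S.curryLeft (e i)) (S'.curryLeft (f i)) := by
  have h : ∀ (g : ι → T) (i : ι) (I : Fin k → ι),
      (fun j => g ((Fin.consEquiv fun _ : Fin (k + 1) => ι) (i, I) j)) =
        Fin.cons (g i) fun j => g (I j) := by
    intro g i I
    funext j
    refine Fin.cases ?_ (fun j => ?_) j <;> simp [Fin.consEquiv]
  rw [pairSum, ← (Fin.consEquiv fun _ : Fin (k + 1) => ι).sum_comp, Fintype.sum_prod_type]
  refine Finset.sum_congr rfl fun i _ => Finset.sum_congr rfl fun I _ => ?_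
  rw [MultilinearMap.curryLeft_apply, MultilinearMap.curryLeft_apply, h, h]

variable [NormedAddCommGroup T] [InnerProductSpace ℝ T] {ι κ : Type*} [Fintype ι] [Fintype κ]
  (e : OrthonormalBasis ι ℝ T) {Z W : κ → T}

theorem sum_orthonormalBasis_eq (h : ∀ v : T, v = ∑ a, (inner ℝ (W a) v : ℝ) • Z a)
    (b : T →ₗ[ℝ] T →ₗ[ℝ] ℝ) : ∑ i, b (e i) (e i) = ∑ a, b (Z a) (W a) := by
  have h1 : ∀ i, b (e i) (e i) = ∑ a, b (Z a) ((inner ℝ (e i) (W a) : ℝ) • e i) := by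
    intro i
    conv_lhs => arg 1; rw [h (e i)]
    simp only [map_sum, map_smul, LinearMap.sum_apply, LinearMap.smul_apply, real_inner_comm]
  simp only [h1]
  rw [Finset.sum_comm]
  refine Finset.sum_congr rfl fun a _ => ?_
  rw [← map_sum, e.sum_repr']

/-- The trace of a bilinear form over all slots of a tensor can be computed in a frame and its dual
frame. -/
theorem pairSum_eq_of_expand (h : ∀ v : T, v = ∑ a, (inner ℝ (W a) v : ℝ) • Z a)
    (b : V →ₗ[ℝ] V →ₗ[ℝ] ℝ) (k : ℕ) : ∀ S S' : MultilinearMap ℝ (fun _ : Fin k => T) V,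
    pairSum b e e S S' = pairSum b Z W S S' := by
  induction k with
  | zero =>
    intro S S'
    simp only [pairSum, Fintype.sum_unique]
    congr 2
    · congr 1
      exact Subsingleton.elim (α := Fin 0 → T) _ _
    · exact Subsingleton.elim (α := Fin 0 → T) _ _
  | succ k ih =>
    intro S S'
    rw [pairSum_succ, pairSum_succ]
    let B : T →ₗ[ℝ] T →ₗ[ℝ] ℝ := LinearMap.mk₂ ℝ
      (fun v w => pairSum b Z W (S.curryLeft v) (S'.curryLeft w))
      (by intros; simp [pairSum, Finset.sum_add_distrib])
      (by intros; simp [pairSum, Finset.mul_sum])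
      (by intros; simp [pairSum, Finset.sum_add_distrib])
      (by intros; simp [pairSum, Finset.mul_sum])
    simp only [ih]
    exact sum_orthonormalBasis_eq e h B

end FrameSums

section Measurability

variable {n : ℕ} {M : Type*} [TopologicalSpace M] [ChartedSpace (EuclideanSpace ℝ (Fin n)) M]
  [IsManifold (𝓡 n) ∞ M] [T2Space M]
  [RiemannianBundle (fun x : M => TangentSpace (𝓡 n) x)]
  [IsContMDiffRiemannianBundle (𝓡 n) ∞ (EuclideanSpace ℝ (Fin n))
    (fun x : M => TangentSpace (𝓡 n) x)]
  {FE : Type*} [NormedAddCommGroup FE] [NormedSpace ℂ FE]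
  {E : M → Type*} [TopologicalSpace (TotalSpace FE E)] [∀ x, NormedAddCommGroup (E x)]
  [∀ x, InnerProductSpace ℂ (E x)] [FiberBundle FE E] [VectorBundle ℂ FE E] [VectorBundle ℝ FE E]
  [ContMDiffVectorBundle ∞ FE E (𝓡 n)] [FiniteDimensional ℂ FE]

/-- The real inner product of the tangent bundle. -/
def tanInner (n : ℕ) {M : Type*} [TopologicalSpace M]
    [ChartedSpace (EuclideanSpace ℝ (Fin n)) M]
    [RiemannianBundle (fun x : M => TangentSpace (𝓡 n) x)] (x : M) :
    Tan n x →ₗ[ℝ] Tan n x →ₗ[ℝ] ℝ :=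
  LinearMap.mk₂ ℝ (fun v w => inner ℝ v w) (fun _ _ _ => inner_add_left _ _ _)
    (fun _ _ _ => real_inner_smul_left _ _ _) (fun _ _ _ => inner_add_right _ _ _)
    (fun _ _ _ => real_inner_smul_right _ _ _)

/-- The real part of the inner product. -/
def reInner (V : Type*) [NormedAddCommGroup V] [InnerProductSpace ℂ V] : V →ₗ[ℝ] V →ₗ[ℝ] ℝ :=
  LinearMap.mk₂ ℝ (fun v w => (inner ℂ v w : ℂ).re) (fun _ _ _ => by simp)
    (fun _ _ _ => by simp) (fun _ _ _ => by simp) (fun _ _ _ => by simp)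

@[simp] theorem reInner_apply {V : Type*} [NormedAddCommGroup V] [InnerProductSpace ℂ V]
    (v w : V) : reInner V v w = (inner ℂ v w : ℂ).re := rfl

theorem reInner_self {V : Type*} [NormedAddCommGroup V] [InnerProductSpace ℂ V] (v : V) :
    reInner V v v = ‖v‖ ^ 2 := inner_self_eq_norm_sq (𝕜 := ℂ) v

variable (n) in
theorem exists_tanFrame (x₀ : M) :
    ∃ (U : Set M) (Z W : Fin (Module.finrank ℝ (EuclideanSpace ℝ (Fin n))) → Π x : M, Tan n x),
      x₀ ∈ U ∧ IsOpen U ∧ (∀ a, SmoothField (Z a)) ∧ (∀ a, SmoothField (W a)) ∧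
      ∀ x ∈ U, ∀ v : Tan n x, v = ∑ a, (inner ℝ (W a x) v : ℝ) • Z a x := by
  obtain ⟨U, Z, W, h1, h2, h3, h4, -, -, h7⟩ := exists_metricFrame (n := n)
    (F := EuclideanSpace ℝ (Fin n)) (V := fun x : M => Tan n x) (tanInner n)
    (fun x v hv => inner_self_eq_zero.1 hv) (fun s t hs ht => ContMDiff.inner_bundle hs ht) x₀
  exact ⟨U, Z, W, h1, h2, h3, h4, h7⟩

theorem exists_bundleFrame (hE : SmoothMetric n FE E) (x₀ : M) :
    ∃ (U : Set M) (Z W : Fin (Module.finrank ℝ FE) → TestSection n FE E),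
      x₀ ∈ U ∧ IsOpen U ∧
      ∀ x ∈ U, ∀ v, v = ∑ a, (inner ℂ ((W a).1 x) v : ℂ).re • (Z a).1 x := by
  have : FiniteDimensional ℝ FE := FiniteDimensional.complexToReal FE
  obtain ⟨U, Z, W, h1, h2, h3, h4, h5, h6, h7⟩ := exists_metricFrame (n := n)
    (F := FE) (V := E) (fun x => reInner (E x))
    (fun x v hv => by
      rw [reInner_self] at hv
      exact norm_eq_zero.1 (pow_eq_zero_iff two_ne_zero |>.1 hv))
    (fun s t hs ht => Complex.reCLM.contDiff.contMDiff.comp (hE s t hs ht)) x₀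
  exact ⟨U, fun a => ⟨Z a, h3 a, h5 a⟩, fun a => ⟨W a, h4 a, h6 a⟩, h1, h2, h7⟩

variable [SecondCountableTopology M] [MeasurableSpace M] [BorelSpace M]

/-- In local frames, the square of the norm is a polynomial in pairings with smooth sections. -/
theorem LocIntegrable.aemeasurable_tenNorm (hE : SmoothMetric n FE E) {k : ℕ}
    {T : Π x, Ten n k E x} (hT : LocIntegrable FE T) :
    AEMeasurable (fun x => tenNorm bundleNorm x (T x)) (riemannianVolume n M) := by
  have key : ∀ x₀ : M, ∃ U : Set M, U ∈ nhds x₀ ∧ IsOpen U ∧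
      AEMeasurable (fun x => tenNorm bundleNorm x (T x)) ((riemannianVolume n M).restrict U) := by
    intro x₀
    obtain ⟨U₁, Z, W, hx₁, hU₁, hZ, hW, h1⟩ := exists_tanFrame n x₀
    obtain ⟨U₂, Y, X, hx₂, hU₂, h2⟩ := exists_bundleFrame hE x₀
    refine ⟨U₁ ∩ U₂, (hU₁.inter hU₂).mem_nhds ⟨hx₁, hx₂⟩, hU₁.inter hU₂, ?_⟩
    have hm : ∀ (φ : TestSection n FE E) (V : Fin k → Π x : M, Tan n x), (∀ i, SmoothField (V i)) →
        AEMeasurable (fun x => (inner ℂ (φ.1 x) (T x fun i => V i x) : ℂ).re)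
          (riemannianVolume n M) :=
      fun φ V hV => (hT V φ hV).aestronglyMeasurable.aemeasurable.re
    have hf : AEMeasurable (fun x => √(∑ I : Fin k → Fin (Module.finrank ℝ
        (EuclideanSpace ℝ (Fin n))), ∑ c,
          (inner ℂ ((X c).1 x) (T x fun i => Z (I i) x) : ℂ).re *
          (inner ℂ ((Y c).1 x) (T x fun i => W (I i) x) : ℂ).re)) (riemannianVolume n M) := by
      refine AEMeasurable.sqrt (Finset.aemeasurable_fun_sum _ fun I _ =>
        Finset.aemeasurable_fun_sum _ fun c _ => ?_)
      exact (hm _ _ fun i => hZ _).mul (hm _ _ fun i => hW _)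
    refine hf.restrict.congr ?_
    filter_upwards [ae_restrict_mem (hU₁.inter hU₂).measurableSet] with x hx
    rw [tenNorm]
    congr 1
    have h3 : ∀ v w : E x, reInner (E x) v w =
        ∑ c, (inner ℂ ((X c).1 x) v : ℂ).re * (inner ℂ ((Y c).1 x) w : ℂ).re := by
      intro v w
      conv_lhs => rw [h2 x hx.2 v]
      simp
    refine Eq.trans ?_ ((pairSum_eq_of_expand (tanBasis n x) (h1 x hx.1) (reInner (E x)) k
      (T x) (T x)).symm.trans ?_)
    · exact Finset.sum_congr rfl fun I _ => (h3 _ _).symm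
    · exact Finset.sum_congr rfl fun I _ => reInner_self _
  choose U hU hUo hm using key
  obtain ⟨s, hs, hsU⟩ := TopologicalSpace.countable_cover_nhds hU
  have : Countable s := hs.to_subtype
  rw [← Measure.restrict_univ (μ := riemannianVolume n M), ← hsU, Set.biUnion_eq_iUnion]
  exact aemeasurable_iUnion_iff.2 fun i => hm i

end Measurability

/-! ### Equivalence of the Sobolev norms -/

section EllNorm

theorem le_ellNorm {p : ℝ≥0∞} (hp : 1 ≤ p) {l j : ℕ} (hj : j ≤ l) (N : ℕ → ℝ≥0∞) :
    N j ≤ ellNorm p l N := by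
  have hj' : j ∈ Finset.range (l + 1) := Finset.mem_range.2 (by omega)
  rw [ellNorm]
  split_ifs with h
  · exact le_iSup₂_of_le (f := fun j (_ : j ∈ Finset.range (l + 1)) => N j) j hj' le_rfl
  · have hp0 : 0 < p.toReal := ENNReal.toReal_pos (by positivity) h
    calc N j = (N j ^ p.toReal) ^ (1 / p.toReal) := by
          rw [← ENNReal.rpow_mul, mul_one_div_cancel hp0.ne', ENNReal.rpow_one]
      _ ≤ _ := by
          refine ENNReal.rpow_le_rpow ?_ (by positivity)
          exact Finset.single_le_sum (f := fun j => N j ^ p.toReal) (fun _ _ => zero_le) hj'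

/-- The constant `l + 1` serves for all exponents `p` at once. -/
theorem ellNorm_le {p : ℝ≥0∞} (hp : 1 ≤ p) {l : ℕ} {N : ℕ → ℝ≥0∞} {B : ℝ≥0∞}
    (hN : ∀ j ≤ l, N j ≤ B) : ellNorm p l N ≤ (l + 1 : ℕ) * B := by
  have h1 : (1 : ℝ≥0∞) ≤ (l + 1 : ℕ) := by exact_mod_cast Nat.le_add_left 1 l
  rw [ellNorm]
  split_ifs with h
  · refine iSup₂_le fun j hj => (hN j ?_).trans (le_mul_of_one_le_left (zero_le) h1)
    exact Nat.lt_succ_iff.1 (Finset.mem_range.1 hj)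
  · have hp1 : 1 ≤ p.toReal := by
      rw [← ENNReal.toReal_one]
      exact (ENNReal.toReal_le_toReal ENNReal.one_ne_top h).2 hp
    have hp0 : 0 < p.toReal := by linarith
    have h2 : ∑ j ∈ Finset.range (l + 1), N j ^ p.toReal ≤ (l + 1 : ℕ) * B ^ p.toReal := by
      refine (Finset.sum_le_sum fun j hj => ENNReal.rpow_le_rpow (hN j ?_) hp0.le).trans_eq ?_
      · exact Nat.lt_succ_iff.1 (Finset.mem_range.1 hj)
      · simp
    calc _ ≤ ((l + 1 : ℕ) * B ^ p.toReal) ^ (1 / p.toReal) :=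
          ENNReal.rpow_le_rpow h2 (by positivity)
      _ = ((l + 1 : ℕ) : ℝ≥0∞) ^ (1 / p.toReal) * B := by
          rw [ENNReal.mul_rpow_of_nonneg _ _ (by positivity), ← ENNReal.rpow_mul,
            mul_one_div_cancel hp0.ne', ENNReal.rpow_one]
      _ ≤ ((l + 1 : ℕ) : ℝ≥0∞) ^ (1 : ℝ) * B := by
          gcongr
          rw [div_le_one hp0]
          exact hp1
      _ = _ := by rw [ENNReal.rpow_one]

end EllNorm

section Sobolev

variable {n : ℕ} {M : Type*} [TopologicalSpace M] [ChartedSpace (EuclideanSpace ℝ (Fin n)) M]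
  [IsManifold (𝓡 n) ∞ M] [T2Space M]
  [RiemannianBundle (fun x : M => TangentSpace (𝓡 n) x)]
  [IsContMDiffRiemannianBundle (𝓡 n) ∞ (EuclideanSpace ℝ (Fin n))
    (fun x : M => TangentSpace (𝓡 n) x)]
  {D : CovariantDerivative (𝓡 n) (EuclideanSpace ℝ (Fin n)) (fun x : M => TangentSpace (𝓡 n) x)}
  {FE : Type*} [NormedAddCommGroup FE] [NormedSpace ℂ FE]
  {E : M → Type*} [TopologicalSpace (TotalSpace FE E)] [∀ x, NormedAddCommGroup (E x)]
  [∀ x, InnerProductSpace ℂ (E x)] [FiberBundle FE E] [VectorBundle ℂ FE E] [VectorBundle ℝ FE E]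
  [ContMDiffVectorBundle ∞ FE E (𝓡 n)] [FiniteDimensional ℂ FE]
  [SecondCountableTopology M] [MeasurableSpace M] [BorelSpace M]
  {cov cov₁ cov₂ : CovariantDerivative (𝓡 n) FE E}

theorem WeakIteratedDeriv.locIntegrable {l : ℕ} {u : Π x, E x} {U}
    (hU : WeakIteratedDeriv D cov l u U) {j : ℕ} (hj : j ≤ l) : LocIntegrable FE (U j) := by
  cases j with
  | zero => exact hU.2.1
  | succ j => exact (hU.2.2 j hj).2.1

variable [∀ x, FiniteDimensional ℂ (E x)]

/-- A pointwise bound for the transition between two connections bounds the Sobolev norms. -/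
theorem sobolevNorm_le_of_transition (hE : SmoothMetric n FE E) (hD : IsSmoothConn D)
    (h₁ : IsComplexConn cov₁) (h₂ : IsComplexConn cov₂) {C}
    (hC : IteratedDeriv D (homDeriv (bundleDeriv cov₂) (bundleDeriv cov₁))
      (fun _ => LinearMap.id) C) {l : ℕ} {c : ℝ≥0} (hc1 : 1 ≤ c)
    (hc : ∀ᵐ x ∂(riemannianVolume n M),
      4 ^ l * ∑ j ∈ Finset.range (l + 1), tenSq (tanBasis n x) opSq (C j x) ≤ (c : ℝ) ^ 2)
    {p : ℝ≥0∞} (hp : 1 ≤ p) (u : Π x, E x) :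
    sobolevNorm D cov₂ l p u ≤
      (((l + 1 : ℕ) : ℝ≥0∞) ^ 2 * c) * sobolevNorm D cov₁ l p u := by
  set κ : ℝ≥0∞ := ((l + 1 : ℕ) : ℝ≥0∞) ^ 2 * c with hκ
  have htop : κ ≠ ⊤ := ENNReal.mul_ne_top (by simp) ENNReal.coe_ne_top
  rw [sobolevNorm.eq_1 D cov₁]
  have key : ∀ U, WeakIteratedDeriv D cov₁ l u U → sobolevNorm D cov₂ l p u ≤
      κ * ellNorm p l fun j => eLpNorm (fun x => tenNorm bundleNorm x (U j x)) p
        (riemannianVolume n M) := by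
    intro U hU
    refine (iInf₂_le _ (hU.leib hD h₁ h₂ hC)).trans ?_
    set N : ℕ → ℝ≥0∞ := fun j => eLpNorm (fun x => tenNorm bundleNorm x (U j x)) p
        (riemannianVolume n M) with hN
    have h3 : ∀ k ≤ l, eLpNorm (fun x => tenNorm bundleNorm x
        (leib (adjPairing (E x)) k (fun j => C j x) (fun j => U j x) : Ten n k E x)) p
        (riemannianVolume n M) ≤ c * ((l + 1 : ℕ) * ellNorm p l N) := by
      intro k hk
      have h4 : ∀ᵐ x ∂(riemannianVolume n M), ‖tenNorm bundleNorm x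
          (leib (adjPairing (E x)) k (fun j => C j x) (fun j => U j x) : Ten n k E x)‖ ≤
          ‖((c : ℝ) • ∑ j ∈ Finset.range (l + 1),
            fun x => tenNorm bundleNorm x (U j x)) x‖ := by
        filter_upwards [hc] with x hx
        have h0 : ∀ j ∈ Finset.range (l + 1), 0 ≤ tenNorm bundleNorm x (U j x) :=
          fun j _ => tenNorm_nonneg _ _ _
        simp only [Pi.smul_apply, Finset.sum_apply, smul_eq_mul, norm_mul]
        rw [Real.norm_of_nonneg (tenNorm_nonneg _ _ _), Real.norm_of_nonneg c.coe_nonneg,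
          Real.norm_of_nonneg (Finset.sum_nonneg h0)]
        refine abs_le_of_sq_le_sq' ?_ (mul_nonneg c.coe_nonneg (Finset.sum_nonneg h0)) |>.2
        refine (tenSq_leib_adjPairing_le k l hk (fun j => C j x) (fun j => U j x)
          (sum_tenSq_nonneg _ opSq_nonneg _ _) le_rfl).trans ?_
        rw [mul_pow]
        exact mul_le_mul hx (Finset.sum_sq_le_sq_sum_of_nonneg h0)
          (Finset.sum_nonneg fun _ _ => sq_nonneg _) (sq_nonneg _)
      refine (eLpNorm_mono_ae h4).trans ?_
      rw [eLpNorm_const_smul]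
      have h5 : ‖(c : ℝ)‖ₑ = c := by simp [enorm]
      rw [h5]
      gcongr
      refine (eLpNorm_sum_le (fun j hj => ?_) hp).trans ?_
      · exact ((hU.locIntegrable (Nat.lt_succ_iff.1 (Finset.mem_range.1 hj))).aemeasurable_tenNorm
          hE).aestronglyMeasurable
      · refine (Finset.sum_le_sum fun j hj =>
          le_ellNorm hp (Nat.lt_succ_iff.1 (Finset.mem_range.1 hj)) N).trans_eq ?_
        simp
    refine (ellNorm_le hp h3).trans_eq ?_
    rw [hκ]
    ring
  have h0 : κ ≠ 0 := by
    refine mul_ne_zero (pow_ne_zero 2 (by simp)) (ENNReal.coe_ne_zero.2 ?_)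
    exact (zero_lt_one.trans_le hc1).ne'
  rw [ENNReal.mul_iInf_of_ne h0 htop]
  refine le_iInf fun U => ?_
  rw [ENNReal.mul_iInf_of_ne h0 htop]
  exact le_iInf fun hU => key U hU

/-- The constant for the equivalence of the Sobolev norms. The bound `K + 1` is used in place of
`K` because `‖A‖` is an infimum over families of derivatives. -/
def sobolevConst (l : ℕ) (K : ℝ≥0) : ℝ≥0 :=
  (l + 1 : ℕ) ^ 2 * max 1 (Real.toNNReal √(4 ^ l * transBound 1 ((K + 1 : ℝ) ^ 2) l))

theorem one_le_sobolevConst (l : ℕ) (K : ℝ≥0) : 1 ≤ sobolevConst l K := by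
  refine one_le_mul_of_one_le_of_one_le (one_le_pow₀ ?_) (le_max_left _ _)
  exact_mod_cast Nat.le_add_left 1 l

/-- The `W^{l-1,∞}`-norm of `A` bounds its derivatives of order less than `l` almost everywhere. -/
theorem exists_iteratedDeriv_form_le (hD : IsSmoothConn D) (h : IsComplexConn cov)
    {A : Π x, Ten n 1 (fun x : M => E x →ₗ[ℂ] E x) x} (hA : SmoothOneForm FE A) (l : ℕ)
    (hK : 1 ≤ l → formSobolevNorm D cov (l - 1) ⊤ A < ⊤) :
    ∃ S, IteratedDeriv D (tenDeriv D (homDeriv (bundleDeriv cov) (bundleDeriv cov)) 1) A S ∧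
      ∀ᵐ x ∂(riemannianVolume n M), ∀ j < l, tenNorm (tenNorm endNorm) x (S j x) ≤
        ((formSobolevNorm D cov (l - 1) ⊤ A).toNNReal : ℝ) + 1 := by
  rcases Nat.eq_zero_or_pos l with rfl | hl
  · obtain ⟨S, hS⟩ := exists_iteratedDeriv_form hD h hA
    exact ⟨S, hS, Filter.Eventually.of_forall fun x j hj => absurd hj (Nat.not_lt_zero j)⟩
  have hK := hK hl
  set K := formSobolevNorm D cov (l - 1) ⊤ A with hKdef
  have h1 : K < K + 1 := ENNReal.lt_add_right hK.ne one_ne_zero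
  rw [hKdef, formSobolevNorm, smoothSobolevNorm] at h1
  simp only [iInf_lt_iff] at h1
  obtain ⟨S, hS, h2⟩ := h1
  refine ⟨S, hS, ?_⟩
  rw [← smoothSobolevNorm, ← formSobolevNorm, ← hKdef] at h2
  rw [ae_all_iff]
  intro j
  by_cases hj : j < l
  · have h3 := (le_ellNorm le_top (show j ≤ l - 1 by omega) _).trans h2.le
    rw [eLpNorm_exponent_top] at h3
    filter_upwards [enorm_ae_le_eLpNormEssSup (fun x => tenNorm (tenNorm endNorm) x (S j x))
      (riemannianVolume n M)] with x hx _
    have h4 := hx.trans h3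
    rw [Real.enorm_of_nonneg (tenNorm_nonneg _ _ _)] at h4
    have h5 := (ENNReal.ofReal_le_iff_le_toReal (ENNReal.add_ne_top.2 ⟨hK.ne,
      ENNReal.one_ne_top⟩)).1 h4
    rwa [ENNReal.toReal_add hK.ne ENNReal.one_ne_top, ENNReal.toReal_one] at h5
  · exact Filter.Eventually.of_forall fun x hj' => absurd hj' hj

/-- The comparison of the Sobolev norms, in both directions. -/
theorem sobolevNorm_le (hE : SmoothMetric n FE E) (hD : IsSmoothConn D)
    (h : IsComplexConn cov)
    {A : Π x, Ten n 1 (fun x : M => E x →ₗ[ℂ] E x) x} (hA : SmoothOneForm FE A) {l : ℕ}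
    (hK : 1 ≤ l → formSobolevNorm D cov (l - 1) ⊤ A < ⊤)
    (hc : cov₁ = cov ∧ cov₂ = addForm cov A ∨ cov₁ = addForm cov A ∧ cov₂ = cov)
    {p : ℝ≥0∞} (hp : 1 ≤ p) (u : Π x, E x) :
    sobolevNorm D cov₂ l p u ≤
      sobolevConst l (formSobolevNorm D cov (l - 1) ⊤ A).toNNReal * sobolevNorm D cov₁ l p u := by
  obtain ⟨S, hS, hle⟩ := exists_iteratedDeriv_form_le hD h hA l hK
  obtain ⟨C, hC, hb⟩ := exists_transition_bound hD h hA hS hc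
  have hcc : IsComplexConn cov₁ ∧ IsComplexConn cov₂ := by
    rcases hc with ⟨rfl, rfl⟩ | ⟨rfl, rfl⟩
    · exact ⟨h, h.addForm hA⟩
    · exact ⟨h.addForm hA, h⟩
  set K := (formSobolevNorm D cov (l - 1) ⊤ A).toNNReal
  have h0 : 0 ≤ 4 ^ l * transBound 1 ((K + 1 : ℝ) ^ 2) l :=
    mul_nonneg (by positivity) (transBound_nonneg zero_le_one (sq_nonneg _) l)
  have h1 := sobolevNorm_le_of_transition hE hD hcc.1 hcc.2 hC
    (c := max 1 (Real.toNNReal √(4 ^ l * transBound 1 ((K + 1 : ℝ) ^ 2) l)))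
    (le_max_left _ _) (by
      filter_upwards [hle] with x hx
      refine (mul_le_mul_of_nonneg_left (hb x l _ hx) (by positivity)).trans ?_
      rw [← Real.sqrt_le_left (by positivity), NNReal.coe_max,
        Real.coe_toNNReal _ (Real.sqrt_nonneg _)]
      exact le_max_right _ _) hp u
  refine h1.trans_eq ?_
  rw [sobolevConst]
  push_cast
  rfl

end Sobolev

/-! ### Norms of coefficients -/

section Coefficients

variable {n : ℕ} {M : Type*} [TopologicalSpace M] [ChartedSpace (EuclideanSpace ℝ (Fin n)) M]
  [RiemannianBundle (fun x : M => TangentSpace (𝓡 n) x)]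
  {E : M → Type*} [∀ x, NormedAddCommGroup (E x)] [∀ x, InnerProductSpace ℂ (E x)]

theorem finrank_tan (x : M) : Module.finrank ℝ (Tan n x) = n :=
  finrank_euclideanSpace_fin (𝕜 := ℝ)

theorem tenFrame_eq_pureTen {j : ℕ} (x : M) (I : Fin j → Fin (Module.finrank ℝ (Tan n x)))
    (f : E x) : (tenFrame x I f : Ten n j E x) =
      pureTen (fun i => (innerSL ℝ (tanBasis n x (I i))).toLinearMap) f := rfl

theorem tenFrame_apply_basis {j : ℕ} (x : M) (I J : Fin j → Fin (Module.finrank ℝ (Tan n x)))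
    (f : E x) : (tenFrame x I f : Ten n j E x) (fun i => tanBasis n x (J i)) =
      if I = J then f else 0 := by
  rw [tenFrame_eq_pureTen, pureTen_apply]
  have h : ∀ i, (innerSL ℝ (tanBasis n x (I i))).toLinearMap (tanBasis n x (J i)) =
      if I i = J i then (1 : ℝ) else 0 := fun i =>
    (orthonormal_iff_ite.1 (tanBasis n x).orthonormal) (I i) (J i)
  simp only [h]
  by_cases hIJ : I = J
  · subst hIJ; simp
  · obtain ⟨i, hi⟩ := Function.ne_iff.1 hIJ
    rw [Finset.prod_eq_zero (Finset.mem_univ i) (by simp [hi]), zero_smul, if_neg hIJ]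

theorem eq_sum_tenFrame {j : ℕ} (x : M) (T : Ten n j E x) :
    T = ∑ I, tenFrame x I (T fun i => tanBasis n x (I i)) := by
  refine Module.Basis.ext_multilinear (fun _ => (tanBasis n x).toBasis) fun J => ?_
  have h : (fun i => (tanBasis n x).toBasis (J i)) = fun i => tanBasis n x (J i) := by
    funext i; simp
  rw [h, sum_apply]
  simp [tenFrame_apply_basis]

theorem tenSq_tenFrame {j : ℕ} (x : M) (I : Fin j → Fin (Module.finrank ℝ (Tan n x))) (f : E x) :
    tenSq (tanBasis n x) (fun v => ‖v‖ ^ 2) (tenFrame x I f : Ten n j E x) = ‖f‖ ^ 2 := by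
  rw [tenSq, Finset.sum_eq_single I]
  · simp [tenFrame_apply_basis]
  · intro J _ hJ
    simp [tenFrame_apply_basis, hJ.symm]
  · simp

theorem tenNorm_bundleNorm_eq_norm {k : ℕ} (x : M) (T : Ten n k E x) :
    tenNorm bundleNorm x T =
      ‖WithLp.toLp 2 fun I : Fin k → Fin (Module.finrank ℝ (Tan n x)) =>
        T fun i => tanBasis n x (I i)‖ := by
  rw [PiLp.norm_eq_of_L2]
  rfl

theorem tenNorm_add_le {k : ℕ} (x : M) (T T' : Ten n k E x) :
    tenNorm bundleNorm x (T + T') ≤ tenNorm bundleNorm x T + tenNorm bundleNorm x T' := by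
  simp only [tenNorm_bundleNorm_eq_norm]
  exact norm_add_le (WithLp.toLp 2 fun I : Fin k → Fin (Module.finrank ℝ (Tan n x)) =>
        T fun i => tanBasis n x (I i)) (WithLp.toLp 2 _)

theorem tenNorm_smul {k : ℕ} (x : M) (c : ℂ) (T : Ten n k E x) :
    tenNorm bundleNorm x (c • T) = ‖c‖ * tenNorm bundleNorm x T := by
  simp only [tenNorm_bundleNorm_eq_norm]
  exact norm_smul c (WithLp.toLp 2 fun I : Fin k → Fin (Module.finrank ℝ (Tan n x)) =>
        T fun i => tanBasis n x (I i))

variable [∀ x, FiniteDimensional ℂ (E x)]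

/-- A boundedness criterion with squares in place of square roots. -/
theorem exists_tenNorm_le_iff {V : M → Type*} [∀ x, AddCommGroup (V x)] [∀ x, Module ℝ (V x)]
    (N : ∀ x, V x → ℝ) {k : ℕ} (S : Π x, Ten n k V x) :
    (∃ c : ℝ, ∀ x, tenNorm N x (S x) ≤ c) ↔
      ∃ c : ℝ, ∀ x, tenSq (tanBasis n x) (fun v => N x v ^ 2) (S x) ≤ c := by
  simp only [← tenNorm_sq]
  constructor
  · rintro ⟨c, hc⟩
    exact ⟨c ^ 2, fun x => pow_le_pow_left₀ (tenNorm_nonneg _ _ _) (hc x) 2⟩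
  · rintro ⟨c, hc⟩
    exact ⟨√c, fun x => Real.le_sqrt_of_sq_le (hc x)⟩

section Coeff

variable {F : M → Type*} [∀ x, NormedAddCommGroup (F x)] [∀ x, InnerProductSpace ℂ (F x)]

theorem coeffNorm_sq {j m : ℕ} (x : M) (a : Ten n j E x →ₗ[ℂ] Ten n m F x) :
    coeffNorm (tenNorm bundleNorm) x a ^ 2 =
      ∑ q : (Fin j → Fin (Module.finrank ℝ (Tan n x))) × Fin (Module.finrank ℂ (E x)),
        tenNorm bundleNorm x (a (tenFrame x q.1 (stdOrthonormalBasis ℂ (E x) q.2))) ^ 2 :=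
  Real.sq_sqrt (Finset.sum_nonneg fun _ _ => sq_nonneg _)

/-- The hermitian norm of `Hom(T*M ⊗ ⋯ ⊗ T*M ⊗ E, T*M ⊗ ⋯ ⊗ T*M ⊗ F)` bounds the operator norm. -/
theorem tenNorm_apply_sq_le {j m : ℕ} (x : M) (a : Ten n j E x →ₗ[ℂ] Ten n m F x)
    (T : Ten n j E x) : tenNorm bundleNorm x (a T) ^ 2 ≤
      coeffNorm (tenNorm bundleNorm) x a ^ 2 * tenNorm bundleNorm x T ^ 2 := by
  let b := stdOrthonormalBasis ℂ (E x)
  have hT : T = ∑ q : (Fin j → Fin (Module.finrank ℝ (Tan n x))) × Fin (Module.finrank ℂ (E x)),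
      (inner ℂ (b q.2) (T fun i => tanBasis n x (q.1 i)) : ℂ) • tenFrame x q.1 (b q.2) := by
    conv_lhs => rw [eq_sum_tenFrame x T]
    rw [Fintype.sum_prod_type]
    refine Finset.sum_congr rfl fun I _ => ?_
    conv_lhs => rw [← b.sum_repr' (T fun i => tanBasis n x (I i))]
    ext v
    rw [tenFrame_eq_pureTen, pureTen_apply, Finset.smul_sum, sum_apply]
    refine Finset.sum_congr rfl fun c _ => ?_
    rw [smul_apply, tenFrame_eq_pureTen, pureTen_apply]
    exact smul_comm _ _ _
  have h := sq_map_sum_le (N := fun S : Ten n m F x => tenNorm bundleNorm x S) (tenNorm_add_le x)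
    (tenNorm_smul x) (tenNorm_nonneg _ x) a
    (fun q : (Fin j → Fin (Module.finrank ℝ (Tan n x))) × Fin (Module.finrank ℂ (E x)) =>
      tenFrame x q.1 (b q.2))
    (fun q => (inner ℂ (b q.2) (T fun i => tanBasis n x (q.1 i)) : ℂ))
  rw [← hT, ← coeffNorm_sq, Fintype.sum_prod_type] at h
  simp only [b.sum_sq_norm_inner_right] at h
  rw [tenNorm_bundleNorm_sq x T]
  exact h

theorem coeffNorm_add_sq_le {j m : ℕ} (x : M) (a b : Ten n j E x →ₗ[ℂ] Ten n m F x) :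
    coeffNorm (tenNorm bundleNorm) x (a + b) ^ 2 ≤
      2 * (coeffNorm (tenNorm bundleNorm) x a ^ 2 + coeffNorm (tenNorm bundleNorm) x b ^ 2) := by
  simp only [coeffNorm_sq]
  rw [← Finset.sum_add_distrib, Finset.mul_sum]
  refine Finset.sum_le_sum fun q _ => ?_
  exact (pow_le_pow_left₀ (tenNorm_nonneg _ _ _) (tenNorm_add_le x _ _) 2).trans add_sq_le

theorem coeffNorm_comp_sq_le {i j m : ℕ} (x : M) (a : Ten n j E x →ₗ[ℂ] Ten n m F x)
    (b : Ten n i E x →ₗ[ℂ] Ten n j E x) :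
    coeffNorm (tenNorm bundleNorm) x (a ∘ₗ b) ^ 2 ≤
      coeffNorm (tenNorm bundleNorm) x a ^ 2 * coeffNorm (tenNorm bundleNorm) x b ^ 2 := by
  rw [coeffNorm_sq x (a ∘ₗ b), coeffNorm_sq x b, Finset.mul_sum]
  exact Finset.sum_le_sum fun q _ => tenNorm_apply_sq_le x a _

/-- The operator norm bounds the hermitian norm, up to the rank. -/
theorem coeffNorm_sq_le {j m : ℕ} (x : M) (a : Ten n j E x →ₗ[ℂ] Ten n m F x) {c : ℝ}
    (h : ∀ T : Ten n j E x, tenNorm bundleNorm x (a T) ^ 2 ≤ c * tenNorm bundleNorm x T ^ 2) :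
    coeffNorm (tenNorm bundleNorm) x a ^ 2 ≤ (n ^ j * Module.finrank ℂ (E x) : ℕ) * c := by
  rw [coeffNorm_sq]
  refine (Finset.sum_le_sum fun q _ => (h _).trans_eq ?_).trans_eq
    (b := ∑ q : (Fin j → Fin (Module.finrank ℝ (Tan n x))) × Fin (Module.finrank ℂ (E x)), c) ?_
  · rw [tenNorm_bundleNorm_sq, tenSq_tenFrame, OrthonormalBasis.norm_eq_one]
    simp
  · rw [Finset.sum_const, Finset.card_univ, Fintype.card_prod, Fintype.card_fun, Fintype.card_fin,
      Fintype.card_fin, Fintype.card_fin, finrank_tan, nsmul_eq_mul]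

end Coeff

/-- The rank of the fibres is constant, so that dimension-dependent constants are uniform on `M`. -/
theorem finrank_fibre {FE : Type*} [NormedAddCommGroup FE] [NormedSpace ℂ FE]
    [TopologicalSpace (TotalSpace FE E)] [FiberBundle FE E] [VectorBundle ℂ FE E] (x : M) :
    Module.finrank ℂ (E x) = Module.finrank ℂ FE :=
  ((trivializationAt FE E x).continuousLinearEquivAt ℂ x
    (FiberBundle.mem_baseSet_trivializationAt FE E x)).toLinearEquiv.finrank_eq

end Coefficients

/-! ### Change of the connection in differential operators -/

section TransMap

variable {T V : Type*} [AddCommGroup T] [Module ℝ T] [NormedAddCommGroup V]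
  [InnerProductSpace ℂ V]

/-- The evaluation `(a, v) ↦ a v` of endomorphisms. -/
def endApply (V : Type*) [NormedAddCommGroup V] [InnerProductSpace ℂ V] :
    (V →ₗ[ℂ] V) →ₗ[ℝ] V →ₗ[ℝ] V :=
  LinearMap.mk₂ ℝ (fun a v => a v) (by intros; simp) (by intros; simp) (by intros; simp)
    (fun r a v => (a.restrictScalars ℝ).map_smul r v)

@[simp] theorem endApply_apply {V : Type*} [NormedAddCommGroup V] [InnerProductSpace ℂ V]
    (a : V →ₗ[ℂ] V) (v : V) : endApply V a v = a v := rfl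

/-- The contribution of `∇̃ⁱ u` to `∇ʲ u = leib j C (∇̃ u)`. -/
def transMap (i j : ℕ) : Fam T (V →ₗ[ℂ] V) →ₗ[ℝ]
    (MultilinearMap ℝ (fun _ : Fin i => T) V →ₗ[ℂ] MultilinearMap ℝ (fun _ : Fin j => T) V) where
  toFun C :=
    { toFun := fun S => leib (endApply V) j C (Pi.single i S)
      map_add' := fun S S' => by rw [Pi.single_add, map_add]
      map_smul' := fun c S => by
        have h := leib_map (endApply V) (endApply V) ((LinearMap.lsmul ℂ V c).restrictScalars ℝ)
          ((LinearMap.lsmul ℂ V c).restrictScalars ℝ) (by intros; simp) j C (Pi.single i S)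
        refine Eq.trans (congrArg _ ?_) h
        rw [Pi.single_smul]
        rfl }
  map_add' C C' := by
    ext1 S
    simp only [LinearMap.coe_mk, AddHom.coe_mk, LinearMap.add_apply, map_add]
  map_smul' r C := by
    ext1 S
    simp only [LinearMap.coe_mk, AddHom.coe_mk, LinearMap.smul_apply, map_smul, RingHom.id_apply]

theorem transMap_apply (i j : ℕ) (C : Fam T (V →ₗ[ℂ] V))
    (S : MultilinearMap ℝ (fun _ : Fin i => T) V) :
    transMap i j C S = leib (endApply V) j C (Pi.single i S) := rfl

theorem leib_eq_sum_transMap {j m : ℕ} (hj : j ≤ m) (C : Fam T (V →ₗ[ℂ] V)) (U : Fam T V) :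
    leib (endApply V) j C U = ∑ i ∈ Finset.range (m + 1), transMap i j C (U i) := by
  simp only [transMap_apply]
  rw [← map_sum]
  refine leib_congr _ j (fun _ _ => rfl) fun i hi => ?_
  rw [Finset.sum_apply, Finset.sum_pi_single, if_pos (Finset.mem_range.2 (by omega))]

variable {ι : Type*} [Fintype ι] (e : ι → T)

theorem tenSq_transMap_le [FiniteDimensional ℂ V] (i j : ℕ) (C : Fam T (V →ₗ[ℂ] V))
    (S : MultilinearMap ℝ (fun _ : Fin i => T) V) :
    tenSq e (fun v => ‖v‖ ^ 2) (transMap i j C S) ≤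
      4 ^ j * (∑ s ∈ Finset.range (j + 1), tenSq e opSq (C s)) *
        tenSq e (fun v => ‖v‖ ^ 2) S := by
  have hV : ∀ v : V, (0 : ℝ) ≤ ‖v‖ ^ 2 := fun v => sq_nonneg _
  rw [transMap_apply]
  refine (tenSq_leib_le e opSq_nonneg hV norm_add_sq_le norm_sq_apply_le_opSq j C _).trans ?_
  have h0 := sum_tenSq_nonneg e opSq_nonneg C (j + 1)
  gcongr
  have h : ∀ s, tenSq e (fun v => ‖v‖ ^ 2) ((Pi.single i S : Fam T V) s) =
      if s = i then tenSq e (fun v => ‖v‖ ^ 2) S else 0 := by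
    intro s
    rcases eq_or_ne s i with rfl | hs
    · simp
    · rw [Pi.single_eq_of_ne hs, if_neg hs]
      simp [tenSq]
  simp only [h, Finset.sum_ite_eq']
  split_ifs
  · exact le_rfl
  · exact tenSq_nonneg e hV S

/-- The composition of complex linear maps, as a real bilinear map. -/
def compBilin (V₁ V₂ V₃ : Type*) [AddCommGroup V₁] [Module ℂ V₁] [AddCommGroup V₂] [Module ℂ V₂]
    [AddCommGroup V₃] [Module ℂ V₃] [Module ℝ V₂] [Module ℝ V₃] [IsScalarTower ℝ ℂ V₂]
    [IsScalarTower ℝ ℂ V₃] :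
    (V₂ →ₗ[ℂ] V₃) →ₗ[ℝ] (V₁ →ₗ[ℂ] V₂) →ₗ[ℝ] (V₁ →ₗ[ℂ] V₃) :=
  LinearMap.mk₂ ℝ (fun a b => a ∘ₗ b) (by intros; ext; simp) (by intros; ext; simp)
    (by intros; ext; simp) (by intros; ext; simp)

end TransMap

section ChangeConn

variable {n : ℕ} {M : Type*} [TopologicalSpace M] [ChartedSpace (EuclideanSpace ℝ (Fin n)) M]
  [IsManifold (𝓡 n) ∞ M] [T2Space M]
  {D : CovariantDerivative (𝓡 n) (EuclideanSpace ℝ (Fin n)) (fun x : M => TangentSpace (𝓡 n) x)}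

section General

variable {H V : M → Type*} [∀ x, AddCommGroup (H x)] [∀ x, Module ℝ (H x)]
  [∀ x, AddCommGroup (V x)] [∀ x, Module ℝ (V x)]
  {RH : (Π x, H x) → (Π x : M, Tan n x → H x) → Prop}
  {RV : (Π x, V x) → (Π x : M, Tan n x → V x) → Prop}

/-- The sequence of all iterated derivatives, as one section. -/
theorem iteratedDeriv_shiftN {b : Π x, H x} {B} (h : IteratedDeriv D RH b B) :
    IteratedDeriv D (fun (C : Π x, Fam (Tan n x) (H x)) C' =>
        ∀ j, tenDeriv D RH j (fun x => C x j) (fun x v => C' x v j)) (fun x j => B j x)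
      (fun r x => shiftN r (fun j => B j x)) := by
  refine ⟨fun x => rfl, fun r => ?_⟩
  refine rel_congr (tenDeriv_shiftN r h.2) rfl ?_
  funext x v
  exact shiftN_succ_curryLeft r _ v

theorem IteratedDeriv.sum (hzero : RV (fun _ => 0) fun _ _ => 0)
    (hadd : ∀ {s s' t t'}, RV s s' → RV t t' →
      RV (fun x => s x + t x) (fun x v => s' x v + t' x v)) (u : Finset ℕ) {s : ℕ → Π x, V x}
    {S : ℕ → ∀ k, Π x, Ten n k V x} (h : ∀ j ∈ u, IteratedDeriv D RV (s j) (S j)) :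
    IteratedDeriv D RV (fun x => ∑ j ∈ u, s j x) (fun k x => ∑ j ∈ u, S j k x) := by
  induction u using Finset.induction_on with
  | empty =>
    refine ⟨fun x => ?_, fun k Y hY => ?_⟩
    · ext; simp
    · refine rel_congr hzero ?_ ?_
      · funext x; simp
      · funext x v; simp
  | insert a u ha ih =>
    have h1 := h a (Finset.mem_insert_self a u)
    have h2 := ih fun j hj => h j (Finset.mem_insert_of_mem hj)
    refine ⟨fun x => ?_, fun k Y hY => ?_⟩
    · have h3 := h2.1 x
      simp only at h3
      simp only [Finset.sum_insert ha, h1.1, h3]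
      ext; simp
    · refine rel_congr (hadd (h1.2 k Y hY) (h2.2 k Y hY)) ?_ ?_
      · funext x; simp only [Finset.sum_insert ha, add_apply]
      · funext x v
        simp only [Finset.sum_insert ha, curryLeft_add', add_apply, Finset.sum_add_distrib]
        abel

end General

variable {FE : Type*} [NormedAddCommGroup FE] [NormedSpace ℂ FE]
  {E : M → Type*} [TopologicalSpace (TotalSpace FE E)] [∀ x, NormedAddCommGroup (E x)]
  [∀ x, InnerProductSpace ℂ (E x)] [FiberBundle FE E] [VectorBundle ℂ FE E] [VectorBundle ℝ FE E]
  [ContMDiffVectorBundle ∞ FE E (𝓡 n)] [FiniteDimensional ℂ FE]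
  {cov₁ cov₂ : CovariantDerivative (𝓡 n) FE E}

/-- The derivative of the section `transMap i j C` is `transMap i j` of the derivatives of `C`. -/
theorem homDeriv_transMap (hD : IsSmoothConn D) (h₁ : IsComplexConn cov₁)
    (h₂ : IsComplexConn cov₂) (i j : ℕ)
    {C : Π x, Fam (Tan n x) (E x →ₗ[ℂ] E x)}
    {C' : Π x : M, Tan n x → Fam (Tan n x) (E x →ₗ[ℂ] E x)}
    (hC : ∀ j, tenDeriv D (homDeriv (bundleDeriv cov₂) (bundleDeriv cov₁)) j (fun x => C x j)
      (fun x v => C' x v j)) :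
    homDeriv (tenDeriv D (bundleDeriv cov₂) i) (tenDeriv D (bundleDeriv cov₁) j)
      (fun x => transMap i j (C x)) (fun x v => transMap i j (C' x v)) := by
  intro T T' hT
  have h3 : ∀ s, tenDeriv D (bundleDeriv cov₂) s (fun x => (Pi.single i (T x) : Fam _ _) s)
      (fun x v => (Pi.single i (T' x v) : Fam _ _) s) := by
    intro s
    rcases eq_or_ne s i with rfl | hs
    · simpa using hT
    · simp only [Pi.single_eq_of_ne hs]
      exact (isConnRel_tenDeriv hD (isFrameRel_bundleDeriv h₂).toIsConnRel s).zero
  exact tenDeriv_leib (RW := bundleDeriv cov₁) (β := fun x => endApply (E x))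
    (isFrameRel_bundleDeriv h₁).add (fun {b b' u u'} hb hu => hb u u' hu) j (fun s _ => hC s)
    fun s _ => h3 s

theorem exists_forall_sum_le {X : Type*} (u : Finset ℕ) {f : ℕ → X → ℝ}
    (h : ∀ j ∈ u, ∃ c : ℝ, ∀ x, f j x ≤ c) : ∃ c : ℝ, ∀ x, ∑ j ∈ u, f j x ≤ c := by
  choose! c hc using h
  exact ⟨∑ j ∈ u, c j, fun x => Finset.sum_le_sum fun j hj => hc j hj x⟩

variable [RiemannianBundle (fun x : M => TangentSpace (𝓡 n) x)] [∀ x, FiniteDimensional ℂ (E x)]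
  {FF : Type*} [NormedAddCommGroup FF] [NormedSpace ℂ FF]
  {F : M → Type*} [TopologicalSpace (TotalSpace FF F)] [∀ x, NormedAddCommGroup (F x)]
  [∀ x, InnerProductSpace ℂ (F x)] [FiberBundle FF F] [VectorBundle ℂ FF F] [VectorBundle ℝ FF F]
  [ContMDiffVectorBundle ∞ FF F (𝓡 n)] [FiniteDimensional ℂ FF]
  {covF : CovariantDerivative (𝓡 n) FF F}

theorem exists_tenSq_transMap_le {C : ∀ k, Π x, Ten n k (fun x : M => E x →ₗ[ℂ] E x) x}
    (hC : ∀ k, ∃ c : ℝ, ∀ x, tenSq (tanBasis n x) opSq (C k x) ≤ c) {d : ℕ}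
    (hd : ∀ x, Module.finrank ℂ (E x) = d) (i j r : ℕ) :
    ∃ c : ℝ, ∀ x, tenSq (tanBasis n x)
      (fun a : Ten n i E x →ₗ[ℂ] Ten n j E x => coeffNorm (tenNorm bundleNorm) x a ^ 2)
      ((transMap i j).compMultilinearMap (shiftN r fun s => C s x)) ≤ c := by
  obtain ⟨c, hc⟩ := exists_forall_sum_le (Finset.range (j + 1)) fun s _ => hC (s + r)
  refine ⟨(n ^ i * d : ℕ) * 4 ^ j * c, fun x => ?_⟩
  have h1 : ∀ C' : Fam (Tan n x) (E x →ₗ[ℂ] E x),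
      coeffNorm (tenNorm bundleNorm) x (transMap i j C' : Ten n i E x →ₗ[ℂ] Ten n j E x) ^ 2 ≤
      ((n ^ i * d : ℕ) * 4 ^ j) *
        ∑ s ∈ Finset.range (j + 1), tenSq (tanBasis n x) opSq (C' s) := by
    intro C'
    rw [← hd x, mul_assoc]
    refine coeffNorm_sq_le x _ fun S => ?_
    rw [tenNorm_bundleNorm_sq, tenNorm_bundleNorm_sq]
    exact tenSq_transMap_le _ i j C' S
  refine (tenSq_mono (tanBasis n x) h1 (shiftN r fun s => C s x)).trans ?_
  rw [tenSq_finset_sum]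
  simp only [tenSq_shiftN]
  exact mul_le_mul_of_nonneg_left (hc x) (by positivity)

theorem exists_tenSq_sum_le {V : M → Type*} [∀ x, AddCommGroup (V x)] [∀ x, Module ℝ (V x)]
    {q : ∀ x, V x → ℝ} (h0 : ∀ x, q x 0 = 0)
    (hadd : ∀ x v w, q x (v + w) ≤ 2 * (q x v + q x w)) (u : Finset ℕ) {k : ℕ}
    {S : ℕ → Π x, Ten n k V x} (h : ∀ j ∈ u, ∃ c : ℝ, ∀ x, tenSq (tanBasis n x) (q x) (S j x) ≤ c) :
    ∃ c : ℝ, ∀ x, tenSq (tanBasis n x) (q x) (∑ j ∈ u, S j x) ≤ c := by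
  induction u using Finset.induction_on with
  | empty => exact ⟨0, fun x => by simp [tenSq, h0]⟩
  | insert a u ha ih =>
    obtain ⟨c, hc⟩ := h a (Finset.mem_insert_self a u)
    obtain ⟨c', hc'⟩ := ih fun j hj => h j (Finset.mem_insert_of_mem hj)
    refine ⟨2 * (c + c'), fun x => ?_⟩
    rw [Finset.sum_insert ha]
    refine (tenSq_add_le _ (hadd x) _ _).trans ?_
    linarith [hc x, hc' x]

/-- The Leibniz rule preserves boundedness of all derivatives. -/
theorem exists_tenSq_leib_le {H V W : M → Type*} [∀ x, AddCommGroup (H x)] [∀ x, Module ℝ (H x)]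
    [∀ x, AddCommGroup (V x)] [∀ x, Module ℝ (V x)] [∀ x, AddCommGroup (W x)]
    [∀ x, Module ℝ (W x)] {β : ∀ x, H x →ₗ[ℝ] V x →ₗ[ℝ] W x} {qH : ∀ x, H x → ℝ}
    {qV : ∀ x, V x → ℝ} {qW : ∀ x, W x → ℝ} (hH : ∀ x b, 0 ≤ qH x b) (hV : ∀ x u, 0 ≤ qV x u)
    (hW : ∀ x v w, qW x (v + w) ≤ 2 * (qW x v + qW x w))
    (hβ : ∀ x b u, qW x (β x b u) ≤ qH x b * qV x u) {B : ∀ k, Π x, Ten n k H x}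
    {U : ∀ k, Π x, Ten n k V x}
    (hB : ∀ r, ∃ c : ℝ, ∀ x, tenSq (tanBasis n x) (qH x) (B r x) ≤ c)
    (hU : ∀ r, ∃ c : ℝ, ∀ x, tenSq (tanBasis n x) (qV x) (U r x) ≤ c) (k : ℕ) :
    ∃ c : ℝ, ∀ x, tenSq (tanBasis n x) (qW x)
      (leib (β x) k (fun r => B r x) (fun r => U r x)) ≤ c := by
  obtain ⟨c₁, hc₁⟩ := exists_forall_sum_le (Finset.range (k + 1)) fun r _ => hB r
  obtain ⟨c₂, hc₂⟩ := exists_forall_sum_le (Finset.range (k + 1)) fun r _ => hU r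
  refine ⟨4 ^ k * c₁ * c₂, fun x => ?_⟩
  refine (tenSq_leib_le (tanBasis n x) (hH x) (hV x) (hW x) (hβ x) k _ _).trans ?_
  have h5 := sum_tenSq_nonneg (tanBasis n x) (hH x) (fun r => B r x) (k + 1)
  have h6 := sum_tenSq_nonneg (tanBasis n x) (hV x) (fun r => U r x) (k + 1)
  have h7 := h5.trans (hc₁ x)
  gcongr
  · exact hc₁ x
  · exact hc₂ x

theorem coeffNorm_zero {j m : ℕ} (x : M) :
    coeffNorm (tenNorm bundleNorm) x (0 : Ten n j E x →ₗ[ℂ] Ten n m F x) ^ 2 = 0 := by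
  have h0 := tenNorm_smul (n := n) (E := F) (k := m) x 0 0
  rw [zero_smul, norm_zero, zero_mul] at h0
  simp [coeffNorm_sq, h0]

/-- The derivatives of the coefficients of a differential operator after a change of the connection
are given by the Leibniz rule for compositions. -/
theorem iteratedDeriv_sum_comp_transMap (hD : IsSmoothConn D) (h₁ : IsComplexConn cov₁)
    (h₂ : IsComplexConn cov₂) (hF : IsComplexConn covF) {C}
    (hC : IteratedDeriv D (homDeriv (bundleDeriv cov₂) (bundleDeriv cov₁))
      (fun _ => LinearMap.id) C) {μ m : ℕ} {a : ∀ j, Π x, Ten n j E x →ₗ[ℂ] Ten n m F x}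
    {S : ∀ j k, Π x, Ten n k (fun x => Ten n j E x →ₗ[ℂ] Ten n m F x) x}
    (hS : ∀ j ≤ μ, IteratedDeriv D
      (homDeriv (tenDeriv D (bundleDeriv cov₁) j) (tenDeriv D (bundleDeriv covF) m)) (a j) (S j))
    (i : ℕ) :
    IteratedDeriv D (homDeriv (tenDeriv D (bundleDeriv cov₂) i) (tenDeriv D (bundleDeriv covF) m))
      (fun x => ∑ j ∈ Finset.range (μ + 1), (a j x) ∘ₗ (transMap i j fun s => C s x))
      (fun k x => ∑ j ∈ Finset.range (μ + 1),
        leib (compBilin (Ten n i E x) (Ten n j E x) (Ten n m F x)) k (fun r => S j r x)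
          (fun r => (transMap i j).compMultilinearMap (shiftN r fun s => C s x))) := by
  have hFm := isConnRel_tenDeriv hD (isFrameRel_bundleDeriv hF).toIsConnRel m
  have hadd : ∀ {s s' t t'}, homDeriv (tenDeriv D (bundleDeriv cov₂) i)
      (tenDeriv D (bundleDeriv covF) m) s s' →
      homDeriv (tenDeriv D (bundleDeriv cov₂) i) (tenDeriv D (bundleDeriv covF) m) t t' →
      homDeriv (tenDeriv D (bundleDeriv cov₂) i) (tenDeriv D (bundleDeriv covF) m)
        (fun x => s x + t x) (fun x v => s' x v + t' x v) := by
    intro s s' t t' hs ht w w' hw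
    refine rel_congr (hFm.add (hs w w' hw) (ht w w' hw)) rfl ?_
    funext x v
    simp only [LinearMap.add_apply]
    abel
  refine IteratedDeriv.sum (fun w w' hw => by simpa using hFm.zero) hadd _ fun j hj => ?_
  have h3 := (iteratedDeriv_shiftN hC).map (fun x => transMap i j)
    (fun c c' hc => homDeriv_transMap hD h₁ h₂ i j hc)
  exact IteratedDeriv.leib (β := fun x => compBilin (Ten n i E x) (Ten n j E x) (Ten n m F x))
    hadd homDeriv_comp (hS j (Nat.lt_succ_iff.1 (Finset.mem_range.1 hj))) h3

theorem exists_tenSq_sum_comp_transMap_le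
    {C : ∀ k, Π x, Ten n k (fun x : M => E x →ₗ[ℂ] E x) x}
    (hCb : ∀ k, ∃ c : ℝ, ∀ x, tenSq (tanBasis n x) opSq (C k x) ≤ c) {d : ℕ}
    (hd : ∀ x, Module.finrank ℂ (E x) = d) {μ m : ℕ}
    {S : ∀ j k, Π x, Ten n k (fun x => Ten n j E x →ₗ[ℂ] Ten n m F x) x}
    (hS : ∀ j ≤ μ, ∀ r, ∃ c : ℝ, ∀ x, tenSq (tanBasis n x)
      (fun b : Ten n j E x →ₗ[ℂ] Ten n m F x => coeffNorm (tenNorm bundleNorm) x b ^ 2)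
      (S j r x) ≤ c) (i k : ℕ) :
    ∃ c : ℝ, ∀ x, tenSq (tanBasis n x)
      (fun b : Ten n i E x →ₗ[ℂ] Ten n m F x => coeffNorm (tenNorm bundleNorm) x b ^ 2)
      (∑ j ∈ Finset.range (μ + 1),
        leib (compBilin (Ten n i E x) (Ten n j E x) (Ten n m F x)) k (fun r => S j r x)
          (fun r => (transMap i j).compMultilinearMap (shiftN r fun s => C s x))) ≤ c := by
  refine exists_tenSq_sum_le
    (q := fun x (a : Ten n i E x →ₗ[ℂ] Ten n m F x) => coeffNorm (tenNorm bundleNorm) x a ^ 2)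
    coeffNorm_zero (fun x => coeffNorm_add_sq_le x) _ fun j hj => ?_
  have hj' := Nat.lt_succ_iff.1 (Finset.mem_range.1 hj)
  exact exists_tenSq_leib_le
    (β := fun x => compBilin (Ten n i E x) (Ten n j E x) (Ten n m F x))
    (qH := fun x (a : Ten n j E x →ₗ[ℂ] Ten n m F x) => coeffNorm (tenNorm bundleNorm) x a ^ 2)
    (qV := fun x (a : Ten n i E x →ₗ[ℂ] Ten n j E x) => coeffNorm (tenNorm bundleNorm) x a ^ 2)
    (qW := fun x (a : Ten n i E x →ₗ[ℂ] Ten n m F x) => coeffNorm (tenNorm bundleNorm) x a ^ 2)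
    (fun _ _ => sq_nonneg _) (fun _ _ => sq_nonneg _) (fun x => coeffNorm_add_sq_le x)
    (fun x a b => coeffNorm_comp_sq_le x a b) (hS j hj')
    (exists_tenSq_transMap_le hCb hd i j) k

/-- If the transition from `∇₂` to `∇₁` is bounded with all derivatives, the operators with bounded
coefficients for `∇₁` have bounded coefficients for `∇₂`. -/
theorem diffB_subset (hD : IsSmoothConn D) (h₁ : IsComplexConn cov₁) (h₂ : IsComplexConn cov₂)
    (hF : IsComplexConn covF) {C}
    (hC : IteratedDeriv D (homDeriv (bundleDeriv cov₂) (bundleDeriv cov₁))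
      (fun _ => LinearMap.id) C)
    (hCb : ∀ k, ∃ c : ℝ, ∀ x, tenSq (tanBasis n x) opSq (C k x) ≤ c) (μ m : ℕ) :
    DiffB D cov₁ covF μ m ⊆ DiffB D cov₂ covF μ m := by
  rintro P ⟨a, ha, hP⟩
  choose! S hS hSb using ha
  refine ⟨fun i x => ∑ j ∈ Finset.range (μ + 1), (a j x) ∘ₗ (transMap i j fun s => C s x),
    fun i _ => ⟨_, iteratedDeriv_sum_comp_transMap hD h₁ h₂ hF hC hS i, fun k => ?_⟩, fun u => ?_⟩
  · rw [exists_tenNorm_le_iff]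
    exact exists_tenSq_sum_comp_transMap_le hCb (fun x => finrank_fibre (FE := FE) (E := E) x)
      (fun j hj r => (exists_tenNorm_le_iff (fun x (b : Ten n j E x →ₗ[ℂ] Ten n m F x) =>
        coeffNorm (tenNorm bundleNorm) x b) (S j r)).1 (hSb j hj r)) i k
  · obtain ⟨U, hU, hPU⟩ := hP u
    obtain ⟨V, hV⟩ := exists_iteratedDeriv hD (isFrameRel_bundleDeriv h₂).toIsConnRel
      (s := u.1) ⟨u.2.1, fun _ _ => rfl⟩
    refine ⟨V, hV, fun x => ?_⟩
    have h3 := IteratedDeriv.leib (RW := bundleDeriv cov₁) (β := fun x => endApply (E x))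
      (isFrameRel_bundleDeriv h₁).add (fun {b b' u u'} hb hu => hb u u' hu) hC hV
    have h4 : U = _ := IteratedDeriv.unique (R := bundleDeriv cov₁) hD
      (isFrameRel_bundleDeriv h₁).unique hU h3
    rw [hPU, h4]
    simp only [LinearMap.sum_apply, LinearMap.comp_apply]
    rw [Finset.sum_comm]
    refine Finset.sum_congr rfl fun j hj => ?_
    rw [leib_eq_sum_transMap (Nat.lt_succ_iff.1 (Finset.mem_range.1 hj)), map_sum]

/-- Bounded geometry of the difference form: the operators with bounded coefficients agree. -/
theorem diffB_eq (hD : IsSmoothConn D) {cov : CovariantDerivative (𝓡 n) FE E}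
    (h : IsComplexConn cov) (hF : IsComplexConn covF)
    {A : Π x, Ten n 1 (fun x : M => E x →ₗ[ℂ] E x) x} (hA : SmoothOneForm FE A)
    (hb : TotallyBoundedForm D cov A) (μ m : ℕ) :
    DiffB D cov covF μ m = DiffB D (addForm cov A) covF μ m := by
  obtain ⟨S, hS, hSb⟩ := hb
  choose c hc using hSb
  have key : ∀ {C : ∀ k, Π x, Ten n k (fun x : M => E x →ₗ[ℂ] E x) x},
      (∀ x l K, (∀ j < l, tenNorm (tenNorm endNorm) x (S j x) ≤ K) →
        ∑ j ∈ Finset.range (l + 1), tenSq (tanBasis n x) opSq (C j x) ≤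
          transBound 1 (K ^ 2) l) →
      ∀ k, ∃ c : ℝ, ∀ x, tenSq (tanBasis n x) opSq (C k x) ≤ c := by
    intro C hC k
    refine ⟨transBound 1 ((∑ j ∈ Finset.range k, |c j|) ^ 2) k, fun x => ?_⟩
    refine le_trans ?_ (hC x k _ fun j hj => ?_)
    · exact Finset.single_le_sum (f := fun j => tenSq (tanBasis n x) opSq (C j x))
        (fun _ _ => tenSq_nonneg _ opSq_nonneg _) (Finset.self_mem_range_succ k)
    · exact ((hc j x).trans (le_abs_self _)).trans (Finset.single_le_sum (f := fun j => |c j|)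
        (fun _ _ => abs_nonneg _) (Finset.mem_range.2 hj))
  obtain ⟨C, hC, hCb⟩ := exists_transition_bound hD h hA hS (Or.inl ⟨rfl, rfl⟩)
  obtain ⟨C', hC', hCb'⟩ := exists_transition_bound hD h hA hS (Or.inr ⟨rfl, rfl⟩)
  exact (diffB_subset hD h (h.addForm hA) hF hC (key hCb) μ m).antisymm
    (diffB_subset hD (h.addForm hA) h hF hC' (key hCb') μ m)

end ChangeConn

/-! ### Sections with prescribed jets -/

section Jets

variable {n : ℕ} {M : Type*} [TopologicalSpace M] [ChartedSpace (EuclideanSpace ℝ (Fin n)) M]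
  [IsManifold (𝓡 n) ∞ M] [T2Space M]
  {D : CovariantDerivative (𝓡 n) (EuclideanSpace ℝ (Fin n)) (fun x : M => TangentSpace (𝓡 n) x)}

section General

variable {V : M → Type*} [∀ x, AddCommGroup (V x)] [∀ x, Module ℝ (V x)]
  {R : (Π x, V x) → (Π x : M, Tan n x → V x) → Prop}

variable [RiemannianBundle (fun x : M => TangentSpace (𝓡 n) x)]

/-- Bounded parallel sections are totally bounded. -/
theorem isTotallyBounded_of_parallel {N : ∀ x, V x → ℝ} (hzero : R (fun _ => 0) fun _ _ => 0)
    {s : Π x, V x} (hs : R s fun _ _ => 0) (hN : ∀ x, N x 0 ^ 2 = 0) {c : ℝ}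
    (hc : ∀ x, N x (s x) ^ 2 ≤ c) : IsTotallyBounded D R N s := by
  let S : ∀ k, Π x, Ten n k V x := fun k =>
    Nat.rec (fun x => ten0 n (s x)) (fun _ _ _ => 0) k
  refine ⟨S, ⟨fun x => rfl, fun k => ?_⟩, fun k => ?_⟩
  · cases k with
    | zero => exact tenDeriv_zero_iff.2 hs
    | succ k =>
      intro Y hY
      refine rel_congr hzero rfl ?_
      funext x v
      simp [S]
  · cases k with
    | zero =>
      refine (exists_tenNorm_le_iff N _).2 ⟨c, fun x => ?_⟩
      rw [tenSq_zero]
      exact hc x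
    | succ k =>
      refine (exists_tenNorm_le_iff N _).2 ⟨0, fun x => ?_⟩
      simp [S, tenSq, hN]

end General

variable {FE : Type*} [NormedAddCommGroup FE] [NormedSpace ℂ FE]
  {E : M → Type*} [TopologicalSpace (TotalSpace FE E)] [∀ x, NormedAddCommGroup (E x)]
  [∀ x, InnerProductSpace ℂ (E x)] [FiberBundle FE E] [VectorBundle ℂ FE E] [VectorBundle ℝ FE E]
  [ContMDiffVectorBundle ∞ FE E (𝓡 n)] [FiniteDimensional ℂ FE]

/-- The product of `k` functions which vanish at `x`, with differentials `ξ`, and a section with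
value `e` at `x`: its derivatives of order less than `k` vanish at `x`, and the one of order `k` is
the symmetrization of `ξ₁ ⊗ ⋯ ⊗ ξ_k ⊗ e`, whichever connection is used. -/
theorem exists_testSection_jet (hD : IsSmoothConn D) (x : M) (k : ℕ) :
    ∀ (ξ : Fin k → Tan n x →ₗ[ℝ] ℝ) (e : E x), ∃ u : TestSection n FE E,
      ∀ (cov : CovariantDerivative (𝓡 n) FE E), IsComplexConn cov → ∀ U,
        IteratedDeriv D (bundleDeriv cov) u.1 U →
          (∀ j < k, U j x = 0) ∧ U k x = symR k (pureTen ξ e) := by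
  have : FiniteDimensional ℝ FE := FiniteDimensional.complexToReal FE
  induction k with
  | zero =>
    intro ξ e
    obtain ⟨ext, h1, h2, h3⟩ := exists_linear_extension (n := n) (F := FE) (V := E) x
    refine ⟨⟨ext e, h1 e, h3 e⟩, fun cov h U hU => ⟨fun j hj => absurd hj (Nat.not_lt_zero j), ?_⟩⟩
    rw [hU.1]
    ext w
    simp [symR, h2]
  | succ k ih =>
    intro ξ e
    obtain ⟨v, hv⟩ := ih (fun i => ξ i.succ) e
    obtain ⟨f, hf, hfx, hdf⟩ := exists_smoothFun_mvfderiv (n := n) x (ξ 0)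
    refine ⟨⟨fun y => f y • v.1 y, hf.smul_section v.2.1, ?_⟩, fun cov h U hU => ?_⟩
    · refine v.2.2.of_isClosed_subset isClosed_closure (closure_mono fun y hy h0 => hy ?_)
      change f y • v.1 y = 0
      rw [show v.1 y = 0 from h0, smul_zero]
    · have hR := isFrameRel_bundleDeriv h
      -- multiplication by `f`, as an endomorphism field
      have hb : homDeriv (bundleDeriv cov) (bundleDeriv cov)
          (fun y => f y • (LinearMap.id : E y →ₗ[ℂ] E y))
          (fun y w => mvfderiv (𝓡 n) f y w • (LinearMap.id : E y →ₗ[ℂ] E y)) :=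
        fun s s' hs => hR.smul hf hs
      obtain ⟨B, hB⟩ := exists_iteratedDeriv hD (isConnRel_homDeriv h h) hb
      obtain ⟨V, hV⟩ := exists_iteratedDeriv hD hR.toIsConnRel (s := v.1)
        ⟨v.2.1, fun _ _ => rfl⟩
      obtain ⟨hV0, hVk⟩ := hv cov h V hV
      have h3 := IteratedDeriv.leib (RW := bundleDeriv cov) (β := fun y => endApply (E y))
        hR.add (fun {b b' u u'} hb hu => hb u u' hu) hB hV
      have h4 : U = _ := IteratedDeriv.unique (R := bundleDeriv cov) hD hR.unique hU h3
      have hB0 : B 0 x = 0 := by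
        refine (hB.1 x).trans ?_
        simp only [hfx, zero_smul]
        rfl
      rw [h4]
      refine ⟨fun j hj => ?_, ?_⟩
      · rcases (Nat.lt_succ_iff.1 hj).lt_or_eq with hj | rfl
        · exact leib_eq_zero_right_of_lt _ j _ hj hV0
        · dsimp only
          rw [leib_eq_bot (endApply (E x)) j _ hV0, hB0]
          ext; simp
      · ext w
        dsimp only
        rw [leib_succ_of_vanish (endApply (E x)) k hB0 hV0, symR_succ_apply]
        refine Finset.sum_congr rfl fun i _ => ?_
        rw [hB.one_apply (R := homDeriv (bundleDeriv cov) (bundleDeriv cov))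
          (isConnRel_homDeriv h h).unique hb, hVk, pureTen_succ_curryLeft,
          map_smul (symR k), smul_apply, hdf]
        simp

/-- Every tensor at a point is the value of a differentiable tensor field. -/
theorem exists_tenDeriv_eq {cov : CovariantDerivative (𝓡 n) FE E} (hD : IsSmoothConn D)
    (h : IsComplexConn cov) {x : M} {k : ℕ} (T₀ : Ten n k E x) :
    ∃ T T', tenDeriv D (bundleDeriv cov) k T T' ∧ T x = T₀ := by
  have hR := isFrameRel_bundleDeriv h
  obtain ⟨ext, hext, hx⟩ := hR.exists_ext x
  choose e' he' using hext
  obtain ⟨U, Z, θ, hxU, hZ⟩ := exists_cutFrame (n := n) (F := EuclideanSpace ℝ (Fin n))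
    (V := fun x : M => TangentSpace (𝓡 n) x) x
  let T : Π y, Ten n k E y := fun y => ∑ I : Fin k → _,
    pureTen (fun i => θ (I i) y) (ext (T₀ fun i => Z (I i) x) y)
  obtain ⟨T', hT'⟩ := exists_tenDeriv hD hR.toIsConnRel k T fun Y hY => by
    have h1 := fun I : Fin k → Fin (Module.finrank ℝ (EuclideanSpace ℝ (Fin n))) =>
      hR.smul (f := fun y => ∏ i, θ (I i) y (Y i y))
        (contMDiff_finsetProd fun i _ => hZ.smooth_coeff (I i) (Y i) (hY i))
        (he' (T₀ fun i => Z (I i) x))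
    refine ⟨_, rel_congr (hR.toIsConnRel.sum Finset.univ fun I _ => h1 I) ?_ rfl⟩
    funext y
    simp [T]
  refine ⟨T, T', hT', ?_⟩
  ext v
  have h2 : v = fun i => ∑ a, θ a x (v i) • Z a x := funext fun i => hZ.expand x hxU (v i)
  conv_rhs => rw [h2, MultilinearMap.map_sum]
  simp only [MultilinearMap.map_smul_univ]
  simp [T, hx]

end Jets

/-! ### Symmetrization of coefficients -/

section Symmetrize

variable {T V : Type*} [AddCommGroup T] [Module ℝ T] [NormedAddCommGroup V]
  [InnerProductSpace ℂ V]

/-- Symmetrization of tensors with values in a complex vector space, as a complex linear map. -/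
def symC (k : ℕ) : MultilinearMap ℝ (fun _ : Fin k => T) V →ₗ[ℂ]
    MultilinearMap ℝ (fun _ : Fin k => T) V where
  toFun S := symR k S
  map_add' := map_add _
  map_smul' c S :=
    symR_compMultilinearMap ((LinearMap.lsmul ℂ V c).restrictScalars ℝ) k S

theorem symC_apply (k : ℕ) (S : MultilinearMap ℝ (fun _ : Fin k => T) V) :
    symC k S = symR k S := rfl

/-- Composition from the right with the symmetrization. -/
def compSym (k : ℕ) (W : Type*) [AddCommGroup W] [Module ℂ W] [Module ℝ W] [IsScalarTower ℝ ℂ W] :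
    (MultilinearMap ℝ (fun _ : Fin k => T) V →ₗ[ℂ] W) →ₗ[ℝ]
      (MultilinearMap ℝ (fun _ : Fin k => T) V →ₗ[ℂ] W) where
  toFun a := a ∘ₗ symC k
  map_add' _ _ := rfl
  map_smul' _ _ := rfl

/-- The endomorphism `T ↦ c (sym T)` of the space of tensors. -/
def endSym (k : ℕ) : (V →ₗ[ℂ] V) →ₗ[ℝ] (MultilinearMap ℝ (fun _ : Fin k => T) V →ₗ[ℂ]
    MultilinearMap ℝ (fun _ : Fin k => T) V) where
  toFun c :=
    { toFun := fun S => (c.restrictScalars ℝ).compMultilinearMap (symC k S)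
      map_add' := fun S S' => by ext; simp
      map_smul' := fun z S => by ext; simp }
  map_add' _ _ := rfl
  map_smul' _ _ := rfl

/-- The endomorphism `c` is read off from `a` at the symmetric tensors `ξ ⊗ ⋯ ⊗ ξ ⊗ e`. -/
theorem map_pureTen_const_of_compSym_eq {k : ℕ} {a : MultilinearMap ℝ (fun _ : Fin k => T) V →ₗ[ℂ]
    MultilinearMap ℝ (fun _ : Fin k => T) V} {c : V →ₗ[ℂ] V} (h : compSym k _ a = endSym k c)
    (ξ : T →ₗ[ℝ] ℝ) (e : V) :
    a (pureTen (fun _ => ξ) e) = pureTen (fun _ => ξ) (c e) := by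
  have h1 : a (symR k (pureTen (fun _ => ξ) e)) =
      (c.restrictScalars ℝ).compMultilinearMap (symR k (pureTen (fun _ => ξ) e)) :=
    LinearMap.congr_fun h _
  rw [symR_pureTen_const] at h1
  have h2 : (k.factorial : ℝ) • a (pureTen (fun _ => ξ) e) =
      (k.factorial : ℝ) • pureTen (fun _ => ξ) (c e) := by
    refine (((a.restrictScalars ℝ).map_smul _ _).symm.trans h1).trans ?_
    ext v
    simp
  exact smul_right_injective _ (Nat.cast_ne_zero.2 k.factorial_ne_zero) h2

end Symmetrize

/-! ### Boundedness of the form from the differential operators -/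

section Converse

variable {n : ℕ} {M : Type*} [TopologicalSpace M] [ChartedSpace (EuclideanSpace ℝ (Fin n)) M]
  [IsManifold (𝓡 n) ∞ M] [T2Space M]
  {D : CovariantDerivative (𝓡 n) (EuclideanSpace ℝ (Fin n)) (fun x : M => TangentSpace (𝓡 n) x)}
  {FE : Type*} [NormedAddCommGroup FE] [NormedSpace ℂ FE]
  {E : M → Type*} [TopologicalSpace (TotalSpace FE E)] [∀ x, NormedAddCommGroup (E x)]
  [∀ x, InnerProductSpace ℂ (E x)] [FiberBundle FE E] [VectorBundle ℂ FE E] [VectorBundle ℝ FE E]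
  [ContMDiffVectorBundle ∞ FE E (𝓡 n)] [FiniteDimensional ℂ FE]
  {cov cov₁ cov₂ : CovariantDerivative (𝓡 n) FE E}

theorem homDeriv_tenDeriv_unique (hD : IsSmoothConn D) (h₁ : IsComplexConn cov₁)
    (h₂ : IsComplexConn cov₂) {j m : ℕ} {a : Π x, Ten n j E x →ₗ[ℂ] Ten n m E x} {a' a''}
    (h : homDeriv (tenDeriv D (bundleDeriv cov₂) j) (tenDeriv D (bundleDeriv cov₁) m) a a')
    (h' : homDeriv (tenDeriv D (bundleDeriv cov₂) j) (tenDeriv D (bundleDeriv cov₁) m) a a'') :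
    a' = a'' := by
  funext x v
  refine LinearMap.ext fun T₀ => ?_
  obtain ⟨T, T', hT, rfl⟩ := exists_tenDeriv_eq hD h₂ T₀
  have h3 := (isConnRel_tenDeriv hD (isFrameRel_bundleDeriv h₁).toIsConnRel m).unique
    (h T T' hT) (h' T T' hT)
  exact add_right_cancel (congrFun (congrFun h3 x) v)

/-- Composition with the symmetrization is parallel. -/
theorem homDeriv_compSym (h₂ : IsComplexConn cov₂) {j m : ℕ}
    {a : Π x, Ten n j E x →ₗ[ℂ] Ten n m E x} {a'}
    (h : homDeriv (tenDeriv D (bundleDeriv cov₂) j) (tenDeriv D (bundleDeriv cov₁) m) a a') :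
    homDeriv (tenDeriv D (bundleDeriv cov₂) j) (tenDeriv D (bundleDeriv cov₁) m)
      (fun x => compSym j (Ten n m E x) (a x)) (fun x v => compSym j (Ten n m E x) (a' x v)) :=
  fun _ _ hT => h _ _ (tenDeriv_symR (isFrameRel_bundleDeriv h₂).add
    (isFrameRel_bundleDeriv h₂).zero j hT)

/-- The bundle map `c ↦ c ∘ sym` is parallel, for the connections on both sides. -/
theorem homDeriv_endSym (h₂ : IsComplexConn cov₂) {j : ℕ}
    {c : Π x, E x →ₗ[ℂ] E x} {c'}
    (h : homDeriv (bundleDeriv cov₂) (bundleDeriv cov₁) c c') :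
    homDeriv (tenDeriv D (bundleDeriv cov₂) j) (tenDeriv D (bundleDeriv cov₁) j)
      (fun x => endSym j (c x)) (fun x v => endSym j (c' x v)) := by
  intro T T' hT Y hY
  have h3 := tenDeriv_symR (isFrameRel_bundleDeriv h₂).add (isFrameRel_bundleDeriv h₂).zero j hT
  refine rel_congr (h _ _ (h3 Y hY)) rfl ?_
  funext x v
  simp only [endSym, LinearMap.coe_mk, AddHom.coe_mk, symC_apply, add_apply,
    LinearMap.compMultilinearMap_apply, LinearMap.restrictScalars_apply, map_add, map_sum,
    add_assoc]

theorem iteratedDeriv_compSym (h₂ : IsComplexConn cov₂) {j m : ℕ}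
    {a : Π x, Ten n j E x →ₗ[ℂ] Ten n m E x}
    {S : ∀ k, Π x, Ten n k (fun x => Ten n j E x →ₗ[ℂ] Ten n m E x) x}
    (hS : IteratedDeriv D
      (homDeriv (tenDeriv D (bundleDeriv cov₂) j) (tenDeriv D (bundleDeriv cov₁) m)) a S) :
    IteratedDeriv D
      (homDeriv (tenDeriv D (bundleDeriv cov₂) j) (tenDeriv D (bundleDeriv cov₁) m))
      (fun x => compSym j (Ten n m E x) (a x))
      (fun k x => (compSym j (Ten n m E x)).compMultilinearMap (S k x)) :=
  IteratedDeriv.map (V := fun x => Ten n j E x →ₗ[ℂ] Ten n m E x)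
    (W := fun x => Ten n j E x →ₗ[ℂ] Ten n m E x) (fun x => compSym j (Ten n m E x))
    (fun _ _ hs => homDeriv_compSym h₂ hs) hS

theorem iteratedDeriv_endSym (h₂ : IsComplexConn cov₂) {j : ℕ} {c : Π x, E x →ₗ[ℂ] E x}
    {C : ∀ k, Π x, Ten n k (fun x : M => E x →ₗ[ℂ] E x) x}
    (hC : IteratedDeriv D (homDeriv (bundleDeriv cov₂) (bundleDeriv cov₁)) c C) :
    IteratedDeriv D
      (homDeriv (tenDeriv D (bundleDeriv cov₂) j) (tenDeriv D (bundleDeriv cov₁) j))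
      (fun x => (endSym j (c x) : Ten n j E x →ₗ[ℂ] Ten n j E x))
      (fun k x => (endSym (T := Tan n x) j).compMultilinearMap (C k x)) :=
  IteratedDeriv.map (V := fun x => E x →ₗ[ℂ] E x)
    (W := fun x => Ten n j E x →ₗ[ℂ] Ten n j E x) (fun x => endSym (T := Tan n x) j)
    (fun _ _ hs => homDeriv_endSym h₂ hs) hC

variable [RiemannianBundle (fun x : M => TangentSpace (𝓡 n) x)] [∀ x, FiniteDimensional ℂ (E x)]

/-- The operator `∇^μ` has bounded coefficients. -/
theorem exists_mem_diffB (hD : IsSmoothConn D) (h : IsComplexConn cov) (μ : ℕ) :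
    ∃ P ∈ DiffB D cov cov μ μ, ∀ (u : TestSection n FE E) U,
      IteratedDeriv D (bundleDeriv cov) u.1 U → P u = U μ := by
  have hR := isFrameRel_bundleDeriv h
  have hk := fun k => isConnRel_tenDeriv hD hR.toIsConnRel k
  choose U hU using fun u : TestSection n FE E =>
    exists_iteratedDeriv hD hR.toIsConnRel (s := u.1) ⟨u.2.1, fun _ _ => rfl⟩
  refine ⟨fun u => U u μ, ⟨Pi.single μ fun x => LinearMap.id, fun j _ => ?_, fun u =>
    ⟨U u, hU u, fun x => ?_⟩⟩, fun u V hV => ?_⟩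
  · have hz : homDeriv (tenDeriv D (bundleDeriv cov) j) (tenDeriv D (bundleDeriv cov) μ)
        (fun _ => 0) fun _ _ => 0 := fun s s' _ => by simpa using (hk μ).zero
    rcases eq_or_ne j μ with rfl | hj
    · rw [Pi.single_eq_same]
      refine isTotallyBounded_of_parallel hz (fun s s' hs => by simpa using hs)
        (coeffNorm_zero (E := E) (F := E)) (c := (n ^ j * Module.finrank ℂ FE : ℕ) * 1) fun x => ?_
      rw [← finrank_fibre (FE := FE) (E := E) x]
      exact coeffNorm_sq_le x _ fun T => by rw [one_mul, LinearMap.id_apply]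
    · rw [Pi.single_eq_of_ne hj]
      exact isTotallyBounded_of_parallel hz hz (coeffNorm_zero (E := E) (F := E)) (c := 0)
        fun x => (coeffNorm_zero (E := E) (F := E) x).le
  · rw [Finset.sum_eq_single μ]
    · rw [Pi.single_eq_same, LinearMap.id_apply]
    · intro j _ hj
      rw [Pi.single_eq_of_ne hj, Pi.zero_apply, LinearMap.zero_apply]
    · simp
  · exact congrFun (IteratedDeriv.unique (R := bundleDeriv cov) hD hR.unique (hU u) hV) μ

/-- If `∇^μ` is a `∇̃`-differential operator with bounded coefficients, then its leading coefficient
acts as the identity on symmetric tensors, as is seen from sections with prescribed jets. -/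
theorem exists_coeff_symR (hD : IsSmoothConn D) (h : IsComplexConn cov) (h₂ : IsComplexConn cov₂)
    {μ : ℕ} (hdiff : DiffB D cov cov μ μ ⊆ DiffB D cov₂ cov μ μ) :
    ∃ a : Π x, Ten n μ E x →ₗ[ℂ] Ten n μ E x,
      IsTotallyBounded D
        (homDeriv (tenDeriv D (bundleDeriv cov₂) μ) (tenDeriv D (bundleDeriv cov) μ))
        (coeffNorm (tenNorm bundleNorm)) a ∧
      ∀ x T, a x (symR μ T) = symR μ T := by
  obtain ⟨P, hP, hPU⟩ := exists_mem_diffB hD h μ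
  obtain ⟨a, ha, hPa⟩ := hdiff hP
  refine ⟨a μ, ha μ le_rfl, fun x T => ?_⟩
  have key : ∀ (ξ : Fin μ → Tan n x →ₗ[ℝ] ℝ) (e : E x),
      a μ x (symR μ (pureTen ξ e)) = symR μ (pureTen ξ e) := by
    intro ξ e
    obtain ⟨u, hu⟩ := exists_testSection_jet (FE := FE) hD x μ ξ e
    obtain ⟨U, hU⟩ := exists_iteratedDeriv hD (isFrameRel_bundleDeriv h).toIsConnRel
      (s := u.1) ⟨u.2.1, fun _ _ => rfl⟩
    obtain ⟨V, hV, hPV⟩ := hPa u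
    obtain ⟨-, h3⟩ := hu cov h U hU
    obtain ⟨h4, h5⟩ := hu cov₂ h₂ V hV
    have h6 := hPV x
    rw [hPU u U hU, Finset.sum_range_succ, Finset.sum_eq_zero, zero_add, h3, h5] at h6
    · exact h6.symm
    · intro j hj
      rw [h4 j (Finset.mem_range.1 hj), map_zero]
  rw [eq_sum_tenFrame x T, map_sum, map_sum]
  exact Finset.sum_congr rfl fun I _ => key _ _

/-- The components of `c` are read off from those of `a` at the symmetric tensors `ξ ⊗ ⋯ ⊗ ξ ⊗ e`,
for which one unit covector `ξ` suffices. -/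
theorem hsSq_le_of_compSym_eq {x : M} {μ : ℕ} (hn : 0 < n)
    {a : Ten n μ E x →ₗ[ℂ] Ten n μ E x} {c : E x →ₗ[ℂ] E x}
    (h : compSym μ (Ten n μ E x) a = endSym μ c) :
    hsSq c ≤ coeffNorm (tenNorm bundleNorm) x a ^ 2 := by
  let I : Fin μ → Fin (Module.finrank ℝ (Tan n x)) := fun _ => ⟨0, by rwa [finrank_tan]⟩
  have key : ∀ e : E x, a (tenFrame x I e) = tenFrame x I (c e) := fun e =>
    map_pureTen_const_of_compSym_eq (T := Tan n x) (V := E x) (a := a) (c := c) h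
      (innerSL ℝ (tanBasis n x ⟨0, by rwa [finrank_tan]⟩)).toLinearMap e
  rw [coeffNorm_sq, Fintype.sum_prod_type]
  refine le_trans (le_of_eq ?_) (Finset.single_le_sum (fun J _ => Finset.sum_nonneg fun _ _ =>
    sq_nonneg _) (Finset.mem_univ I))
  refine Finset.sum_congr rfl fun i _ => ?_
  rw [key, tenNorm_bundleNorm_sq, tenSq_tenFrame]

/-- The iterated derivatives of the identity between the two connections are bounded. -/
theorem exists_tenSq_transition_le (hD : IsSmoothConn D) (h : IsComplexConn cov)
    (h₂ : IsComplexConn cov₂) {μ : ℕ} (hn : 0 < n)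
    (hdiff : DiffB D cov cov μ μ ⊆ DiffB D cov₂ cov μ μ) {C}
    (hC : IteratedDeriv D (homDeriv (bundleDeriv cov₂) (bundleDeriv cov))
      (fun _ => LinearMap.id) C) (k : ℕ) :
    ∃ c : ℝ, ∀ x, tenSq (tanBasis n x) hsSq (C k x) ≤ c := by
  obtain ⟨a, ⟨S, hS, hSb⟩, ha⟩ := exists_coeff_symR hD h h₂ hdiff
  obtain ⟨c, hc⟩ := (exists_tenNorm_le_iff (fun x (b : Ten n μ E x →ₗ[ℂ] Ten n μ E x) =>
    coeffNorm (tenNorm bundleNorm) x b) (S k)).1 (hSb k)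
  refine ⟨c, fun x => le_trans ?_ (hc x)⟩
  have h3 := iteratedDeriv_compSym h₂ hS
  have h4 := iteratedDeriv_endSym (j := μ) h₂ hC
  have h5 : (fun x => compSym μ (Ten n μ E x) (a x)) =
      fun x => endSym μ (LinearMap.id : E x →ₗ[ℂ] E x) := by
    funext x
    refine LinearMap.ext fun T => (ha x T).trans ?_
    ext v
    rfl
  rw [h5] at h3
  have h6 := IteratedDeriv.unique (R := homDeriv (tenDeriv D (bundleDeriv cov₂) μ)
    (tenDeriv D (bundleDeriv cov) μ)) hD (homDeriv_tenDeriv_unique hD h h₂) h3 h4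
  refine Finset.sum_le_sum fun I _ => hsSq_le_of_compSym_eq hn ?_
  exact DFunLike.congr_fun (congrFun (congrFun h6 k) x) fun i => tanBasis n x (I i)

/-- The recursion between the iterated derivatives of `A` and those of the identity is solved for
the former. -/
theorem totallyBoundedForm_of_diffB_subset (hD : IsSmoothConn D) (h : IsComplexConn cov)
    {A : Π x, Ten n 1 (fun x : M => E x →ₗ[ℂ] E x) x} (hA : SmoothOneForm FE A) {μ : ℕ}
    (hdiff : DiffB D cov cov μ μ ⊆ DiffB D (addForm cov A) cov μ μ) :
    TotallyBoundedForm D cov A := by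
  obtain ⟨S, hS⟩ := exists_iteratedDeriv_form hD h hA
  obtain ⟨C, hC, hr⟩ := exists_transition_left hD h hA hS
  have hb : ∀ m, ∃ c : ℝ, ∀ x, tenSq (tanBasis n x) (tenSq (tanBasis n x) hsSq) (S m x) ≤ c := by
    rcases Nat.eq_zero_or_pos n with hn | hn
    · -- there are no nonzero forms in dimension zero
      refine fun m => ⟨0, fun x => (Finset.sum_eq_zero fun I _ => ?_).le⟩
      have : IsEmpty (Fin (Module.finrank ℝ (Tan n x))) := by
        rw [finrank_tan, hn]; infer_instance
      exact Finset.sum_eq_zero fun J _ => isEmptyElim (J 0)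
    · choose c hc using fun k => exists_tenSq_transition_le hD h (h.addForm hA) hn hdiff hC k
      intro m
      induction m using Nat.strong_induction_on with
      | _ m ih =>
        have ih' : ∀ j, ∃ b : ℝ, j < m → ∀ x,
            tenSq (tanBasis n x) (tenSq (tanBasis n x) hsSq) (S j x) ≤ b := by
          intro j
          by_cases hj : j < m
          · obtain ⟨b, hb⟩ := ih j hj
            exact ⟨b, fun _ => hb⟩
          · exact ⟨0, fun hj' => absurd hj' hj⟩
        choose b hb using ih'
        refine ⟨2 * (c (m + 1) + 4 ^ m * (∑ j ∈ Finset.range m, b j) *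
          ∑ j ∈ Finset.range (m + 1), c j), fun x => ?_⟩
        refine (tenSq_le_of_split_eq_leib (tanBasis n x) hsSq_nonneg hsSq_nonneg hsSq_add_le
          hsSq_neg (by simp [hsSq]) (β := -endComp (E x)) (fun f g => ?_)
          (C := fun j => C j x) (S := fun j => S j x) (hr x) (fun f => ?_) m).trans ?_
        · simp only [LinearMap.neg_apply, endComp_apply, hsSq_neg]
          exact hsSq_comp_le f g
        · rw [hC.1]
          simp only [LinearMap.neg_apply, endComp_apply, hsSq_neg]
          rfl
        · have h0 := sum_tenSq_nonneg (tanBasis n x) hsSq_nonneg (fun j => C j x) (m + 1)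
          have h1 : ∑ j ∈ Finset.range m,
              tenSq (tanBasis n x) (tenSq (tanBasis n x) hsSq) (S j x) ≤
                ∑ j ∈ Finset.range m, b j :=
            Finset.sum_le_sum fun j hj => hb j (Finset.mem_range.1 hj) x
          have h2 : ∑ j ∈ Finset.range (m + 1), tenSq (tanBasis n x) hsSq (C j x) ≤
              ∑ j ∈ Finset.range (m + 1), c j := Finset.sum_le_sum fun j _ => hc j x
          have h3 := (sum_tenSq_nonneg (tanBasis n x) (tenSq_nonneg _ hsSq_nonneg)
            (fun j => S j x) m).trans h1
          have h4 := hc (m + 1) x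
          gcongr
  refine ⟨S, hS, fun k => ?_⟩
  obtain ⟨c, hc⟩ := hb k
  refine ⟨√c, fun x => Real.le_sqrt_of_sq_le ?_⟩
  rw [tenNorm_tenNorm_endNorm_sq]
  exact hc x

end Converse

end

end NablaSobolev

theorem mainTheorem2 :
    ∃ C : ℕ → ℝ≥0 → ℝ≥0, (∀ l K, 1 ≤ C l K) ∧
    -- a Riemannian manifold `M` of dimension `n` with its Levi-Civita connection `D`
    ∀ (n : ℕ) (M : Type u) [TopologicalSpace M] [ChartedSpace (EuclideanSpace ℝ (Fin n)) M]
      [IsManifold (𝓡 n) ∞ M] [T2Space M] [SecondCountableTopology M]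
      [MeasurableSpace M] [BorelSpace M]
      [RiemannianBundle (fun x : M => TangentSpace (𝓡 n) x)]
      [IsContMDiffRiemannianBundle (𝓡 n) ∞ (EuclideanSpace ℝ (Fin n))
        (fun x : M => TangentSpace (𝓡 n) x)]
      (D : CovariantDerivative (𝓡 n) (EuclideanSpace ℝ (Fin n))
        (fun x : M => TangentSpace (𝓡 n) x)),
      IsLeviCivita D →
    -- a hermitian vector bundle `E` with a metric preserving connection `cov`
    ∀ (FE : Type v) [NormedAddCommGroup FE] [NormedSpace ℂ FE] [FiniteDimensional ℂ FE]
      (E : M → Type w) [TopologicalSpace (TotalSpace FE E)] [∀ x, NormedAddCommGroup (E x)]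
      [∀ x, InnerProductSpace ℂ (E x)] [∀ x, FiniteDimensional ℂ (E x)] [FiberBundle FE E]
      [VectorBundle ℂ FE E] [VectorBundle ℝ FE E] [ContMDiffVectorBundle ∞ FE E (𝓡 n)]
      (cov : CovariantDerivative (𝓡 n) FE E), SmoothMetric n FE E → IsMetricConnection cov →
    -- a smooth skew-adjoint section `A` of `T*M ⊗ End(E)`
    ∀ A : Π x, Ten n 1 (fun x : M => E x →ₗ[ℂ] E x) x,
      SmoothOneForm FE A → SkewAdjoint A →
    -- (i)
    (∀ μ : ℕ,
      (TotallyBoundedForm D cov A ↔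
        ∀ (FF : Type v) [NormedAddCommGroup FF] [NormedSpace ℂ FF] [FiniteDimensional ℂ FF]
          (F : M → Type w) [TopologicalSpace (TotalSpace FF F)] [∀ x, NormedAddCommGroup (F x)]
          [∀ x, InnerProductSpace ℂ (F x)] [FiberBundle FF F]
          [VectorBundle ℂ FF F] [VectorBundle ℝ FF F] [ContMDiffVectorBundle ∞ FF F (𝓡 n)]
          (covF : CovariantDerivative (𝓡 n) FF F), SmoothMetric n FF F →
          IsMetricConnection covF →
          ∀ m : ℕ, DiffB D cov covF μ m = DiffB D (addForm cov A) covF μ m) ∧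
      (DiffB D cov cov μ μ = DiffB D (addForm cov A) cov μ μ → TotallyBoundedForm D cov A)) ∧
    -- (ii)
    (∀ (l : ℕ) (p : ℝ≥0∞), 1 ≤ p → (1 ≤ l → formSobolevNorm D cov (l - 1) ⊤ A < ⊤) →
      (∀ u : Π x, E x,
        (C l (formSobolevNorm D cov (l - 1) ⊤ A).toNNReal : ℝ≥0∞)⁻¹ * sobolevNorm D cov l p u
            ≤ sobolevNorm D (addForm cov A) l p u ∧
          sobolevNorm D (addForm cov A) l p u
            ≤ C l (formSobolevNorm D cov (l - 1) ⊤ A).toNNReal * sobolevNorm D cov l p u) ∧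
      sobolevSpace D cov l p = sobolevSpace D (addForm cov A) l p) := by
  refine ⟨sobolevConst, one_le_sobolevConst, ?_⟩
  intro n M _ _ _ _ _ _ _ _ _ D hLC FE _ _ _ E _ _ _ _ _ _ _ _ cov hE hcov A hA hskew
  have hD := hLC.isSmoothConn
  have h := hcov.isComplexConn
  refine ⟨fun μ => ⟨⟨fun hb => ?_, fun hdiff => ?_⟩, fun hdiff => ?_⟩, fun l p hp hK => ?_⟩
  · intro FF _ _ _ F _ _ _ _ _ _ _ covF hF hcovF m
    exact diffB_eq hD h hcovF.isComplexConn hA hb μ m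
  · exact totallyBoundedForm_of_diffB_subset hD h hA (hdiff FE E cov hE hcov μ).le
  · exact totallyBoundedForm_of_diffB_subset hD h hA hdiff.le
  · have h1 := fun u => sobolevNorm_le (p := p) hE hD h hA hK (Or.inl ⟨rfl, rfl⟩) hp u
    have h2 := fun u => sobolevNorm_le (p := p) hE hD h hA hK (Or.inr ⟨rfl, rfl⟩) hp u
    have h3 : (sobolevConst l (formSobolevNorm D cov (l - 1) ⊤ A).toNNReal : ℝ≥0∞) ≠ 0 :=
      ENNReal.coe_ne_zero.2 (zero_lt_one.trans_le (one_le_sobolevConst _ _)).ne'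
    refine ⟨fun u => ⟨(ENNReal.inv_mul_le_iff h3 ENNReal.coe_ne_top).2 (h2 u), h1 u⟩,
      Set.ext fun u => ⟨fun hu => ?_, fun hu => ?_⟩⟩
    · exact (h1 u).trans_lt (ENNReal.mul_lt_top ENNReal.coe_lt_top hu)
    · exact (h2 u).trans_lt (ENNReal.mul_lt_top ENNReal.coe_lt_top hu)
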